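/- Let $p,q:\mathbb R\to\mathbb C$ be $\pi$-periodic functions of bounded variation on $[0,\pi]$, put $J=\begin{pmatrix}0&1\\-1&0\end{pmatrix}$, $Q=\begin{pmatrix}p&q\\q&-p\end{pmatrix}$ and $l(\mathbf y)=J\mathbf y'+Q\mathbf y$. Let $L(Q)$ be the operator generated by $l$ in $L^2(\mathbb R;\mathbb C^2)$ and, for $t\in\mathbb C$, let $L_t(Q)$ be the operator generated by $l$ in $L^2([0,\pi];\mathbb C^2)$ with the boundary condition $\mathbf y(\pi)=e^{i\pi t}\mathbf y(0)$ (both on their maximal domains). A point $\lambda_0\in\sigma(L(Q))$ is called a *spectral singularity* of $L(Q)$ if for every $\varepsilon>0$ there is a sequence of simple closed piecewise $C^1$ contours $\gamma_n\subset\{|z-\lambda_0|<\varepsilon\}$ such that, for each $n$ and each $t\in(-1,1]$, $\gamma_n$ encloses at most one eigenvalue of $L_t(Q)$ counted with algebraic multiplicity, and $$\lim_{n\to\infty}\ \sup_t\ \Big\|\int_{\gamma_n}(L_t(Q)-zI)^{-1}\,dz\Big\|=\infty ,$$ the supremum being over all $t\in(-1,1]$ for which $\gamma_n$ lies in the resolvent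 set of $L_t(Q)$. A point $\lambda_0$ is called an *essential spectral singularity* of $L(Q)$ if there are $t_1\in(-1,1]$ and a continuous branch $\lambda(t)$ of eigenvalues of $L_t(Q)$, defined for real $t$ near $t_1$, with $\lambda(t_1)=\lambda_0$, such that for every $\varepsilon>0$ the function $1/|\alpha(t)|$ is not integrable on $(t_1-\varepsilon,t_1+\varepsilon)$; here $\alpha(t)=(\Psi_t,\Psi_t^*)$, where $\Psi_t$ is a normalized eigenfunction of $L_t(Q)$ for $\lambda(t)$ and $\Psi_t^*$ is a normalized eigenfunction of $(L_t(Q))^*$ for $\overline{\lambda(t)}$. **Theorem.** Let $t_0\in(-1,1]$, $t_0\neq 0,1$, and let $\lambda_0$ be a multiple eigenvalue of $L_{t_0}(Q)$, that is, an eigenvalue of algebraic multiplicity at least $2$. Then $\lambda_0$ is a spectral singularity of $L(Q)$ and is not an essential spectral singularity of $L(Q)$. -/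

import Mathlib

open MeasureTheory Set Filter Topology

noncomputable section

namespace Dirac

/-! ### Unbounded operators: resolvent, spectrum, eigenvectors, multiplicity -/

section Operators

variable {E : Type*} [NormedAddCommGroup E] [NormedSpace ℂ E]

/-- The bounded operator `R` is the two-sided inverse of `T - z`. -/
def IsResolventAt (T : E →ₗ.[ℂ] E) (z : ℂ) (R : E →L[ℂ] E) : Prop :=
  (∀ f : E, ∃ h : R f ∈ T.domain, T ⟨R f, h⟩ - z • R f = f) ∧
    ∀ y : T.domain, R (T y - z • (y : E)) = y

/-- The resolvent set of `T`. -/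
def resolventSet (T : E →ₗ.[ℂ] E) : Set ℂ := {z | ∃ R : E →L[ℂ] E, IsResolventAt T z R}

/-- The spectrum of `T`. -/
def spectrum (T : E →ₗ.[ℂ] E) : Set ℂ := (resolventSet T)ᶜ

open Classical in
/-- The resolvent `(T - z)⁻¹` (zero outside the resolvent set). -/
def resolvent (T : E →ₗ.[ℂ] E) (z : ℂ) : E →L[ℂ] E :=
  if h : ∃ R : E →L[ℂ] E, IsResolventAt T z R then h.choose else 0

/-- `y` is an eigenvector of `T` with eigenvalue `z`. -/
def IsEigenvector (T : E →ₗ.[ℂ] E) (z : ℂ) (y : E) : Prop :=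
  y ≠ 0 ∧ ∃ h : y ∈ T.domain, T ⟨y, h⟩ = z • y

/-- `z` is an eigenvalue of `T`. -/
def IsEigenvalue (T : E →ₗ.[ℂ] E) (z : ℂ) : Prop := ∃ y : E, IsEigenvector T z y

/-- The kernel of `(T - z) ^ k`: a vector lies in the kernel of `(T - z) ^ (k + 1)` iff it lies in
the domain of `T` and `T - z` sends it into the kernel of `(T - z) ^ k`. -/
def kerPow (T : E →ₗ.[ℂ] E) (z : ℂ) : ℕ → Submodule ℂ E
  | 0 => ⊥
  | k + 1 =>
    (T.graph ⊓ (kerPow T z k).comap (LinearMap.snd ℂ E E - z • LinearMap.fst ℂ E E)).map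
      (LinearMap.fst ℂ E E)

/-- The algebraic multiplicity of `z` as an eigenvalue of `T`: the dimension of the space of all
root vectors (eigenvectors and associated vectors) of `T` at `z`; it is `0` if `z` is not an
eigenvalue. -/
def algMultiplicity (T : E →ₗ.[ℂ] E) (z : ℂ) : ℕ∞ :=
  Cardinal.toENat (Module.rank ℂ (⨆ k : ℕ, kerPow T z k : Submodule ℂ E))

end Operators

/-! ### The Dirac operators -/

/-- `ℂ²` with its Euclidean norm. -/
abbrev C2 : Type := EuclideanSpace ℂ (Fin 2)

/-- The space `L²(s; ℂ²)`. -/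
abbrev L2 (s : Set ℝ) : Type := Lp C2 2 (volume.restrict s)

/-- `u` is absolutely continuous on the compact subintervals of the interval `s`, with
derivative `g` almost everywhere: `u` is an indefinite integral of `g`. -/
def IsPrimitive (s : Set ℝ) (u g : ℝ → C2) : Prop :=
  ∀ a ∈ s, ∀ b ∈ s, IntervalIntegrable g volume a b ∧ u b - u a = ∫ x in a..b, g x

/-- The differential expression `J u' + Q u`, where `J = (0 1; -1 0)`, `Q = (p q; q -p)`
and `g` stands for `u'`. -/
def diracExpr (p q : ℝ → ℂ) (u g : ℝ → C2) (x : ℝ) : C2 :=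
  WithLp.toLp 2 (Matrix.mulVec !![0, 1; -1, 0] (g x).ofLp +
    Matrix.mulVec !![p x, q x; q x, -p x] (u x).ofLp)

lemma diracExpr_add (p q : ℝ → ℂ) (u g u' g' : ℝ → C2) (x : ℝ) :
    diracExpr p q (u + u') (g + g') x = diracExpr p q u g x + diracExpr p q u' g' x := by
  simp only [diracExpr, Pi.add_apply, WithLp.ofLp_add, Matrix.mulVec_add, ← WithLp.toLp_add]
  congr 1
  abel

lemma diracExpr_smul (p q : ℝ → ℂ) (c : ℂ) (u g : ℝ → C2) (x : ℝ) :
    diracExpr p q (c • u) (c • g) x = c • diracExpr p q u g x := by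
  simp only [diracExpr, Pi.smul_apply, WithLp.ofLp_smul, Matrix.mulVec_smul, ← WithLp.toLp_smul,
    smul_add]

lemma IsPrimitive.add {s : Set ℝ} {u g u' g' : ℝ → C2} (h : IsPrimitive s u g)
    (h' : IsPrimitive s u' g') : IsPrimitive s (u + u') (g + g') := by
  intro a ha b hb
  refine ⟨(h a ha b hb).1.add (h' a ha b hb).1, ?_⟩
  simp only [Pi.add_apply]
  rw [intervalIntegral.integral_add (h a ha b hb).1 (h' a ha b hb).1, ← (h a ha b hb).2,
    ← (h' a ha b hb).2]
  abel

lemma IsPrimitive.smul {s : Set ℝ} {u g : ℝ → C2} (c : ℂ) (h : IsPrimitive s u g) :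
    IsPrimitive s (c • u) (c • g) := by
  intro a ha b hb
  refine ⟨(h a ha b hb).1.smul c, ?_⟩
  simp only [Pi.smul_apply]
  rw [intervalIntegral.integral_smul, ← (h a ha b hb).2, smul_sub]

lemma isPrimitive_zero (s : Set ℝ) : IsPrimitive s 0 0 := by
  intro a _ b _
  exact ⟨intervalIntegrable_const (c := (0 : C2)), by simp⟩

/-- The graph of the operator generated in `L²(s; ℂ²)` by the differential expression on the
maximal domain, subject to the boundary conditions `bc`: the pairs `(y, f)` for which `y` is
(represented by) a locally absolutely continuous function `u` satisfying `bc`, and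
`J u' + Q u = f` almost everywhere on `s`. -/
def diracGraph (p q : ℝ → ℂ) (s : Set ℝ) (bc : Submodule ℂ (ℝ → C2)) :
    Submodule ℂ (L2 s × L2 s) where
  carrier := {yf | ∃ u g : ℝ → C2, IsPrimitive s u g ∧ u ∈ bc ∧
    yf.1 =ᵐ[volume.restrict s] u ∧ yf.2 =ᵐ[volume.restrict s] diracExpr p q u g}
  zero_mem' := by
    refine ⟨0, 0, isPrimitive_zero s, bc.zero_mem, Lp.coeFn_zero _ _ _, ?_⟩
    refine (Lp.coeFn_zero _ _ _).trans (Eventually.of_forall fun x => ?_)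
    simp [diracExpr]
  add_mem' := by
    rintro ⟨y, f⟩ ⟨y', f'⟩ ⟨u, g, h, hb, hy, hf⟩ ⟨u', g', h', hb', hy', hf'⟩
    refine ⟨u + u', g + g', h.add h', bc.add_mem hb hb', ?_, ?_⟩
    · exact (Lp.coeFn_add _ _).trans (hy.add hy')
    · refine (Lp.coeFn_add _ _).trans ?_
      filter_upwards [hf, hf'] with x hx hx'
      simp only [Pi.add_apply, diracExpr_add]
      rw [hx, hx']
  smul_mem' := by
    rintro c ⟨y, f⟩ ⟨u, g, h, hb, hy, hf⟩
    refine ⟨c • u, c • g, h.smul c, bc.smul_mem c hb, ?_, ?_⟩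
    · exact (Lp.coeFn_smul _ _).trans (hy.const_smul c)
    · refine (Lp.coeFn_smul _ _).trans ?_
      filter_upwards [hf] with x hx
      simp only [Pi.smul_apply, diracExpr_smul]
      rw [hx]

/-- The quasi-periodic boundary condition `u(π) = e^{iπt} u(0)`. -/
def quasiPeriodic (t : ℂ) : Submodule ℂ (ℝ → C2) where
  carrier := {u | u Real.pi = Complex.exp (Complex.I * Real.pi * t) • u 0}
  zero_mem' := by simp
  add_mem' := by
    intro u v hu hv
    simp only [mem_ofPred_eq, Pi.add_apply, smul_add] at *
    rw [hu, hv]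
  smul_mem' := by
    intro c u hu
    simp only [mem_ofPred_eq, Pi.smul_apply] at *
    rw [hu, smul_comm]

/-- The operator `L(Q)` in `L²(ℝ; ℂ²)`. -/
def opLine (p q : ℝ → ℂ) : L2 univ →ₗ.[ℂ] L2 univ :=
  (diracGraph p q univ ⊤).toLinearPMap

/-- The operator `L_t(Q)` in `L²([0, π]; ℂ²)`. -/
def op (p q : ℝ → ℂ) (t : ℂ) : L2 (Icc 0 Real.pi) →ₗ.[ℂ] L2 (Icc 0 Real.pi) :=
  (diracGraph p q (Icc 0 Real.pi) (quasiPeriodic t)).toLinearPMap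

/-! The two graphs are single-valued, so that they are the graphs of the two operators. -/

lemma IsPrimitive.ae_eq_zero_Icc {a b : ℝ} (hab : a < b) {u g : ℝ → C2}
    (h : IsPrimitive (Icc a b) u g) (hu : u =ᵐ[volume.restrict (Icc a b)] 0) :
    g =ᵐ[volume.restrict (Icc a b)] 0 := by
  have ha : a ∈ Icc a b := left_mem_Icc.2 hab.le
  have hb : b ∈ Icc a b := right_mem_Icc.2 hab.le
  have hI := (h a ha b hb).1
  have hcont : ContinuousOn u (Icc a b) := by
    have h1 : ContinuousOn (fun x => u a + ∫ y in a..x, g y) (Icc a b) := by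
      refine continuousOn_const.add ?_
      have := intervalIntegral.continuousOn_primitive_interval' hI left_mem_uIcc
      rwa [uIcc_of_le hab.le] at this
    refine h1.congr fun x hx => ?_
    simp [← (h a ha x hx).2]
  have h0 : EqOn u 0 (Icc a b) :=
    Measure.eqOn_Icc_of_ae_eq volume hab.ne hu hcont continuousOn_const
  have hd := hI.ae_hasDerivAt_integral
  have hne : ∀ᵐ x : ℝ, x ∉ ({a, b} : Set ℝ) :=
    (measure_eq_zero_iff_ae_notMem (μ := volume)).1 ((Set.toFinite {a, b}).measure_zero volume)
  rw [EventuallyEq, ae_restrict_iff' measurableSet_Icc]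
  filter_upwards [hd, hne] with x hx hxn hxI
  simp only [mem_insert_iff, mem_singleton_iff, not_or] at hxn
  have hxo : x ∈ Ioo a b :=
    ⟨lt_of_le_of_ne hxI.1 (Ne.symm hxn.1), lt_of_le_of_ne hxI.2 hxn.2⟩
  have hx' := hx (by rwa [uIcc_of_le hab.le]) a (by simp)
  have h2 : (fun z => ∫ y in a..z, g y) =ᶠ[𝓝 x] fun _ => (0 : C2) := by
    filter_upwards [Ioo_mem_nhds hxo.1 hxo.2] with z hz
    rw [← (h a ha z ⟨hz.1.le, hz.2.le⟩).2, h0 ⟨hz.1.le, hz.2.le⟩, h0 ha]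
    simp
  exact hx'.unique ((hasDerivAt_const x (0 : C2)).congr_of_eventuallyEq h2)

lemma IsPrimitive.ae_eq_zero_univ {u g : ℝ → C2}
    (h : IsPrimitive univ u g) (hu : u =ᵐ[volume] 0) : g =ᵐ[volume] 0 := by
  have key : ∀ n : ℕ, ∀ᵐ x : ℝ, x ∈ Icc (-(n + 1 : ℝ)) (n + 1) → g x = 0 := by
    intro n
    have hn : (-(n + 1 : ℝ)) < n + 1 := by
      have : (0 : ℝ) ≤ n := n.cast_nonneg
      linarith
    have := IsPrimitive.ae_eq_zero_Icc hn (u := u) (g := g)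
      (fun a _ b _ => h a (mem_univ _) b (mem_univ _)) (ae_restrict_of_ae hu)
    rwa [EventuallyEq, ae_restrict_iff' measurableSet_Icc] at this
  filter_upwards [ae_all_iff.2 key] with x hx
  obtain ⟨n, hn⟩ := exists_nat_ge |x|
  refine hx n ⟨?_, ?_⟩
  · have := neg_abs_le x
    linarith
  · have := le_abs_self x
    linarith

lemma diracGraph_single_valued {p q : ℝ → ℂ} {s : Set ℝ} {bc : Submodule ℂ (ℝ → C2)}
    (hs : ∀ u g : ℝ → C2, IsPrimitive s u g → u =ᵐ[volume.restrict s] 0 →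
      g =ᵐ[volume.restrict s] 0) :
    ∀ yf ∈ diracGraph p q s bc, yf.1 = 0 → yf.2 = 0 := by
  rintro ⟨y, f⟩ ⟨u, g, h, -, hy, hf⟩ h0
  have hy0 : y =ᵐ[volume.restrict s] 0 := by
    have h0' : y = 0 := h0
    rw [h0']
    exact Lp.coeFn_zero _ _ _
  have hu : u =ᵐ[volume.restrict s] 0 := hy.symm.trans hy0
  have hg := hs u g h hu
  refine Lp.ext (hf.trans ((?_ : _ =ᵐ[_] _).trans (Lp.coeFn_zero _ _ _).symm))
  filter_upwards [hu, hg] with x hx hx'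
  simp [diracExpr, hx, hx']

lemma op_graph (p q : ℝ → ℂ) (t : ℂ) :
    (op p q t).graph = diracGraph p q (Icc 0 Real.pi) (quasiPeriodic t) :=
  Submodule.toLinearPMap_graph_eq _ (diracGraph_single_valued fun _ _ h hu =>
    h.ae_eq_zero_Icc Real.pi_pos hu)

lemma opLine_graph (p q : ℝ → ℂ) : (opLine p q).graph = diracGraph p q univ ⊤ :=
  Submodule.toLinearPMap_graph_eq _ (diracGraph_single_valued fun _ _ h hu => by
    rw [Measure.restrict_univ] at hu ⊢
    exact h.ae_eq_zero_univ hu)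

/-! ### Spectral singularities -/

/-- `γ`, parametrized by `[0, 1]`, is a simple closed piecewise continuously differentiable
contour. -/
structure IsContour (γ : ℝ → ℂ) : Prop where
  continuousOn : ContinuousOn γ (Icc 0 1)
  closed : γ 0 = γ 1
  simple : InjOn γ (Ico 0 1)
  piecewise : ∃ P : Finset ℝ, ∀ a b : ℝ, 0 ≤ a → a < b → b ≤ 1 →
    Disjoint (Ioo a b) (P : Set ℝ) → ContDiffOn ℝ 1 γ (Icc a b)

/-- The contour `γ` encloses the point `z`: `z` is off `γ` and `γ` winds around it. -/
def Encloses (γ : ℝ → ℂ) (z : ℂ) : Prop :=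
  z ∉ γ '' Icc 0 1 ∧ ∫ s in (0 : ℝ)..1, deriv γ s / (γ s - z) ≠ 0

/-- The integral `e(t, γ) = ∫_γ (L_t(Q) - z)⁻¹ dz`. -/
def contourProj (p q : ℝ → ℂ) (t : ℝ) (γ : ℝ → ℂ) :
    L2 (Icc 0 Real.pi) →L[ℂ] L2 (Icc 0 Real.pi) :=
  ∫ s in (0 : ℝ)..1, deriv γ s • resolvent (op p q t) (γ s)

/-- The contour `γ` encloses at most one eigenvalue of `L_t(Q)`, counting multiplicity. -/
def EnclosesAtMostOne (p q : ℝ → ℂ) (t : ℝ) (γ : ℝ → ℂ) : Prop :=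
  {z : ℂ | IsEigenvalue (op p q t) z ∧ Encloses γ z}.Subsingleton ∧
    ∀ z : ℂ, Encloses γ z → algMultiplicity (op p q t) z ≤ 1

/-- `z₀` is a spectral singularity of `L(Q)`. -/
def IsSpectralSingularity (p q : ℝ → ℂ) (z₀ : ℂ) : Prop :=
  z₀ ∈ spectrum (opLine p q) ∧ ∀ ε : ℝ, 0 < ε → ∃ γ : ℕ → ℝ → ℂ,
    (∀ n, IsContour (γ n) ∧ γ n '' Icc 0 1 ⊆ Metric.ball z₀ ε ∧
      ∀ t ∈ Ioc (-1 : ℝ) 1, EnclosesAtMostOne p q t (γ n)) ∧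
    Tendsto (fun n => ⨆ t ∈ {t : ℝ | t ∈ Ioc (-1 : ℝ) 1 ∧
        γ n '' Icc 0 1 ⊆ resolventSet (op p q t)}, ‖contourProj p q t (γ n)‖ₑ)
      atTop (𝓝 ⊤)

/-! ### Essential spectral singularities -/

/-- On the interval `I` of real quasimomenta, `lam` is a continuous branch of eigenvalues of
`L_t(Q)`, `Ψ t` is a normalized eigenfunction of `L_t(Q)` for `lam t`, and `Ψs t` is a normalized
eigenfunction of the adjoint operator for the conjugate of `lam t`. -/
structure IsBlochBranch (p q : ℝ → ℂ) (I : Set ℝ) (lam : ℝ → ℂ)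
    (Ψ Ψs : ℝ → L2 (Icc 0 Real.pi)) : Prop where
  continuousOn : ContinuousOn lam I
  eigen : ∀ t ∈ I, IsEigenvector (op p q t) (lam t) (Ψ t)
  norm_eigen : ∀ t ∈ I, ‖Ψ t‖ = 1
  eigen_adjoint : ∀ t ∈ I, IsEigenvector (op p q t).adjoint (star (lam t)) (Ψs t)
  norm_eigen_adjoint : ∀ t ∈ I, ‖Ψs t‖ = 1

/-- `z₀` is an essential spectral singularity of `L(Q)`: it is the value at some `t₀ ∈ (-1, 1]` of
a branch of eigenvalues, defined near `t₀`, for which `1 / α`, where `α t` is the inner product of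
the normalized eigenfunctions, is not integrable on any interval `(t₀ - ε, t₀ + ε)`.
(The modulus of `α t` does not depend on the phases of the eigenfunctions.) -/
def IsESS (p q : ℝ → ℂ) (z₀ : ℂ) : Prop :=
  ∃ t₀ ∈ Ioc (-1 : ℝ) 1, ∃ δ : ℝ, 0 < δ ∧ ∃ (lam : ℝ → ℂ) (Ψ Ψs : ℝ → L2 (Icc 0 Real.pi)),
    IsBlochBranch p q (Ioo (t₀ - δ) (t₀ + δ)) lam Ψ Ψs ∧ lam t₀ = z₀ ∧
    ∀ ε : ℝ, 0 < ε →
      ∫⁻ t in Ioo (t₀ - ε) (t₀ + ε), ‖(inner ℂ (Ψs t) (Ψ t) : ℂ)‖ₑ⁻¹ = ⊤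

end Dirac

end

/-!
By Floquet theory the eigenvalues of `L_t(Q)` are the zeros of `F(z) - 2 cos πt`, where the Hill
discriminant `F` is entire, and at a zero with `F' ≠ 0` the algebraic multiplicity is one. So a
multiple eigenvalue `λ₀` has `F'(λ₀) = 0`.

Let `λ ≠ λ₀` be an eigenvalue of `L_t(Q)` close to `λ₀`. It is simple, and the residue of the
resolvent at `λ` is a bounded form, which does not vanish near `λ₀`, divided by `F'(λ)`. Hence its
norm is unbounded along small circles around points `λ → λ₀`, which makes `λ₀` a spectral
singularity. It belongs to the spectrum of `L(Q)` because Bloch solutions are bounded but not square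
integrable.

By the same computation `1 / |α(t)|` is at most a constant times `1 / |F'(λ(t))|`. If `F - F(λ₀)`
has a zero of order `m` at `λ₀`, then `|F'(λ)|` is comparable to `|F(λ) - F(λ₀)| ^ (1 - 1 / m)`, and
`F(λ(t)) - F(λ₀) = 2 cos πt - 2 cos πt₀` is comparable to `t - t₀` because `sin πt₀ ≠ 0`. So
`1 / |α|` is dominated by an integrable power `|t - t₀| ^ (1 / m - 1)`.
-/

namespace Dirac

section Primitives

variable {E : Type*} [NormedAddCommGroup E] [NormedSpace ℝ E] {a b : ℝ}

lemma absolutelyContinuousOnInterval_const_add_integral {g : ℝ → E}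
    (hg : IntervalIntegrable g volume a b) (c : E) :
    AbsolutelyContinuousOnInterval (fun x => c + ∫ y in a..x, g y) a b := by
  have hnorm := hg.norm.absolutelyContinuousOnInterval_intervalIntegral (c := a) left_mem_uIcc
  rw [absolutelyContinuousOnInterval_iff] at hnorm ⊢
  intro ε hε
  obtain ⟨δ, hδ, H⟩ := hnorm ε hε
  refine ⟨δ, hδ, fun I hI hlen => (Finset.sum_le_sum fun i hi => ?_).trans_lt (H I hI hlen)⟩
  have hint : ∀ {x}, x ∈ uIcc a b → IntervalIntegrable g volume a x := fun hx =>
    hg.mono_set (uIcc_subset_uIcc_left hx)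
  obtain ⟨h₁, h₂⟩ := hI.1 i hi
  rw [dist_add_left, dist_comm, dist_comm (∫ y in a..(I.2 i).1, ‖g y‖), dist_eq_norm,
    Real.dist_eq, intervalIntegral.integral_interval_sub_left (hint h₂) (hint h₁),
    intervalIntegral.integral_interval_sub_left (hint h₂).norm (hint h₁).norm]
  exact intervalIntegral.norm_integral_le_abs_integral_norm

lemma continuousOn_of_eq_primitive {u u' : ℝ → E} (hu' : IntervalIntegrable u' volume a b)
    (hu : ∀ x ∈ uIcc a b, u x = u a + ∫ y in a..x, u' y) : ContinuousOn u (uIcc a b) :=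
  (absolutelyContinuousOnInterval_const_add_integral hu' (u a)).continuousOn.congr hu

variable {𝕜 : Type*} [RCLike 𝕜] {u v u' v' : ℝ → 𝕜}

lemma mul_sub_mul_eq_integral_of_eq_primitive
    (hu' : IntervalIntegrable u' volume a b) (hv' : IntervalIntegrable v' volume a b)
    (hu : ∀ x ∈ uIcc a b, u x = u a + ∫ y in a..x, u' y)
    (hv : ∀ x ∈ uIcc a b, v x = v a + ∫ y in a..x, v' y) :
    IntervalIntegrable (fun x => u' x * v x + u x * v' x) volume a b ∧
      u b * v b - u a * v a = ∫ x in a..b, (u' x * v x + u x * v' x) := by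
  have hI : IntervalIntegrable (fun x => u' x * v x + u x * v' x) volume a b :=
    (hu'.mul_continuousOn (continuousOn_of_eq_primitive hv' hv)).add
      (hv'.continuousOn_mul (continuousOn_of_eq_primitive hu' hu))
  refine ⟨hI, ?_⟩
  have hdiff := ((absolutelyContinuousOnInterval_const_add_integral hu' (u a)).fun_smul
    (absolutelyContinuousOnInterval_const_add_integral hv' (v a))).fun_sub
    (absolutelyContinuousOnInterval_const_add_integral hI (u a * v a))
  obtain ⟨C, hC⟩ := hdiff.const_of_ae_hasDerivAt_zero (by
    filter_upwards [hu'.ae_hasDerivAt_integral, hv'.ae_hasDerivAt_integral,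
      hI.ae_hasDerivAt_integral] with x hxu hxv hxI hx
    have hderiv := (((hxu hx a left_mem_uIcc).const_add (u a)).mul
      ((hxv hx a left_mem_uIcc).const_add (v a))).sub
      ((hxI hx a left_mem_uIcc).const_add (u a * v a))
    refine hderiv.congr_deriv ?_
    rw [← hu x hx, ← hv x hx, sub_self])
  have ha := hC a left_mem_uIcc
  have hb := hC b right_mem_uIcc
  simp only [← hu _ right_mem_uIcc, ← hv _ right_mem_uIcc, smul_eq_mul,
    intervalIntegral.integral_same, add_zero, sub_self] at ha hb
  linear_combination hb - ha

end Primitives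

section Volterra

variable {𝕜 E : Type*} [NontriviallyNormedField 𝕜] [NormedAddCommGroup E] [NormedSpace 𝕜 E]
  {A : ℝ → E →L[𝕜] E} {C : ℝ}

lemma aestronglyMeasurable_clm_apply {μ : Measure ℝ} (hA : AEStronglyMeasurable A μ) {u : ℝ → E}
    (hu : AEStronglyMeasurable u μ) : AEStronglyMeasurable (fun s => A s (u s)) μ :=
  (isBoundedBilinearMap_apply (𝕜 := 𝕜) (E := E) (F := E)).continuous.comp_aestronglyMeasurable
    (hA.prodMk hu)

lemma intervalIntegrable_clm_apply (hA : AEStronglyMeasurable A volume) (hC : ∀ s, ‖A s‖ ≤ C)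
    {u : ℝ → E} {a b : ℝ} (hu : ContinuousOn u (uIcc a b)) :
    IntervalIntegrable (fun s => A s (u s)) volume a b := by
  refine (hu.norm.intervalIntegrable.const_mul C).mono_fun (aestronglyMeasurable_clm_apply
    hA.restrict ((hu.mono uIoc_subset_uIcc).aestronglyMeasurable measurableSet_uIoc)) ?_
  filter_upwards with s
  exact ((A s).le_of_opNorm_le (hC s) _).trans (le_abs_self _)

variable [NormedSpace ℝ E]

/-- The iterates `Tⁿ w` of the Volterra operator `(T u)(x) = ∫₀ˣ A u`; the solution of
`u = w + T u` is their sum. -/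
noncomputable def volterraIter (A : ℝ → E →L[𝕜] E) (w : ℝ → E) : ℕ → ℝ → E
  | 0 => w
  | n + 1 => fun x => ∫ s in (0 : ℝ)..x, A s (volterraIter A w n s)

lemma continuous_volterraIter (hA : AEStronglyMeasurable A volume) (hC : ∀ s, ‖A s‖ ≤ C)
    {w : ℝ → E} (hw : Continuous w) (n : ℕ) : Continuous (volterraIter A w n) := by
  induction n with
  | zero => exact hw
  | succ n ih =>
    exact intervalIntegral.continuous_primitive
      (fun a b => intervalIntegrable_clm_apply hA hC ih.continuousOn) 0

lemma abs_le_of_mem_uIoc_zero {x s : ℝ} (hs : s ∈ uIoc 0 x) : |s| ≤ |x| := by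
  simpa using abs_sub_left_of_mem_uIcc (uIoc_subset_uIcc hs)

lemma norm_volterraIter_le (hC : ∀ s, ‖A s‖ ≤ C) {w : ℝ → E} {K r : ℝ}
    (hK : ∀ x, |x| ≤ r → ‖w x‖ ≤ K) (n : ℕ) {x : ℝ} (hx : |x| ≤ r) :
    ‖volterraIter A w n x‖ ≤ K * ((C * |x|) ^ n / n.factorial) := by
  induction n generalizing x with
  | zero => simpa [volterraIter] using hK x hx
  | succ n ih =>
    have hbound : ∀ s ∈ uIoc 0 x, ‖A s (volterraIter A w n s)‖ ≤
        C ^ (n + 1) * K / n.factorial * |s - 0| ^ n := by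
      intro s hs
      have hn := ih ((abs_le_of_mem_uIoc_zero hs).trans hx)
      calc ‖A s (volterraIter A w n s)‖ ≤ C * ‖volterraIter A w n s‖ :=
            (A s).le_of_opNorm_le (hC s) _
        _ ≤ C * (K * ((C * |s|) ^ n / n.factorial)) :=
            mul_le_mul_of_nonneg_left hn ((norm_nonneg _).trans (hC s))
        _ = C ^ (n + 1) * K / n.factorial * |s - 0| ^ n := by rw [sub_zero, mul_pow]; ring
    calc ‖∫ s in (0 : ℝ)..x, A s (volterraIter A w n s)‖
        ≤ ∫ s in uIoc 0 x, ‖A s (volterraIter A w n s)‖ :=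
          intervalIntegral.norm_integral_le_integral_norm_uIoc
      _ ≤ ∫ s in uIoc 0 x, C ^ (n + 1) * K / n.factorial * |s - 0| ^ n :=
          integral_mono_of_nonneg (Eventually.of_forall fun _ => norm_nonneg _)
            (Continuous.integrableOn_uIoc (by fun_prop))
            ((ae_restrict_iff' measurableSet_uIoc).2 (Eventually.of_forall hbound))
      _ = K * ((C * |x|) ^ (n + 1) / (n + 1).factorial) := by
          rw [integral_const_mul, integral_pow_abs_sub_uIoc, sub_zero, Nat.factorial_succ]
          push_cast
          field_simp
          rw [mul_pow]
          ring

lemma summable_volterra_bound (K r : ℝ) :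
    Summable fun n : ℕ => K * ((C * r) ^ n / n.factorial) :=
  (Real.summable_pow_div_factorial _).mul_left K

lemma exists_norm_volterraIter_le (hC : ∀ s, ‖A s‖ ≤ C) {w : ℝ → E} (hw : Continuous w) (r : ℝ) :
    ∃ K, ∀ n : ℕ, ∀ x, |x| ≤ r → ‖volterraIter A w n x‖ ≤ K * ((C * r) ^ n / n.factorial) := by
  have hC0 : 0 ≤ C := (norm_nonneg _).trans (hC 0)
  obtain ⟨K, hK⟩ := (isCompact_Icc (a := -r) (b := r)).exists_bound_of_continuousOn
    hw.continuousOn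
  refine ⟨K, fun n x hx => ?_⟩
  have hK0 : 0 ≤ K := (norm_nonneg _).trans (hK x (abs_le.1 hx))
  exact (norm_volterraIter_le hC (fun y hy => hK y (abs_le.1 hy)) n hx).trans (by gcongr)

lemma exists_continuous_eq_add_volterra [CompleteSpace E] (hA : AEStronglyMeasurable A volume)
    (hC : ∀ s, ‖A s‖ ≤ C) {w : ℝ → E} (hw : Continuous w) :
    ∃ u : ℝ → E, Continuous u ∧ ∀ x, u x = w x + ∫ s in (0 : ℝ)..x, A s (u s) := by
  have hC0 : 0 ≤ C := (norm_nonneg _).trans (hC 0)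
  have hbound := exists_norm_volterraIter_le hC hw
  have hsum : ∀ x, Summable fun n => volterraIter A w n x := fun x =>
    have ⟨K, hK⟩ := hbound |x|
    .of_norm_bounded (summable_volterra_bound K |x|) fun n => hK n x le_rfl
  refine ⟨fun x => ∑' n, volterraIter A w n x, continuous_iff_continuousAt.2 fun x₀ => ?_,
    fun x => ?_⟩
  · obtain ⟨K, hK⟩ := hbound (|x₀| + 1)
    have hnhds : Metric.ball 0 (|x₀| + 1) ∈ 𝓝 x₀ :=
      Metric.isOpen_ball.mem_nhds (mem_ball_zero_iff.2 (lt_add_one |x₀|))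
    have hcont : ContinuousOn (fun x => ∑' n, volterraIter A w n x)
        (Metric.ball 0 (|x₀| + 1)) := by
      refine continuousOn_tsum (fun n => (continuous_volterraIter hA hC hw n).continuousOn)
        (summable_volterra_bound (C := C) K (|x₀| + 1)) fun n x hx => ?_
      exact hK n x (mem_ball_zero_iff.1 hx).le
    exact hcont.continuousAt hnhds
  · obtain ⟨K, hK⟩ := hbound |x|
    have hterm : HasSum (fun n => volterraIter A w (n + 1) x)
        (∫ s in (0 : ℝ)..x, A s (∑' n, volterraIter A w n s)) := by
      refine intervalIntegral.hasSum_integral_of_dominated_convergence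
        (fun n _ => C * (K * ((C * |x|) ^ n / n.factorial))) (fun n => ?_) (fun n => ?_)
        (Eventually.of_forall fun _ _ => (summable_volterra_bound K |x|).mul_left C)
        intervalIntegrable_const ?_
      · exact aestronglyMeasurable_clm_apply hA.restrict
          (continuous_volterraIter hA hC hw n).aestronglyMeasurable
      · filter_upwards with s hs
        exact ((A s).le_of_opNorm_le (hC s) _).trans
          (mul_le_mul_of_nonneg_left (hK n s (abs_le_of_mem_uIoc_zero hs)) hC0)
      · filter_upwards with s _
        exact (A s).hasSum (hsum s).hasSum
    exact (hsum x).tsum_eq_zero_add.trans (congrArg (w x + ·) hterm.tsum_eq)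

end Volterra

lemma norm_le_mul_exp_of_norm_le_add_integral {E : Type*} [NormedAddCommGroup E] {u : ℝ → E}
    {a b c C : ℝ} (hC : 0 ≤ C) (hc : 0 ≤ c) (hu : ContinuousOn u (Icc a b))
    (h : ∀ x ∈ Icc a b, ‖u x‖ ≤ c + C * ∫ s in a..x, ‖u s‖) {x : ℝ} (hx : x ∈ Icc a b) :
    ‖u x‖ ≤ c * Real.exp (C * (x - a)) := by
  have hab : a ≤ b := hx.1.trans hx.2
  have hint : IntervalIntegrable (fun s => ‖u s‖) volume a b :=
    (hu.norm.mono (uIcc_of_le hab).subset).intervalIntegrable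
  have hcont : ContinuousOn (fun x => c + C * ∫ s in a..x, ‖u s‖) (Icc a b) := by
    rw [← uIcc_of_le hab]
    exact continuousOn_const.add (continuousOn_const.mul
      (intervalIntegral.continuousOn_primitive_interval' hint left_mem_uIcc))
  have hderiv : ∀ y ∈ Ico a b,
      HasDerivWithinAt (fun x => c + C * ∫ s in a..x, ‖u s‖) (C * ‖u y‖) (Ici y) y := by
    intro y hy
    have hmem : Icc a b ∈ 𝓝[≥] y := mem_of_superset (Icc_mem_nhdsGE hy.2)
      (Icc_subset_Icc_left hy.1)
    have hy' : ContinuousWithinAt (fun s => ‖u s‖) (Ici y) y :=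
      ((hu.norm y (Ico_subset_Icc_self hy)).mono_of_mem_nhdsWithin hmem)
    have hmeas : StronglyMeasurableAtFilter (fun s => ‖u s‖) (𝓝[>] y) :=
      ⟨Icc a b, nhdsWithin_mono _ Ioi_subset_Ici_self hmem,
        hu.norm.aestronglyMeasurable measurableSet_Icc⟩
    exact ((intervalIntegral.integral_hasDerivWithinAt_right
      (hint.mono_set (uIcc_subset_uIcc_left (uIcc_of_le hab ▸ Ico_subset_Icc_self hy)))
      hmeas (hy'.mono Ioi_subset_Ici_self)).const_mul C).const_add c
  have hgronwall := norm_le_gronwallBound_of_norm_deriv_right_le (K := C) (ε := 0) hcont hderiv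
    (δ := c) (by simp [abs_of_nonneg hc]) (fun y hy => by
      rw [add_zero, norm_mul, Real.norm_of_nonneg hC, norm_norm]
      exact mul_le_mul_of_nonneg_left ((h y (Ico_subset_Icc_self hy)).trans (le_abs_self _)) hC)
  rw [← gronwallBound_ε0]
  exact (h x hx).trans ((le_abs_self _).trans (hgronwall x hx))

section BoundedVariation

variable {f : ℝ → ℂ} {a b T : ℝ}

lemma exists_norm_le_of_periodic_boundedVariationOn (hf : Function.Periodic f T) (hT : 0 < T)
    (hv : BoundedVariationOn f (Icc 0 T)) : ∃ B, ∀ x, ‖f x‖ ≤ B := by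
  refine ⟨‖f 0‖ + (eVariationOn f (Icc 0 T)).toReal, fun x => ?_⟩
  obtain ⟨y, hy, hxy⟩ := hf.exists_mem_Ico₀ hT x
  have hdist := hv.dist_le (Ico_subset_Icc_self hy) (left_mem_Icc.2 hT.le)
  rw [dist_eq_norm] at hdist
  rw [hxy]
  exact (norm_le_norm_add_norm_sub' _ _).trans (by gcongr)

lemma intervalIntegrable_of_boundedVariationOn_real {f : ℝ → ℝ}
    (hv : BoundedVariationOn f (uIcc a b)) : IntervalIntegrable f volume a b := by
  obtain ⟨f₁, f₂, h₁, h₂, rfl⟩ := hv.locallyBoundedVariationOn.exists_monotoneOn_sub_monotoneOn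
  exact h₁.intervalIntegrable.sub h₂.intervalIntegrable

lemma intervalIntegrable_of_boundedVariationOn (hv : BoundedVariationOn f (uIcc a b)) :
    IntervalIntegrable f volume a b := by
  have hre : LipschitzWith 1 Complex.re := .of_dist_le_mul fun x y => by
    simpa [dist_eq_norm] using Complex.abs_re_le_norm (x - y)
  have him : LipschitzWith 1 Complex.im := .of_dist_le_mul fun x y => by
    simpa [dist_eq_norm] using Complex.abs_im_le_norm (x - y)
  have h₁ := intervalIntegrable_of_boundedVariationOn_real (hre.comp_boundedVariationOn hv)
  have h₂ := intervalIntegrable_of_boundedVariationOn_real (him.comp_boundedVariationOn hv)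
  have h₁' : IntervalIntegrable (fun x => ((f x).re : ℂ)) volume a b := ⟨h₁.1.ofReal, h₁.2.ofReal⟩
  have h₂' : IntervalIntegrable (fun x => ((f x).im : ℂ)) volume a b := ⟨h₂.1.ofReal, h₂.2.ofReal⟩
  exact (h₁'.add (h₂'.mul_const Complex.I)).congr fun x _ => Complex.re_add_im _

lemma aestronglyMeasurable_of_periodic_boundedVariationOn (hf : Function.Periodic f T)
    (hT : 0 < T) (hv : BoundedVariationOn f (Icc 0 T)) : AEStronglyMeasurable f volume := by
  have hint := hf.intervalIntegrable₀ hT.ne'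
    (intervalIntegrable_of_boundedVariationOn ((uIcc_of_le hT.le).symm ▸ hv))
  have hcover : (⋃ n : ℕ, Ioc (-(n : ℝ)) n) = univ := by
    refine eq_univ_of_forall fun x => ?_
    obtain ⟨n, hn⟩ := exists_nat_gt |x|
    exact mem_iUnion.2 ⟨n, (abs_lt.1 hn).1, (abs_lt.1 hn).2.le⟩
  rw [← Measure.restrict_univ (μ := (volume : Measure ℝ)), ← hcover,
    aestronglyMeasurable_iUnion_iff]
  exact fun n => (hint (-n) n).1.aestronglyMeasurable

end BoundedVariation

section System

/-- The bilinear (not sesquilinear) scalar product of `ℂ²`; it is the one for which `Q` is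
symmetric, as in Lagrange's identity. -/
def dot (u v : C2) : ℂ := u 0 * v 0 + u 1 * v 1

/-- The determinant of the matrix with columns `u` and `v`; at the values of two solutions it is
their Wronskian. -/
def wronskian (u v : C2) : ℂ := u 0 * v 1 - u 1 * v 0

/-- `u` is a solution on `s` of `J u' + Q u = z u + f`, the equation holding almost everywhere. -/
def IsSolution (p q : ℝ → ℂ) (s : Set ℝ) (z : ℂ) (f u : ℝ → C2) : Prop :=
  ∃ g : ℝ → C2, IsPrimitive s u g ∧
    ∀ᵐ x ∂volume.restrict s, diracExpr p q u g x = z • u x + f x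

/-- The entries of `Q` are measurable and bounded by `B`: the standing assumption on the
potential, in which bounded variation enters only through its consequences. -/
structure BddPotential (p q : ℝ → ℂ) (B : ℝ) : Prop where
  aestronglyMeasurable_left : AEStronglyMeasurable p volume
  aestronglyMeasurable_right : AEStronglyMeasurable q volume
  norm_left_le : ∀ x, ‖p x‖ ≤ B
  norm_right_le : ∀ x, ‖q x‖ ≤ B

lemma exists_bddPotential {p q : ℝ → ℂ} {T : ℝ} (hT : 0 < T) (hp : Function.Periodic p T)
    (hq : Function.Periodic q T) (hpv : BoundedVariationOn p (Icc 0 T))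
    (hqv : BoundedVariationOn q (Icc 0 T)) : ∃ B, BddPotential p q B := by
  obtain ⟨Bp, hBp⟩ := exists_norm_le_of_periodic_boundedVariationOn hp hT hpv
  obtain ⟨Bq, hBq⟩ := exists_norm_le_of_periodic_boundedVariationOn hq hT hqv
  exact ⟨max Bp Bq, aestronglyMeasurable_of_periodic_boundedVariationOn hp hT hpv,
    aestronglyMeasurable_of_periodic_boundedVariationOn hq hT hqv,
    fun x => (hBp x).trans (le_max_left _ _), fun x => (hBq x).trans (le_max_right _ _)⟩

lemma diracExpr_apply_zero (p q : ℝ → ℂ) (u g : ℝ → C2) (x : ℝ) :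
    diracExpr p q u g x 0 = g x 1 + (p x * u x 0 + q x * u x 1) := by
  simp [diracExpr, dotProduct, Fin.sum_univ_two]

lemma diracExpr_apply_one (p q : ℝ → ℂ) (u g : ℝ → C2) (x : ℝ) :
    diracExpr p q u g x 1 = -g x 0 + (q x * u x 0 - p x * u x 1) := by
  simp [diracExpr, dotProduct, Fin.sum_univ_two, sub_eq_add_neg]

lemma C2.ext_iff {u v : C2} : u = v ↔ u 0 = v 0 ∧ u 1 = v 1 := by
  simp [PiLp.ext_iff, Fin.forall_fin_two]

lemma norm_dot_le (u v : C2) : ‖dot u v‖ ≤ 2 * (‖u‖ * ‖v‖) := by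
  have hcoord : ∀ i : Fin 2, ‖u i * v i‖ ≤ ‖u‖ * ‖v‖ := fun i => by
    rw [norm_mul]
    exact mul_le_mul (PiLp.norm_apply_le u i) (PiLp.norm_apply_le v i) (norm_nonneg _)
      (norm_nonneg _)
  rw [two_mul]
  exact (norm_add_le _ _).trans (add_le_add (hcoord 0) (hcoord 1))

lemma dot_comm (u v : C2) : dot u v = dot v u := by
  unfold dot
  ring

lemma dot_add (u v w : C2) : dot u (v + w) = dot u v + dot u w := by
  simp only [dot, PiLp.add_apply]
  ring

lemma dot_smul (c : ℂ) (u v : C2) : dot u (c • v) = c * dot u v := by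
  simp only [dot, PiLp.smul_apply, smul_eq_mul]
  ring

lemma smul_dot (c : ℂ) (u v : C2) : dot (c • u) v = c * dot u v := by
  rw [dot_comm, dot_smul, dot_comm]

lemma dot_zero (u : C2) : dot u 0 = 0 := by simp [dot]

lemma zero_dot (u : C2) : dot 0 u = 0 := by simp [dot]

lemma wronskian_smul_eq (u v w : C2) :
    wronskian v w • u = wronskian u w • v - wronskian u v • w := by
  simp only [C2.ext_iff, wronskian, PiLp.sub_apply, PiLp.smul_apply, smul_eq_mul]
  constructor <;> ring

end System

section Primitive

variable {s : Set ℝ} {u g : ℝ → C2} {a b : ℝ}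

lemma IsPrimitive.mono {s' : Set ℝ} (h : IsPrimitive s u g) (hs : s' ⊆ s) : IsPrimitive s' u g :=
  fun a ha b hb => h a (hs ha) b (hs hb)

lemma IsPrimitive.eq_add_integral (h : IsPrimitive s u g) (ha : a ∈ s) (hb : b ∈ s) :
    u b = u a + ∫ x in a..b, g x := by
  rw [← (h a ha b hb).2]
  abel

lemma IsPrimitive.continuousOn (h : IsPrimitive s u g) (hs : uIcc a b ⊆ s) :
    ContinuousOn u (uIcc a b) :=
  continuousOn_of_eq_primitive (h a (hs left_mem_uIcc) b (hs right_mem_uIcc)).1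
    fun _ hx => h.eq_add_integral (hs left_mem_uIcc) (hs hx)

lemma intervalIntegrable_apply (hg : IntervalIntegrable g volume a b) (i : Fin 2) :
    IntervalIntegrable (fun x => g x i) volume a b :=
  ⟨(EuclideanSpace.proj (𝕜 := ℂ) i).integrable_comp hg.1,
    (EuclideanSpace.proj (𝕜 := ℂ) i).integrable_comp hg.2⟩

lemma IsPrimitive.apply_eq_add_integral (h : IsPrimitive s u g) (ha : a ∈ s) (hb : b ∈ s)
    (i : Fin 2) : u b i = u a i + ∫ x in a..b, g x i := by
  have hproj : ∫ x in a..b, g x i = (∫ x in a..b, g x) i :=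
    (EuclideanSpace.proj (𝕜 := ℂ) i).intervalIntegral_comp_comm (h a ha b hb).1
  rw [hproj, h.eq_add_integral ha hb, PiLp.add_apply]

end Primitive

namespace IsSolution

variable {p q : ℝ → ℂ} {s : Set ℝ} {z : ℂ} {f k u v : ℝ → C2} {a b : ℝ}

lemma mono {s' : Set ℝ} (h : IsSolution p q s z f u) (hs : s' ⊆ s) : IsSolution p q s' z f u := by
  obtain ⟨g, hg, hd⟩ := h
  exact ⟨g, hg.mono hs, ae_restrict_of_ae_restrict_of_subset hs hd⟩

lemma congr (h : IsSolution p q s z f u) (hf : f =ᵐ[volume.restrict s] k) :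
    IsSolution p q s z k u := by
  obtain ⟨g, hg, hd⟩ := h
  refine ⟨g, hg, ?_⟩
  filter_upwards [hd, hf] with x hx hfx
  rw [hx, hfx]

lemma add (h : IsSolution p q s z f u) (h' : IsSolution p q s z k v) :
    IsSolution p q s z (f + k) (u + v) := by
  obtain ⟨g, hg, hd⟩ := h
  obtain ⟨g', hg', hd'⟩ := h'
  refine ⟨g + g', hg.add hg', ?_⟩
  filter_upwards [hd, hd'] with x hx hx'
  rw [diracExpr_add, hx, hx', Pi.add_apply, Pi.add_apply, smul_add]
  abel

lemma smul (c : ℂ) (h : IsSolution p q s z f u) : IsSolution p q s z (c • f) (c • u) := by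
  obtain ⟨g, hg, hd⟩ := h
  refine ⟨c • g, hg.smul c, ?_⟩
  filter_upwards [hd] with x hx
  rw [diracExpr_smul, hx, smul_add, Pi.smul_apply, Pi.smul_apply, smul_comm]

lemma change_parameter (h : IsSolution p q s z f u) (ζ : ℂ) :
    IsSolution p q s ζ (f + (z - ζ) • u) u := by
  obtain ⟨g, hg, hd⟩ := h
  refine ⟨g, hg, ?_⟩
  filter_upwards [hd] with x hx
  rw [hx, Pi.add_apply, Pi.smul_apply]
  module

lemma continuousOn (h : IsSolution p q s z f u) (hs : Icc a b ⊆ s) :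
    ContinuousOn u (Icc a b) := by
  rcases le_or_gt a b with hab | hab
  · rw [← uIcc_of_le hab] at hs ⊢
    exact h.choose_spec.1.continuousOn hs
  · simp [hab]

lemma continuous (h : IsSolution p q univ z f u) : Continuous u :=
  continuous_iff_continuousAt.2 fun x =>
    (h.continuousOn (subset_univ (Icc (x - 1) (x + 1)))).continuousAt
      (Icc_mem_nhds (by linarith) (by linarith))

lemma wronskian_sub_wronskian (hu : IsSolution p q s z f u) (hv : IsSolution p q s z k v)
    (hs : uIcc a b ⊆ s) :
    wronskian (u b) (v b) - wronskian (u a) (v a) =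
      ∫ x in a..b, (dot (u x) (k x) - dot (f x) (v x)) := by
  obtain ⟨g, hg, hgx⟩ := hu
  obtain ⟨h, hh, hhx⟩ := hv
  have ha : a ∈ s := hs left_mem_uIcc
  have hb : b ∈ s := hs right_mem_uIcc
  have hprod : ∀ i j : Fin 2, IntervalIntegrable (fun x => g x i * v x j + u x i * h x j) volume a b
      ∧ u b i * v b j - u a i * v a j = ∫ x in a..b, (g x i * v x j + u x i * h x j) :=
    fun i j => mul_sub_mul_eq_integral_of_eq_primitive (u := fun x => u x i) (v := fun x => v x j)
      (intervalIntegrable_apply (hg a ha b hb).1 i) (intervalIntegrable_apply (hh a ha b hb).1 j)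
      (fun x hx => hg.apply_eq_add_integral ha (hs hx) i)
      (fun x hx => hh.apply_eq_add_integral ha (hs hx) j)
  have hwronskian : wronskian (u b) (v b) - wronskian (u a) (v a) =
      (u b 0 * v b 1 - u a 0 * v a 1) - (u b 1 * v b 0 - u a 1 * v a 0) := by
    simp only [wronskian]
    ring
  rw [hwronskian, (hprod 0 1).2, (hprod 1 0).2,
    ← intervalIntegral.integral_sub (hprod 0 1).1 (hprod 1 0).1]
  refine intervalIntegral.integral_congr_ae ?_
  rw [← ae_restrict_iff' measurableSet_uIoc]
  have hsub : uIoc a b ⊆ s := uIoc_subset_uIcc.trans hs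
  filter_upwards [ae_restrict_of_ae_restrict_of_subset hsub hgx,
    ae_restrict_of_ae_restrict_of_subset hsub hhx] with x hgx hhx
  simp only [C2.ext_iff, diracExpr_apply_zero, diracExpr_apply_one, PiLp.add_apply,
    PiLp.smul_apply, smul_eq_mul] at hgx hhx
  simp only [dot]
  linear_combination (-v x 1) * hgx.2 + u x 0 * hhx.1 - v x 0 * hgx.1 + u x 1 * hhx.2

end IsSolution

section Coefficient

/-- The matrix `-J`. -/
noncomputable def negJ : C2 →L[ℂ] C2 :=
  Matrix.toEuclideanCLM (n := Fin 2) (𝕜 := ℂ) !![0, -1; 1, 0]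

lemma negJ_apply_zero (u : C2) : negJ u 0 = -u 1 := by
  simp [negJ, Matrix.ofLp_toEuclideanCLM, Matrix.mulVec, dotProduct, Fin.sum_univ_two]

lemma negJ_apply_one (u : C2) : negJ u 1 = u 0 := by
  simp [negJ, Matrix.ofLp_toEuclideanCLM, Matrix.mulVec, dotProduct, Fin.sum_univ_two]

/-- The matrix `-J (z - Q)`: the equation `J u' + Q u = z u + f`, solved for the derivative, reads
`u' = -J (z - Q) u - J f`. -/
noncomputable def coefficient (p q : ℝ → ℂ) (z : ℂ) (x : ℝ) : C2 →L[ℂ] C2 :=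
  z • negJ + (p x • Matrix.toEuclideanCLM (n := Fin 2) (𝕜 := ℂ) !![0, -1; -1, 0] +
    q x • Matrix.toEuclideanCLM (n := Fin 2) (𝕜 := ℂ) !![1, 0; 0, -1])

lemma coefficient_apply_zero (p q : ℝ → ℂ) (z : ℂ) (x : ℝ) (u : C2) :
    coefficient p q z x u 0 = -z * u 1 - p x * u 1 + q x * u 0 := by
  simp [coefficient, negJ_apply_zero, Matrix.ofLp_toEuclideanCLM, Matrix.mulVec, dotProduct,
    Fin.sum_univ_two]
  ring

lemma coefficient_apply_one (p q : ℝ → ℂ) (z : ℂ) (x : ℝ) (u : C2) :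
    coefficient p q z x u 1 = z * u 0 - p x * u 0 - q x * u 1 := by
  simp [coefficient, negJ_apply_one, Matrix.ofLp_toEuclideanCLM, Matrix.mulVec, dotProduct,
    Fin.sum_univ_two]
  ring

lemma diracExpr_eq_iff {p q : ℝ → ℂ} {z : ℂ} {u g : ℝ → C2} {x : ℝ} {y : C2} :
    diracExpr p q u g x = z • u x + y ↔ g x = negJ y + coefficient p q z x (u x) := by
  simp only [C2.ext_iff, diracExpr_apply_zero, diracExpr_apply_one, PiLp.add_apply,
    PiLp.smul_apply, smul_eq_mul, negJ_apply_zero, negJ_apply_one, coefficient_apply_zero,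
    coefficient_apply_one]
  constructor <;> rintro ⟨h₀, h₁⟩
  · exact ⟨by linear_combination -h₁, by linear_combination h₀⟩
  · exact ⟨by linear_combination h₁, by linear_combination -h₀⟩

lemma IsSolution.norm_le_mul_exp {p q : ℝ → ℂ} {z : ℂ} {u : ℝ → C2} {a b C : ℝ}
    (hC : ∀ x, ‖coefficient p q z x‖ ≤ C) (hu : IsSolution p q (Icc a b) z 0 u) {x : ℝ}
    (hx : x ∈ Icc a b) : ‖u x‖ ≤ ‖u a‖ * Real.exp (C * (x - a)) := by
  have hcont := hu.continuousOn subset_rfl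
  obtain ⟨g, hg, hgx⟩ := hu
  refine norm_le_mul_exp_of_norm_le_add_integral ((norm_nonneg _).trans (hC 0)) (norm_nonneg _)
    hcont (fun y hy => ?_) hx
  rw [hg.eq_add_integral (left_mem_Icc.2 (hy.1.trans hy.2)) hy,
    ← intervalIntegral.integral_const_mul]
  refine (norm_add_le _ _).trans ((add_le_add_iff_left _).2 ?_)
  refine intervalIntegral.norm_integral_le_of_norm_le hy.1 ?_ ?_
  · rw [← ae_restrict_iff' measurableSet_Ioc]
    filter_upwards [ae_restrict_of_ae_restrict_of_subset
      (Ioc_subset_Icc_self.trans (Icc_subset_Icc_right hy.2)) hgx] with t ht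
    rw [diracExpr_eq_iff.1 ht, Pi.zero_apply, map_zero, zero_add]
    exact (coefficient p q z t).le_of_opNorm_le (hC t) _
  · refine ContinuousOn.intervalIntegrable ?_
    rw [uIcc_of_le hy.1]
    exact continuousOn_const.mul (hcont.mono (Icc_subset_Icc_right hy.2)).norm

end Coefficient

namespace BddPotential

variable {p q : ℝ → ℂ} {B : ℝ} (h : BddPotential p q B)

include h

lemma exists_norm_coefficient_le (R : ℝ) :
    ∃ C, ∀ z : ℂ, ‖z‖ ≤ R → ∀ x, ‖coefficient p q z x‖ ≤ C := by
  refine ⟨R * ‖negJ‖ + (B * ‖Matrix.toEuclideanCLM (n := Fin 2) (𝕜 := ℂ) !![0, -1; -1, 0]‖ +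
    B * ‖Matrix.toEuclideanCLM (n := Fin 2) (𝕜 := ℂ) !![1, 0; 0, -1]‖), fun z hz x =>
      (norm_add_le _ _).trans (add_le_add ?_ ((norm_add_le _ _).trans (add_le_add ?_ ?_)))⟩
  · rw [norm_smul]
    gcongr
  · rw [norm_smul]
    gcongr
    exact h.norm_left_le x
  · rw [norm_smul]
    gcongr
    exact h.norm_right_le x

lemma aestronglyMeasurable_coefficient (z : ℂ) :
    AEStronglyMeasurable (coefficient p q z) volume :=
  aestronglyMeasurable_const.add ((h.aestronglyMeasurable_left.smul_const _).add
    (h.aestronglyMeasurable_right.smul_const _))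

lemma exists_isSolution (z : ℂ) {f : ℝ → C2} (hf : ∀ a b, IntervalIntegrable f volume a b)
    (c : C2) : ∃ u, IsSolution p q univ z f u ∧ u 0 = c := by
  have hJf : ∀ a b, IntervalIntegrable (fun x => negJ (f x)) volume a b := fun a b =>
    ⟨negJ.integrable_comp (hf a b).1, negJ.integrable_comp (hf a b).2⟩
  have hA := h.aestronglyMeasurable_coefficient z
  obtain ⟨C, hC⟩ := h.exists_norm_coefficient_le ‖z‖
  obtain ⟨u, hcont, hu⟩ := exists_continuous_eq_add_volterra hA (hC z le_rfl)
    (w := fun x => c + ∫ s in (0 : ℝ)..x, negJ (f s))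
    (continuous_const.add (intervalIntegral.continuous_primitive hJf 0))
  have hAu : ∀ a b, IntervalIntegrable (fun x => coefficient p q z x (u x)) volume a b :=
    fun a b => intervalIntegrable_clm_apply hA (hC z le_rfl) hcont.continuousOn
  refine ⟨u, ⟨fun x => negJ (f x) + coefficient p q z x (u x), fun a _ b _ =>
    ⟨(hJf a b).add (hAu a b), ?_⟩, Eventually.of_forall fun x => diracExpr_eq_iff.2 rfl⟩,
    by simp [hu 0]⟩
  rw [intervalIntegral.integral_add (hJf a b) (hAu a b), hu a, hu b,
    ← intervalIntegral.integral_interval_sub_left (hJf 0 b) (hJf 0 a),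
    ← intervalIntegral.integral_interval_sub_left (hAu 0 b) (hAu 0 a)]
  abel

end BddPotential

section FundamentalSystem

open Classical in
/-- The solution on the line of `J u' + Q u = z u` with `u 0 = c` (zero if there is none). -/
noncomputable def fundamentalSolution (p q : ℝ → ℂ) (z : ℂ) (c : C2) : ℝ → C2 :=
  if h : ∃ u, IsSolution p q univ z 0 u ∧ u 0 = c then h.choose else 0

/-- The first column of the fundamental matrix of `J u' + Q u = z u`. -/
noncomputable def phi (p q : ℝ → ℂ) (z : ℂ) : ℝ → C2 := fundamentalSolution p q z !₂[1, 0]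

/-- The second column of the fundamental matrix of `J u' + Q u = z u`. -/
noncomputable def psi (p q : ℝ → ℂ) (z : ℂ) : ℝ → C2 := fundamentalSolution p q z !₂[0, 1]

/-- The bilinear pairing of functions on `[0, π]`. -/
noncomputable def pairing (f u : ℝ → C2) : ℂ := ∫ x in (0 : ℝ)..Real.pi, dot (f x) (u x)

/-- The Hill discriminant `F(z)`: the trace of the monodromy matrix. -/
noncomputable def discriminant (p q : ℝ → ℂ) (z : ℂ) : ℂ :=
  phi p q z Real.pi 0 + psi p q z Real.pi 1

/-- The derivative `F'(z)` of the Hill discriminant, as a quadratic expression in the fundamental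
system. -/
noncomputable def discriminantDeriv (p q : ℝ → ℂ) (z : ℂ) : ℂ :=
  psi p q z Real.pi 0 * pairing (phi p q z) (phi p q z) +
    (psi p q z Real.pi 1 - phi p q z Real.pi 0) * pairing (phi p q z) (psi p q z) -
    phi p q z Real.pi 1 * pairing (psi p q z) (psi p q z)

end FundamentalSystem

section Pairing

variable {f u v : ℝ → C2} {a b : ℝ}

lemma pairing_comm (f u : ℝ → C2) : pairing f u = pairing u f := by
  simp only [pairing, dot_comm]

lemma pairing_smul_left (c : ℂ) (f u : ℝ → C2) : pairing (c • f) u = c * pairing f u := by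
  simp only [pairing, Pi.smul_apply, smul_dot, intervalIntegral.integral_const_mul]

lemma intervalIntegrable_dot (hf : IntervalIntegrable f volume a b)
    (hu : ContinuousOn u (uIcc a b)) :
    IntervalIntegrable (fun x => dot (f x) (u x)) volume a b := by
  have hcoord : ∀ i : Fin 2, ContinuousOn (fun x => u x i) (uIcc a b) := fun i =>
    (EuclideanSpace.proj (𝕜 := ℂ) i).continuous.comp_continuousOn hu
  exact ((intervalIntegrable_apply hf 0).mul_continuousOn (hcoord 0)).add
    ((intervalIntegrable_apply hf 1).mul_continuousOn (hcoord 1))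

lemma pairing_add_smul (hf : IntervalIntegrable f volume 0 Real.pi)
    (hu : ContinuousOn u (Icc 0 Real.pi)) (hv : ContinuousOn v (Icc 0 Real.pi)) (a b : ℂ) :
    pairing f (fun x => a • u x + b • v x) = a * pairing f u + b * pairing f v := by
  rw [← uIcc_of_le Real.pi_pos.le] at hu hv
  simp only [pairing, dot_add, dot_smul]
  rw [intervalIntegral.integral_add ((intervalIntegrable_dot hf hu).const_mul _)
    ((intervalIntegrable_dot hf hv).const_mul _), intervalIntegral.integral_const_mul,
    intervalIntegral.integral_const_mul]

lemma norm_integral_dot_le (hf : IntervalIntegrable f volume a b) {K : ℝ}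
    (hu : ∀ x ∈ Icc a b, ‖u x‖ ≤ K) {x : ℝ} (hx : x ∈ Icc a b) :
    ‖∫ s in a..x, dot (f s) (u s)‖ ≤ 2 * K * ∫ s in a..b, ‖f s‖ := by
  have hK : 0 ≤ K := (norm_nonneg _).trans (hu x hx)
  have hsub : uIcc a x ⊆ uIcc a b := by
    rw [uIcc_of_le hx.1, uIcc_of_le (hx.1.trans hx.2)]
    exact Icc_subset_Icc_right hx.2
  calc ‖∫ s in a..x, dot (f s) (u s)‖ ≤ ∫ s in a..x, 2 * K * ‖f s‖ := by
        refine intervalIntegral.norm_integral_le_of_norm_le hx.1 (Eventually.of_forall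
          fun s hs => (norm_dot_le _ _).trans ?_) ((hf.norm.const_mul _).mono_set hsub)
        rw [mul_comm ‖f s‖, ← mul_assoc]
        gcongr
        exact hu s ⟨hs.1.le, hs.2.trans hx.2⟩
    _ = 2 * K * ∫ s in a..x, ‖f s‖ := intervalIntegral.integral_const_mul _ _
    _ ≤ 2 * K * ∫ s in a..b, ‖f s‖ := by
        gcongr
        exact intervalIntegral.integral_mono_interval le_rfl hx.1 hx.2
          (Eventually.of_forall fun _ => norm_nonneg _) hf.norm

lemma continuous_pairing {X : Type*} [TopologicalSpace X] [FirstCountableTopology X]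
    {U : X → ℝ → C2} (hf : IntervalIntegrable f volume 0 Real.pi)
    (hU : ∀ t, Continuous (U t)) (hU' : ∀ x ∈ Icc 0 Real.pi, Continuous fun t => U t x)
    (hbound : ∀ t, ∃ K, ∀ᶠ τ in 𝓝 t, ∀ x ∈ Icc 0 Real.pi, ‖U τ x‖ ≤ K) :
    Continuous fun t => pairing f (U t) := by
  refine continuous_iff_continuousAt.2 fun t => ?_
  obtain ⟨K, hK⟩ := hbound t
  have hsub : uIoc 0 Real.pi ⊆ Icc 0 Real.pi := by
    rw [uIoc_of_le Real.pi_pos.le]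
    exact Ioc_subset_Icc_self
  refine intervalIntegral.continuousAt_of_dominated_interval (bound := fun x => 2 * (‖f x‖ * K))
    (Eventually.of_forall fun τ =>
      (intervalIntegrable_iff.1
        (intervalIntegrable_dot hf (hU τ).continuousOn)).aestronglyMeasurable) ?_
    ((hf.norm.mul_const K).const_mul 2) (Eventually.of_forall fun x hx => ?_)
  · filter_upwards [hK] with τ hτ
    filter_upwards with x hx
    refine (norm_dot_le _ _).trans ?_
    gcongr
    exact hτ x (hsub hx)
  · have hcoord : ∀ i : Fin 2, Continuous fun τ => U τ x i := fun i =>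
      (EuclideanSpace.proj (𝕜 := ℂ) i).continuous.comp (hU' x (hsub hx))
    exact ((continuous_const.mul (hcoord 0)).add (continuous_const.mul (hcoord 1))).continuousAt

end Pairing

namespace BddPotential

variable {p q : ℝ → ℂ} {B : ℝ} (h : BddPotential p q B)

include h

lemma fundamentalSolution_spec (z : ℂ) (c : C2) :
    IsSolution p q univ z 0 (fundamentalSolution p q z c) ∧ fundamentalSolution p q z c 0 = c := by
  have hex := h.exists_isSolution z (f := 0)
    (fun _ _ => (integrable_zero ℝ C2 volume).intervalIntegrable) c
  rw [fundamentalSolution, dif_pos hex]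
  exact hex.choose_spec

lemma continuous_fundamentalSolution (z : ℂ) (c : C2) : Continuous (fundamentalSolution p q z c) :=
  (h.fundamentalSolution_spec z c).1.continuous

lemma isSolution_fundamentalSolution (z : ℂ) (c : C2) (s : Set ℝ) :
    IsSolution p q s z 0 (fundamentalSolution p q z c) :=
  (h.fundamentalSolution_spec z c).1.mono (subset_univ _)

lemma fundamentalSolution_zero (z : ℂ) (c : C2) : fundamentalSolution p q z c 0 = c :=
  (h.fundamentalSolution_spec z c).2

lemma continuous_phi (z : ℂ) : Continuous (phi p q z) := h.continuous_fundamentalSolution z _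

lemma continuous_psi (z : ℂ) : Continuous (psi p q z) := h.continuous_fundamentalSolution z _

lemma isSolution_phi (z : ℂ) (s : Set ℝ) : IsSolution p q s z 0 (phi p q z) :=
  h.isSolution_fundamentalSolution z _ s

lemma isSolution_psi (z : ℂ) (s : Set ℝ) : IsSolution p q s z 0 (psi p q z) :=
  h.isSolution_fundamentalSolution z _ s

lemma phi_zero (z : ℂ) : phi p q z 0 = !₂[1, 0] := h.fundamentalSolution_zero z _

lemma psi_zero (z : ℂ) : psi p q z 0 = !₂[0, 1] := h.fundamentalSolution_zero z _

lemma wronskian_phi_psi (z : ℂ) (x : ℝ) : wronskian (phi p q z x) (psi p q z x) = 1 := by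
  have hlagrange := (h.isSolution_phi z univ).wronskian_sub_wronskian (h.isSolution_psi z univ)
    (a := 0) (b := x) (subset_univ _)
  simp only [Pi.zero_apply, dot_zero, zero_dot, sub_self, intervalIntegral.integral_zero]
    at hlagrange
  rw [sub_eq_zero.1 hlagrange, h.phi_zero, h.psi_zero]
  simp [wronskian]

lemma eq_smul_phi_add_smul_psi {z : ℂ} {f u : ℝ → C2} {b : ℝ} (hu : IsSolution p q (Icc 0 b) z f u)
    {x : ℝ} (hx : x ∈ Icc 0 b) :
    u x = (u 0 0 - ∫ s in (0 : ℝ)..x, dot (f s) (psi p q z s)) • phi p q z x +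
      (u 0 1 + ∫ s in (0 : ℝ)..x, dot (f s) (phi p q z s)) • psi p q z x := by
  have hsub : uIcc 0 x ⊆ Icc 0 b := by
    rw [uIcc_of_le hx.1]
    exact Icc_subset_Icc_right hx.2
  have hψ := hu.wronskian_sub_wronskian (h.isSolution_psi z _) hsub
  have hφ := hu.wronskian_sub_wronskian (h.isSolution_phi z _) hsub
  have hinit₀ : wronskian (u 0) !₂[0, 1] = u 0 0 := by simp [wronskian]
  have hinit₁ : wronskian (u 0) !₂[1, 0] = -u 0 1 := by simp [wronskian]
  simp only [h.phi_zero, h.psi_zero, Pi.zero_apply, hinit₀, hinit₁, dot_zero, zero_sub,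
    intervalIntegral.integral_neg] at hψ hφ
  have hexpand := wronskian_smul_eq (u x) (phi p q z x) (psi p q z x)
  rw [h.wronskian_phi_psi z x, one_smul] at hexpand
  rw [hexpand, sub_eq_add_neg, ← neg_smul]
  congr 2
  · linear_combination hψ
  · linear_combination -hφ

lemma exists_norm_fundamentalSolution_le (R b : ℝ) : ∃ K, 0 < K ∧ ∀ z : ℂ, ‖z‖ ≤ R → ∀ c : C2,
    ∀ x ∈ Icc 0 b, ‖fundamentalSolution p q z c x‖ ≤ K * ‖c‖ := by
  obtain ⟨C, hC⟩ := h.exists_norm_coefficient_le R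
  refine ⟨Real.exp (C * b), Real.exp_pos _, fun z hz c x hx => ?_⟩
  have hC₀ : 0 ≤ C := (norm_nonneg _).trans (hC z hz 0)
  have hgrowth := (h.isSolution_fundamentalSolution z c _).norm_le_mul_exp (hC z hz) hx
  rw [h.fundamentalSolution_zero, sub_zero, mul_comm] at hgrowth
  refine hgrowth.trans ?_
  gcongr
  exact hx.2

lemma exists_norm_phi_psi_le (R b : ℝ) : ∃ K, 0 < K ∧ ∀ z : ℂ, ‖z‖ ≤ R → ∀ x ∈ Icc 0 b,
    ‖phi p q z x‖ ≤ K ∧ ‖psi p q z x‖ ≤ K := by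
  obtain ⟨K, hK, hbound⟩ := h.exists_norm_fundamentalSolution_le R b
  refine ⟨K, hK, fun z hz x hx => ⟨(hbound z hz _ x hx).trans_eq ?_,
    (hbound z hz _ x hx).trans_eq ?_⟩⟩ <;> simp [EuclideanSpace.norm_eq, Fin.sum_univ_two]

lemma norm_le_of_isSolution {z : ℂ} {f u : ℝ → C2} {b K : ℝ}
    (hf : IntervalIntegrable f volume 0 b)
    (hK : ∀ x ∈ Icc 0 b, ‖phi p q z x‖ ≤ K ∧ ‖psi p q z x‖ ≤ K)
    (hu : IsSolution p q (Icc 0 b) z f u) {x : ℝ} (hx : x ∈ Icc 0 b) :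
    ‖u x‖ ≤ 2 * K * (‖u 0‖ + 2 * K * ∫ s in (0 : ℝ)..b, ‖f s‖) := by
  have : 0 ≤ K := (norm_nonneg _).trans (hK x hx).1
  rw [h.eq_smul_phi_add_smul_psi hu hx]
  set I := ∫ s in (0 : ℝ)..b, ‖f s‖
  have hφ := norm_integral_dot_le hf (fun y hy => (hK y hy).1) hx
  have hψ := norm_integral_dot_le hf (fun y hy => (hK y hy).2) hx
  have hI : 0 ≤ ‖u 0‖ + 2 * K * I := by
    have := (norm_nonneg _).trans hφ
    positivity
  refine (norm_add_le _ _).trans ?_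
  rw [norm_smul, norm_smul, mul_assoc, two_mul, mul_comm K]
  gcongr
  · exact (norm_sub_le _ _).trans (add_le_add (PiLp.norm_apply_le _ _) hψ)
  · exact (hK x hx).1
  · exact (norm_add_le _ _).trans (add_le_add (PiLp.norm_apply_le _ _) hφ)
  · exact (hK x hx).2

lemma exists_norm_fundamentalSolution_sub_le (R b : ℝ) (c : C2) :
    ∃ K, ∀ z ζ : ℂ, ‖z‖ ≤ R → ‖ζ‖ ≤ R → ∀ x ∈ Icc 0 b,
      ‖fundamentalSolution p q ζ c x - fundamentalSolution p q z c x‖ ≤ K * ‖ζ - z‖ := by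
  obtain ⟨K, _, hbound⟩ := h.exists_norm_fundamentalSolution_le R b
  obtain ⟨M, hM, hφψ⟩ := h.exists_norm_phi_psi_le R b
  refine ⟨2 * M * (2 * M * (b * (K * ‖c‖))), fun z ζ hz hζ x hx => ?_⟩
  have hdiff : IsSolution p q (Icc 0 b) z ((ζ - z) • fundamentalSolution p q ζ c)
      (fundamentalSolution p q ζ c - fundamentalSolution p q z c) := by
    convert ((h.isSolution_fundamentalSolution ζ c (Icc 0 b)).change_parameter z).add
      ((h.isSolution_fundamentalSolution z c (Icc 0 b)).smul (-1)) using 1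
    · simp
    · rw [neg_one_smul, sub_eq_add_neg]
  have hcont := (h.continuous_fundamentalSolution ζ c).const_smul (ζ - z)
  have hnorm := h.norm_le_of_isSolution (hcont.intervalIntegrable 0 b) (hφψ z hz) hdiff hx
  have hint : ∫ s in (0 : ℝ)..b, ‖(ζ - z) • fundamentalSolution p q ζ c s‖ ≤
      b * (‖ζ - z‖ * (K * ‖c‖)) := by
    refine (intervalIntegral.integral_mono_on (hx.1.trans hx.2) (hcont.norm.intervalIntegrable 0 b)
      (intervalIntegrable_const (c := ‖ζ - z‖ * (K * ‖c‖))) fun y hy => ?_).trans_eq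
        (by rw [intervalIntegral.integral_const, sub_zero, smul_eq_mul])
    rw [Pi.smul_apply, norm_smul]
    gcongr
    exact hbound ζ hζ c y hy
  rw [Pi.sub_apply, Pi.sub_apply, h.fundamentalSolution_zero, h.fundamentalSolution_zero,
    sub_self, norm_zero, zero_add] at hnorm
  calc _ ≤ 2 * M * (2 * M * (b * (‖ζ - z‖ * (K * ‖c‖)))) := hnorm.trans (by gcongr; exact hint)
    _ = _ := by ring

lemma continuous_fundamentalSolution_left (c : C2) {x : ℝ} (hx : 0 ≤ x) :
    Continuous fun z => fundamentalSolution p q z c x := by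
  refine continuous_iff_continuousAt.2 fun z => ?_
  obtain ⟨K, hK⟩ := h.exists_norm_fundamentalSolution_sub_le (‖z‖ + 1) x c
  refine continuousAt_of_locally_lipschitz one_pos K fun ζ hζ => ?_
  rw [dist_eq_norm, dist_eq_norm] at *
  have hnorm : ‖ζ‖ ≤ ‖z‖ + 1 := (norm_le_norm_add_norm_sub' ζ z).trans (by gcongr)
  exact hK z ζ (by linarith) hnorm x ⟨hx, le_rfl⟩

lemma continuous_pairing_fundamentalSolution {f : ℝ → C2}
    (hf : IntervalIntegrable f volume 0 Real.pi) (c : C2) :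
    Continuous fun z => pairing f (fundamentalSolution p q z c) := by
  refine continuous_pairing hf (fun z => h.continuous_fundamentalSolution z c)
    (fun x hx => h.continuous_fundamentalSolution_left c hx.1) fun z => ?_
  obtain ⟨K, -, hK⟩ := h.exists_norm_fundamentalSolution_le (‖z‖ + 1) Real.pi
  refine ⟨K * ‖c‖, ?_⟩
  filter_upwards [continuous_norm.continuousAt.eventually_lt continuousAt_const
    (lt_add_one ‖z‖)] with ζ hζ
  exact hK ζ hζ.le c

lemma hasDerivAt_fundamentalSolution (z : ℂ) (c : C2) :
    HasDerivAt (fun ζ => fundamentalSolution p q ζ c Real.pi)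
      (pairing (phi p q z) (fundamentalSolution p q z c) • psi p q z Real.pi -
        pairing (psi p q z) (fundamentalSolution p q z c) • phi p q z Real.pi) z := by
  have hslope : ∀ ζ, fundamentalSolution p q ζ c Real.pi - fundamentalSolution p q z c Real.pi =
      (ζ - z) • (pairing (phi p q z) (fundamentalSolution p q ζ c) • psi p q z Real.pi -
        pairing (psi p q z) (fundamentalSolution p q ζ c) • phi p q z Real.pi) := by
    intro ζ
    have hπ := right_mem_Icc.2 Real.pi_pos.le
    have hζ := h.eq_smul_phi_add_smul_psi
      ((h.isSolution_fundamentalSolution ζ c (Icc 0 Real.pi)).change_parameter z) hπ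
    have hz := h.eq_smul_phi_add_smul_psi
      (h.isSolution_fundamentalSolution z c (Icc 0 Real.pi)) hπ
    simp only [zero_add, Pi.smul_apply, Pi.zero_apply, zero_dot, smul_dot,
      intervalIntegral.integral_const_mul, intervalIntegral.integral_zero, sub_zero, add_zero,
      h.fundamentalSolution_zero] at hζ hz
    rw [hζ, hz, pairing_comm (phi p q z), pairing_comm (psi p q z), pairing, pairing]
    module
  rw [hasDerivAt_iff_tendsto_slope]
  have hφ := h.continuous_pairing_fundamentalSolution
    ((h.continuous_phi z).intervalIntegrable (μ := volume) 0 Real.pi) c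
  have hψ := h.continuous_pairing_fundamentalSolution
    ((h.continuous_psi z).intervalIntegrable (μ := volume) 0 Real.pi) c
  refine ((((hφ.smul continuous_const).sub (hψ.smul continuous_const)).tendsto z).mono_left
    nhdsWithin_le_nhds).congr' ?_
  filter_upwards [self_mem_nhdsWithin] with ζ hζ
  rw [slope_def_module, hslope, inv_smul_smul₀ (sub_ne_zero.2 hζ)]
  rfl

lemma hasDerivAt_discriminant (z : ℂ) :
    HasDerivAt (discriminant p q) (discriminantDeriv p q z) z := by
  have hcoord : ∀ (c : C2) (i : Fin 2), HasDerivAt (fun ζ => fundamentalSolution p q ζ c Real.pi i)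
      (pairing (phi p q z) (fundamentalSolution p q z c) * psi p q z Real.pi i -
        pairing (psi p q z) (fundamentalSolution p q z c) * phi p q z Real.pi i) z := fun c i =>
    (EuclideanSpace.proj (𝕜 := ℂ) i).hasFDerivAt.comp_hasDerivAt z
      (h.hasDerivAt_fundamentalSolution z c)
  refine ((hcoord _ 0).add (hcoord _ 1)).congr_deriv ?_
  rw [discriminantDeriv, ← phi, ← psi, pairing_comm (psi p q z) (phi p q z)]
  ring

lemma differentiable_discriminant : Differentiable ℂ (discriminant p q) :=
  fun z => (h.hasDerivAt_discriminant z).differentiableAt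

end BddPotential

section Conjugation

open ComplexConjugate

/-- Coordinatewise complex conjugation on `C2`. -/
noncomputable def conjC2 : C2 →L[ℝ] C2 where
  toFun u := !₂[conj (u 0), conj (u 1)]
  map_add' u v := by simp [C2.ext_iff]
  map_smul' c u := by simp [C2.ext_iff]
  cont := by fun_prop

lemma conjC2_apply (u : C2) (i : Fin 2) : conjC2 u i = conj (u i) := by
  fin_cases i <;> rfl

lemma inner_eq_dot (u v : C2) : inner ℂ u v = dot v (conjC2 u) := by
  simp [dot, conjC2_apply, PiLp.inner_apply, Fin.sum_univ_two]

lemma C2.norm_sq_eq (u : C2) : ‖u‖ ^ 2 = ‖u 0‖ ^ 2 + ‖u 1‖ ^ 2 := by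
  rw [EuclideanSpace.norm_sq_eq, Fin.sum_univ_two]

lemma dot_conjC2_self (u : C2) : dot u (conjC2 u) = ((‖u‖ ^ 2 : ℝ) : ℂ) := by
  rw [C2.norm_sq_eq]
  simp [dot, conjC2_apply, Complex.mul_conj, Complex.normSq_eq_norm_sq]

lemma intervalIntegrable_conjC2 {f : ℝ → C2} {a b : ℝ} (hf : IntervalIntegrable f volume a b) :
    IntervalIntegrable (fun x => conjC2 (f x)) volume a b :=
  ⟨conjC2.integrable_comp hf.1, conjC2.integrable_comp hf.2⟩

lemma pairing_conjC2_self (u : ℝ → C2) :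
    pairing (fun x => conjC2 (u x)) u = ((∫ x in (0 : ℝ)..Real.pi, ‖u x‖ ^ 2 : ℝ) : ℂ) := by
  rw [pairing, ← intervalIntegral.integral_ofReal]
  simp only [dot_comm (conjC2 _), dot_conjC2_self]

lemma integral_norm_sq_pos {E : Type*} [NormedAddCommGroup E] {u : ℝ → E} {a b : ℝ} (hab : a < b)
    (hu : ContinuousOn u (Icc a b)) (ha : u a ≠ 0) : 0 < ∫ x in a..b, ‖u x‖ ^ 2 :=
  intervalIntegral.integral_pos hab (hu.norm.pow 2) (fun _ _ => by positivity)
    ⟨a, left_mem_Icc.2 hab.le, by positivity⟩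

/-- The value at `u` of the quadratic form of the matrix `Q(x) - Q(x)*`. -/
noncomputable def skewForm (p q : ℝ → ℂ) (x : ℝ) (u : C2) : ℂ :=
  (p x - conj (p x)) * (u 0 * conj (u 0) - u 1 * conj (u 1)) +
    (q x - conj (q x)) * (u 0 * conj (u 1) + u 1 * conj (u 0))

/-- The inhomogeneity acquired by the conjugate of a solution `u` of `J u' + Q u = z u`: the vector
`(z̄ - z + Q(x) - Q̄(x)) ū`. -/
noncomputable def conjDefect (p q : ℝ → ℂ) (z : ℂ) (x : ℝ) (u : C2) : C2 :=
  !₂[(conj z - z + (p x - conj (p x))) * conj (u 0) + (q x - conj (q x)) * conj (u 1),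
    (conj z - z - (p x - conj (p x))) * conj (u 1) + (q x - conj (q x)) * conj (u 0)]

lemma dot_conjDefect (p q : ℝ → ℂ) (z : ℂ) (x : ℝ) (u : C2) :
    dot u (conjDefect p q z x u) =
      (conj z - z) * ((‖u‖ ^ 2 : ℝ) : ℂ) + skewForm p q x u := by
  rw [← dot_conjC2_self]
  simp only [dot, conjDefect, skewForm, conjC2_apply, Matrix.cons_val_zero, Matrix.cons_val_one]
  ring

variable {p q : ℝ → ℂ} {z : ℂ}

lemma IsSolution.conj {s : Set ℝ} {u : ℝ → C2} (hu : IsSolution p q s z 0 u) :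
    IsSolution p q s z (fun x => conjDefect p q z x (u x)) (fun x => conjC2 (u x)) := by
  obtain ⟨g, hg, hd⟩ := hu
  refine ⟨fun x => conjC2 (g x), fun a ha b hb => ?_, ?_⟩
  · obtain ⟨hint, heq⟩ := hg a ha b hb
    refine ⟨intervalIntegrable_conjC2 hint, ?_⟩
    rw [conjC2.intervalIntegral_comp_comm hint, ← heq, map_sub]
  · filter_upwards [hd] with x hx
    obtain ⟨h₀, h₁⟩ := C2.ext_iff.1 hx
    replace h₀ := congrArg (starRingEnd ℂ) h₀
    replace h₁ := congrArg (starRingEnd ℂ) h₁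
    simp only [diracExpr_apply_zero, diracExpr_apply_one, PiLp.add_apply, PiLp.smul_apply,
      smul_eq_mul, Pi.zero_apply, PiLp.zero_apply, map_add, map_mul, map_neg, map_sub,
      map_zero] at h₀ h₁
    simp only [C2.ext_iff, diracExpr_apply_zero, diracExpr_apply_one, PiLp.add_apply,
      PiLp.smul_apply, smul_eq_mul, conjC2_apply, conjDefect, Matrix.cons_val_zero,
      Matrix.cons_val_one, Matrix.cons_val_fin_one]
    exact ⟨by linear_combination h₀, by linear_combination h₁⟩

lemma wronskian_smul_conjC2_smul {ω : ℂ} (hω : ‖ω‖ = 1) (u : C2) :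
    wronskian (ω • u) (conjC2 (ω • u)) = wronskian u (conjC2 u) := by
  have hunit : ω * starRingEnd ℂ ω = 1 := by
    rw [Complex.mul_conj, Complex.normSq_eq_norm_sq, hω, one_pow, Complex.ofReal_one]
  simp only [wronskian, conjC2_apply, PiLp.smul_apply, smul_eq_mul, map_mul]
  linear_combination (u 0 * starRingEnd ℂ (u 1) - u 1 * starRingEnd ℂ (u 0)) * hunit

namespace BddPotential

variable {B : ℝ} (h : BddPotential p q B)

include h

lemma norm_skewForm_le (x : ℝ) (u : C2) : ‖skewForm p q x u‖ ≤ 4 * B * ‖u‖ ^ 2 := by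
  have hp : ‖p x - conj (p x)‖ ≤ 2 * B := by
    refine (norm_sub_le _ _).trans ?_
    rw [RCLike.norm_conj, two_mul]
    exact add_le_add (h.norm_left_le x) (h.norm_left_le x)
  have hq : ‖q x - conj (q x)‖ ≤ 2 * B := by
    refine (norm_sub_le _ _).trans ?_
    rw [RCLike.norm_conj, two_mul]
    exact add_le_add (h.norm_right_le x) (h.norm_right_le x)
  have hdiag : ‖u 0 * conj (u 0) - u 1 * conj (u 1)‖ ≤ ‖u‖ ^ 2 := by
    refine (norm_sub_le _ _).trans_eq ?_
    rw [norm_mul, norm_mul, RCLike.norm_conj, RCLike.norm_conj, C2.norm_sq_eq, sq, sq]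
  have hoff : ‖u 0 * conj (u 1) + u 1 * conj (u 0)‖ ≤ ‖u‖ ^ 2 := by
    refine (norm_add_le _ _).trans ?_
    rw [norm_mul, norm_mul, RCLike.norm_conj, RCLike.norm_conj, C2.norm_sq_eq]
    linarith [two_mul_le_add_sq ‖u 0‖ ‖u 1‖, mul_comm ‖u 0‖ ‖u 1‖]
  have : 0 ≤ 2 * B := (norm_nonneg _).trans hp
  calc ‖skewForm p q x u‖ ≤ 2 * B * ‖u‖ ^ 2 + 2 * B * ‖u‖ ^ 2 := by
        refine (norm_add_le _ _).trans ?_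
        rw [norm_mul, norm_mul]
        gcongr
    _ = 4 * B * ‖u‖ ^ 2 := by ring

lemma intervalIntegrable_skewForm {u : ℝ → C2} {a b : ℝ} (hu : ContinuousOn u (uIcc a b)) :
    IntervalIntegrable (fun x => skewForm p q x (u x)) volume a b := by
  have hcoord : ∀ i, ContinuousOn (fun x => u x i) (uIcc a b) := fun i =>
    (EuclideanSpace.proj (𝕜 := ℂ) i).continuous.comp_continuousOn hu
  have hconj : ∀ i, ContinuousOn (fun x => conj (u x i)) (uIcc a b) := fun i =>
    Complex.continuous_conj.comp_continuousOn (hcoord i)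
  have hmeas : ∀ {f : ℝ → ℂ}, ContinuousOn f (uIcc a b) →
      AEStronglyMeasurable f (volume.restrict (uIoc a b)) := fun hf =>
    (hf.mono uIoc_subset_uIcc).aestronglyMeasurable measurableSet_uIoc
  have hskew : ∀ {f : ℝ → ℂ}, AEStronglyMeasurable f volume →
      AEStronglyMeasurable (fun x => f x - conj (f x)) (volume.restrict (uIoc a b)) := fun hf =>
    hf.restrict.sub (Complex.continuous_conj.comp_aestronglyMeasurable hf.restrict)
  refine ((hu.norm.pow 2).intervalIntegrable.const_mul (4 * B)).mono_fun ?_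
    (Eventually.of_forall fun x => (h.norm_skewForm_le x (u x)).trans (le_abs_self _))
  exact ((hskew h.aestronglyMeasurable_left).mul
      (hmeas (((hcoord 0).mul (hconj 0)).sub ((hcoord 1).mul (hconj 1))))).add
    ((hskew h.aestronglyMeasurable_right).mul
      (hmeas (((hcoord 0).mul (hconj 1)).add ((hcoord 1).mul (hconj 0)))))

lemma abs_im_le_of_boundary {ω : ℂ} (hω : ‖ω‖ = 1) {u : ℝ → C2} {a b : ℝ} (hab : a < b)
    (hu : IsSolution p q (Icc a b) z 0 u) (hbc : u b = ω • u a) (ha : u a ≠ 0) :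
    |z.im| ≤ 2 * B := by
  have hcont : ContinuousOn u (Icc a b) := hu.continuousOn subset_rfl
  have hpos := integral_norm_sq_pos hab hcont ha
  have hlagrange := hu.wronskian_sub_wronskian hu.conj (uIcc_of_le hab.le).subset
  rw [← uIcc_of_le hab.le] at hcont
  have hsq : IntervalIntegrable (fun x => ‖u x‖ ^ 2) volume a b :=
    (hcont.norm.pow 2).intervalIntegrable
  have hsq' : IntervalIntegrable (fun x => ((‖u x‖ ^ 2 : ℝ) : ℂ)) volume a b :=
    ⟨hsq.1.ofReal, hsq.2.ofReal⟩
  simp only [hbc, wronskian_smul_conjC2_smul hω, sub_self, dot_conjDefect, Pi.zero_apply, zero_dot,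
    sub_zero] at hlagrange
  rw [intervalIntegral.integral_add (hsq'.const_mul _)
    (h.intervalIntegrable_skewForm hcont), intervalIntegral.integral_const_mul,
    intervalIntegral.integral_ofReal] at hlagrange
  set N := ∫ x in a..b, ‖u x‖ ^ 2
  have hbound : ‖(conj z - z) * (N : ℂ)‖ ≤ 4 * B * N := by
    rw [eq_neg_of_add_eq_zero_left hlagrange.symm, norm_neg, ← intervalIntegral.integral_const_mul]
    exact intervalIntegral.norm_integral_le_of_norm_le hab.le
      (Eventually.of_forall fun x _ => h.norm_skewForm_le x (u x)) (hsq.const_mul _)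
  have him : ‖conj z - z‖ = 2 * |z.im| := by
    rw [norm_sub_rev, Complex.sub_conj, norm_mul, Complex.norm_I, mul_one, Complex.norm_real,
      Real.norm_eq_abs, abs_mul, abs_two]
  rw [norm_mul, him, Complex.norm_real, Real.norm_of_nonneg hpos.le] at hbound
  linarith [le_of_mul_le_mul_right hbound hpos]

end BddPotential

end Conjugation

section SingularMatrices

variable {K : Type*} [Field K] {N : Matrix (Fin 2) (Fin 2) K} {v w : Fin 2 → K}

open Matrix

lemma exists_eq_smul_of_mulVec_eq_zero (hN : N ≠ 0) (hv : v ≠ 0) (hNv : N *ᵥ v = 0)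
    (hNw : N *ᵥ w = 0) : ∃ κ : K, w = κ • v := by
  obtain ⟨i, j, hij⟩ : ∃ i j, N i j ≠ 0 := by
    by_contra! H
    exact hN (Matrix.ext H)
  have hrow : ∀ u, N *ᵥ u = 0 → N i 0 * u 0 + N i 1 * u 1 = 0 := fun u hu => by
    simpa only [mulVec, dotProduct, Fin.sum_univ_two, Pi.zero_apply] using congrFun hu i
  have hcross : v 0 * w 1 - v 1 * w 0 = 0 := by
    refine (mul_eq_zero.1 ?_).resolve_left hij
    match j with
    | 0 => linear_combination w 1 * hrow v hNv - v 1 * hrow w hNw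
    | 1 => linear_combination v 0 * hrow w hNw - w 0 * hrow v hNv
  obtain ⟨k, hk⟩ := Function.ne_iff.1 hv
  refine ⟨w k / v k, funext fun l => ?_⟩
  rw [Pi.smul_apply, smul_eq_mul, div_mul_eq_mul_div, eq_div_iff hk]
  match k, l with
  | 0, 0 | 1, 1 => ring
  | 0, 1 => linear_combination hcross
  | 1, 0 => linear_combination -hcross

lemma exists_mulVec_eq_of_adjugate_mulVec_eq_zero (hN : N ≠ 0) (hdet : N.det = 0)
    (hw : N.adjugate *ᵥ w = 0) : ∃ v, N *ᵥ v = w := by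
  have hadj : N.adjugate ≠ 0 := fun H => hN (by
    simpa [H] using (adjugate_adjugate N (by simp)).symm)
  obtain ⟨x, hx⟩ : ∃ x, N *ᵥ x ≠ 0 := by
    by_contra! H
    exact hN (ext_of_mulVec_single fun j => by rw [H, zero_mulVec])
  obtain ⟨κ, hκ⟩ := exists_eq_smul_of_mulVec_eq_zero hadj hx
    (by rw [mulVec_mulVec, adjugate_mul, hdet, zero_smul, zero_mulVec]) hw
  exact ⟨κ • x, by rw [mulVec_smul, hκ]⟩

end SingularMatrices

section BoundaryProblem

open Matrix

/-- The matrix `M(z) - ω`, where `M(z)` is the monodromy matrix of `J u' + Q u = z u`. -/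
noncomputable def boundaryMatrix (p q : ℝ → ℂ) (z ω : ℂ) : Matrix (Fin 2) (Fin 2) ℂ :=
  !![phi p q z Real.pi 0 - ω, psi p q z Real.pi 0; phi p q z Real.pi 1, psi p q z Real.pi 1 - ω]

/-- The vector `b` for which `u(π) = M(z) (u(0) - b)` whenever `J u' + Q u = z u + f`. -/
noncomputable def sourceVector (p q : ℝ → ℂ) (z : ℂ) (f : ℝ → C2) : C2 :=
  !₂[pairing f (psi p q z), -pairing f (phi p q z)]

/-- The initial value of the residue of the resolvent applied to `f`, up to the factor
`-1 / F'(z)`. -/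
noncomputable def residueVector (p q : ℝ → ℂ) (z ω : ℂ) (f : ℝ → C2) : C2 :=
  WithLp.toLp 2 ((boundaryMatrix p q z ω).adjugate *ᵥ (sourceVector p q z f).ofLp)

variable {p q : ℝ → ℂ} {z ω : ℂ} {f k u : ℝ → C2}

lemma residueVector_zero_eq (p q : ℝ → ℂ) (z ω : ℂ) (f : ℝ → C2) : residueVector p q z ω f 0 =
    (psi p q z Real.pi 1 - ω) * pairing f (psi p q z) +
      psi p q z Real.pi 0 * pairing f (phi p q z) := by
  simp [residueVector, boundaryMatrix, sourceVector, adjugate_fin_two_of]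
  ring

lemma residueVector_one_eq (p q : ℝ → ℂ) (z ω : ℂ) (f : ℝ → C2) : residueVector p q z ω f 1 =
    -phi p q z Real.pi 1 * pairing f (psi p q z) -
      (phi p q z Real.pi 0 - ω) * pairing f (phi p q z) := by
  simp [residueVector, boundaryMatrix, sourceVector, adjugate_fin_two_of]
  ring

lemma boundaryMatrix_mulVec_eq_zero_iff {v : C2} : boundaryMatrix p q z ω *ᵥ v.ofLp = 0 ↔
    (phi p q z Real.pi 0 - ω) * v 0 + psi p q z Real.pi 0 * v 1 = 0 ∧
      phi p q z Real.pi 1 * v 0 + (psi p q z Real.pi 1 - ω) * v 1 = 0 := by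
  simp only [boundaryMatrix, funext_iff, Fin.forall_fin_two, mulVec, dotProduct, Fin.sum_univ_two,
    of_apply, cons_val', cons_val_zero, cons_val_one, cons_val_fin_one, Pi.zero_apply]

lemma pairing_congr (u : ℝ → C2) (hf : f =ᵐ[volume.restrict (Icc 0 Real.pi)] k) :
    pairing f u = pairing k u := by
  refine intervalIntegral.integral_congr_ae ?_
  rw [uIoc_of_le Real.pi_pos.le, ← ae_restrict_iff' measurableSet_Ioc]
  filter_upwards [ae_restrict_of_ae_restrict_of_subset Ioc_subset_Icc_self hf] with x hx
  rw [hx]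

lemma residueVector_congr (ω : ℂ) (hf : f =ᵐ[volume.restrict (Icc 0 Real.pi)] k) :
    residueVector p q z ω f = residueVector p q z ω k := by
  simp only [residueVector, sourceVector, pairing_congr _ hf]

lemma norm_residueVector_apply_le {K N : ℝ} (hω : ‖ω‖ = 1)
    (hK : ∀ x ∈ Icc 0 Real.pi, ‖phi p q z x‖ ≤ K ∧ ‖psi p q z x‖ ≤ K)
    (hf : IntervalIntegrable f volume 0 Real.pi) (hfN : ∫ x in (0 : ℝ)..Real.pi, ‖f x‖ ≤ N)
    (i : Fin 2) : ‖residueVector p q z ω f i‖ ≤ (2 * K + 1) * (2 * K * N) := by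
  have hπ : Real.pi ∈ Icc 0 Real.pi := right_mem_Icc.2 Real.pi_pos.le
  have hK₀ : 0 ≤ K := (norm_nonneg _).trans (hK _ hπ).1
  have : 0 ≤ N :=
    (intervalIntegral.integral_nonneg Real.pi_pos.le fun _ _ => norm_nonneg _).trans hfN
  have hfφ : ‖pairing f (phi p q z)‖ ≤ 2 * K * N :=
    (norm_integral_dot_le hf (fun x hx => (hK x hx).1) hπ).trans (by gcongr)
  have hfψ : ‖pairing f (psi p q z)‖ ≤ 2 * K * N :=
    (norm_integral_dot_le hf (fun x hx => (hK x hx).2) hπ).trans (by gcongr)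
  have hφ : ∀ j, ‖phi p q z Real.pi j‖ ≤ K := fun j =>
    (PiLp.norm_apply_le _ _).trans (hK _ hπ).1
  have hψ : ∀ j, ‖psi p q z Real.pi j‖ ≤ K := fun j =>
    (PiLp.norm_apply_le _ _).trans (hK _ hπ).2
  have hφω : ‖phi p q z Real.pi 0 - ω‖ ≤ K + 1 :=
    (norm_sub_le _ _).trans (add_le_add (hφ 0) hω.le)
  have hψω : ‖psi p q z Real.pi 1 - ω‖ ≤ K + 1 :=
    (norm_sub_le _ _).trans (add_le_add (hψ 1) hω.le)
  fin_cases i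
  · calc ‖residueVector p q z ω f 0‖ ≤ (K + 1) * (2 * K * N) + K * (2 * K * N) := by
          rw [residueVector_zero_eq]
          refine (norm_add_le _ _).trans ?_
          rw [norm_mul, norm_mul]
          gcongr
          exact hψ 0
      _ = (2 * K + 1) * (2 * K * N) := by ring
  · calc ‖residueVector p q z ω f 1‖ ≤ K * (2 * K * N) + (K + 1) * (2 * K * N) := by
          rw [residueVector_one_eq]
          refine (norm_sub_le _ _).trans ?_
          rw [norm_mul, norm_mul, norm_neg]
          gcongr
          exact hφ 1
      _ = (2 * K + 1) * (2 * K * N) := by ring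

namespace BddPotential

variable {B : ℝ} (h : BddPotential p q B)

include h

lemma det_boundaryMatrix (z : ℂ) (hω : ω ≠ 0) :
    (boundaryMatrix p q z ω).det = -ω * (discriminant p q z - (ω + ω⁻¹)) := by
  have hdet := h.wronskian_phi_psi z Real.pi
  rw [wronskian] at hdet
  rw [boundaryMatrix, det_fin_two_of, discriminant]
  linear_combination hdet - mul_inv_cancel₀ hω

lemma det_boundaryMatrix_eq_zero (hω : ω ≠ 0) (hD : discriminant p q z = ω + ω⁻¹) :
    (boundaryMatrix p q z ω).det = 0 := by
  rw [h.det_boundaryMatrix z hω, hD, sub_self, mul_zero]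

lemma boundaryMatrix_ne_zero (z : ℂ) (hω : ω ^ 2 ≠ 1) : boundaryMatrix p q z ω ≠ 0 := by
  intro hzero
  have hdet := h.wronskian_phi_psi z Real.pi
  have hφ₀ := congrFun₂ hzero 0 0
  have hψ₀ := congrFun₂ hzero 0 1
  have hψ₁ := congrFun₂ hzero 1 1
  simp only [boundaryMatrix, of_apply, cons_val', cons_val_zero, cons_val_one, Matrix.zero_apply,
    cons_val_fin_one] at hφ₀ hψ₀ hψ₁
  rw [wronskian, hψ₀, sub_eq_zero.1 hφ₀, sub_eq_zero.1 hψ₁] at hdet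
  exact hω (by linear_combination hdet)

lemma exists_boundaryMatrix_mulVec_eq_zero (hω : ω ≠ 0) (hD : discriminant p q z = ω + ω⁻¹) :
    ∃ v : C2, v ≠ 0 ∧ boundaryMatrix p q z ω *ᵥ v.ofLp = 0 := by
  obtain ⟨v, hv, hNv⟩ := exists_mulVec_eq_zero_iff.2 (h.det_boundaryMatrix_eq_zero hω hD)
  exact ⟨WithLp.toLp 2 v, fun H => hv (congrArg WithLp.ofLp H), hNv⟩

lemma exists_eq_smul_of_boundaryMatrix_mulVec (hω : ω ^ 2 ≠ 1) {v w : C2} (hv : v ≠ 0)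
    (hNv : boundaryMatrix p q z ω *ᵥ v.ofLp = 0) (hNw : boundaryMatrix p q z ω *ᵥ w.ofLp = 0) :
    ∃ κ : ℂ, w = κ • v := by
  obtain ⟨κ, hκ⟩ := exists_eq_smul_of_mulVec_eq_zero (h.boundaryMatrix_ne_zero z hω)
    (fun H => hv (WithLp.ofLp_injective 2 H)) hNv hNw
  exact ⟨κ, WithLp.ofLp_injective 2 hκ⟩

lemma boundaryMatrix_mulVec_residueVector (hω : ω ≠ 0) (hD : discriminant p q z = ω + ω⁻¹)
    (f : ℝ → C2) : boundaryMatrix p q z ω *ᵥ (residueVector p q z ω f).ofLp = 0 := by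
  rw [residueVector, mulVec_mulVec, mul_adjugate, h.det_boundaryMatrix_eq_zero hω hD, zero_smul,
    zero_mulVec]

lemma fundamentalSolution_eq (z : ℂ) (c : C2) {x : ℝ} (hx : 0 ≤ x) :
    fundamentalSolution p q z c x = c 0 • phi p q z x + c 1 • psi p q z x := by
  have heq := h.eq_smul_phi_add_smul_psi (h.isSolution_fundamentalSolution z c (Icc 0 x))
    ⟨hx, le_rfl⟩
  simpa only [h.fundamentalSolution_zero, Pi.zero_apply, zero_dot, intervalIntegral.integral_zero,
    sub_zero, add_zero] using heq

lemma eq_fundamentalSolution {b : ℝ} (hu : IsSolution p q (Icc 0 b) z 0 u) {x : ℝ}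
    (hx : x ∈ Icc 0 b) : u x = fundamentalSolution p q z (u 0) x := by
  rw [h.fundamentalSolution_eq z _ hx.1, h.eq_smul_phi_add_smul_psi hu hx]
  simp only [Pi.zero_apply, zero_dot, intervalIntegral.integral_zero, sub_zero, add_zero]

lemma fundamentalSolution_smul (z κ : ℂ) (c : C2) {x : ℝ} (hx : 0 ≤ x) :
    fundamentalSolution p q z (κ • c) x = κ • fundamentalSolution p q z c x := by
  rw [h.fundamentalSolution_eq z _ hx, h.fundamentalSolution_eq z _ hx]
  simp only [PiLp.smul_apply, smul_add, smul_smul, smul_eq_mul]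

lemma pairing_fundamentalSolution (hf : IntervalIntegrable f volume 0 Real.pi) (z : ℂ) (c : C2) :
    pairing f (fundamentalSolution p q z c) =
      c 0 * pairing f (phi p q z) + c 1 * pairing f (psi p q z) := by
  rw [← pairing_add_smul hf (h.continuous_phi z).continuousOn (h.continuous_psi z).continuousOn]
  refine intervalIntegral.integral_congr fun x hx => ?_
  rw [uIcc_of_le Real.pi_pos.le] at hx
  simp only [h.fundamentalSolution_eq z c hx.1]

lemma boundary_iff (hu : IsSolution p q (Icc 0 Real.pi) z f u) : u Real.pi = ω • u 0 ↔
    boundaryMatrix p q z ω *ᵥ (u 0 - sourceVector p q z f).ofLp =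
      ω • (sourceVector p q z f).ofLp := by
  rw [h.eq_smul_phi_add_smul_psi hu (right_mem_Icc.2 Real.pi_pos.le), ← pairing, ← pairing,
    C2.ext_iff]
  simp only [boundaryMatrix, sourceVector, funext_iff, Fin.forall_fin_two, mulVec, dotProduct,
    Fin.sum_univ_two, of_apply, cons_val', cons_val_zero, cons_val_one, cons_val_fin_one,
    PiLp.add_apply, PiLp.smul_apply, smul_eq_mul, Pi.smul_apply, WithLp.ofLp_sub,
    Pi.sub_apply]
  constructor <;> rintro ⟨h₀, h₁⟩ <;> constructor
  · linear_combination h₀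
  · linear_combination h₁
  · linear_combination h₀
  · linear_combination h₁

lemma fundamentalSolution_pi_eq_iff (z : ℂ) (v : C2) :
    fundamentalSolution p q z v Real.pi = ω • v ↔ boundaryMatrix p q z ω *ᵥ v.ofLp = 0 := by
  have hiff := h.boundary_iff (ω := ω) (h.isSolution_fundamentalSolution z v (Icc 0 Real.pi))
  have hzero : sourceVector p q z 0 = 0 := by
    simp [sourceVector, pairing, zero_dot]
  rwa [hzero, sub_zero, WithLp.ofLp_zero, smul_zero, h.fundamentalSolution_zero] at hiff

lemma discriminant_smul_eq_neg_residueVector (hω : ω ≠ 0)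
    (hu : IsSolution p q (Icc 0 Real.pi) z f u) (hb : u Real.pi = ω • u 0) :
    (discriminant p q z - (ω + ω⁻¹)) • (u 0 - sourceVector p q z f) =
      -residueVector p q z ω f := by
  have hadj := congrArg ((boundaryMatrix p q z ω).adjugate *ᵥ ·) ((h.boundary_iff hu).1 hb)
  simp only [mulVec_mulVec, adjugate_mul, mulVec_smul, smul_mulVec, one_mulVec,
    h.det_boundaryMatrix z hω] at hadj
  refine WithLp.ofLp_injective 2 (smul_right_injective _ hω ?_)
  simp only [WithLp.ofLp_smul, WithLp.ofLp_neg, residueVector, smul_neg, ← hadj, smul_smul,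
    neg_mul, neg_smul, neg_neg]

lemma residueVector_eq_zero (hω : ω ≠ 0) (hD : discriminant p q z = ω + ω⁻¹)
    (hu : IsSolution p q (Icc 0 Real.pi) z f u) (hb : u Real.pi = ω • u 0) :
    residueVector p q z ω f = 0 := by
  have heq := h.discriminant_smul_eq_neg_residueVector hω hu hb
  rwa [hD, sub_self, zero_smul, eq_comm, neg_eq_zero] at heq

lemma exists_isSolution_boundary (hf : IntervalIntegrable f volume 0 Real.pi)
    (hsolve : ∃ v, boundaryMatrix p q z ω *ᵥ v = ω • (sourceVector p q z f).ofLp) :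
    ∃ u, IsSolution p q (Icc 0 Real.pi) z f u ∧ u Real.pi = ω • u 0 := by
  obtain ⟨v, hv⟩ := hsolve
  rw [intervalIntegrable_iff_integrableOn_Icc_of_le Real.pi_pos.le] at hf
  obtain ⟨u, hu, hu₀⟩ := h.exists_isSolution z
    (fun _ _ => (hf.integrable_indicator measurableSet_Icc).intervalIntegrable)
    (WithLp.toLp 2 v + sourceVector p q z f)
  replace hu := (hu.mono (subset_univ _)).congr (indicator_ae_eq_restrict measurableSet_Icc)
  exact ⟨u, hu, (h.boundary_iff hu).2 (by rw [hu₀, add_sub_cancel_right, hv])⟩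

lemma exists_isSolution_boundary_of_discriminant_ne (hω : ω ≠ 0)
    (hD : discriminant p q z ≠ ω + ω⁻¹) (hf : IntervalIntegrable f volume 0 Real.pi) :
    ∃ u, IsSolution p q (Icc 0 Real.pi) z f u ∧ u Real.pi = ω • u 0 := by
  have hdet : IsUnit (boundaryMatrix p q z ω).det := by
    rw [h.det_boundaryMatrix z hω, isUnit_iff_ne_zero]
    exact mul_ne_zero (neg_ne_zero.2 hω) (sub_ne_zero.2 hD)
  exact h.exists_isSolution_boundary hf
    ⟨(boundaryMatrix p q z ω)⁻¹ *ᵥ _, by rw [mulVec_mulVec, mul_nonsing_inv _ hdet, one_mulVec]⟩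

lemma exists_isSolution_boundary_of_residueVector_eq_zero (hω : ω ≠ 0) (hω2 : ω ^ 2 ≠ 1)
    (hD : discriminant p q z = ω + ω⁻¹) (hf : IntervalIntegrable f volume 0 Real.pi)
    (hres : residueVector p q z ω f = 0) :
    ∃ u, IsSolution p q (Icc 0 Real.pi) z f u ∧ u Real.pi = ω • u 0 := by
  refine h.exists_isSolution_boundary hf (exists_mulVec_eq_of_adjugate_mulVec_eq_zero
    (h.boundaryMatrix_ne_zero z hω2) (h.det_boundaryMatrix_eq_zero hω hD) ?_)
  rw [mulVec_smul, ← WithLp.ofLp_toLp 2 (_ *ᵥ _), ← residueVector, hres, WithLp.ofLp_zero,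
    smul_zero]

lemma residueVector_fundamentalSolution {v : C2} (hv : boundaryMatrix p q z ω *ᵥ v.ofLp = 0) :
    residueVector p q z ω (fundamentalSolution p q z v) = discriminantDeriv p q z • v := by
  obtain ⟨h₀, h₁⟩ := boundaryMatrix_mulVec_eq_zero_iff.1 hv
  have hφ := h.pairing_fundamentalSolution ((h.continuous_phi z).intervalIntegrable _ _) z v
  have hψ := h.pairing_fundamentalSolution ((h.continuous_psi z).intervalIntegrable _ _) z v
  rw [pairing_comm] at hφ hψ
  rw [pairing_comm (psi p q z) (phi p q z)] at hψ
  rw [C2.ext_iff, residueVector_zero_eq, residueVector_one_eq, PiLp.smul_apply, PiLp.smul_apply,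
    discriminantDeriv, hφ, hψ, smul_eq_mul, smul_eq_mul]
  constructor
  · linear_combination pairing (phi p q z) (psi p q z) * h₀ +
      pairing (psi p q z) (psi p q z) * h₁
  · linear_combination -pairing (phi p q z) (phi p q z) * h₀ -
      pairing (phi p q z) (psi p q z) * h₁

variable {K N : ℝ}

lemma norm_fundamentalSolution_residueVector_le (hω : ‖ω‖ = 1)
    (hK : ∀ x ∈ Icc 0 Real.pi, ‖phi p q z x‖ ≤ K ∧ ‖psi p q z x‖ ≤ K)
    (hf : IntervalIntegrable f volume 0 Real.pi) (hfN : ∫ x in (0 : ℝ)..Real.pi, ‖f x‖ ≤ N)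
    {x : ℝ} (hx : x ∈ Icc 0 Real.pi) :
    ‖fundamentalSolution p q z (residueVector p q z ω f) x‖ ≤ 4 * K ^ 2 * (2 * K + 1) * N := by
  have hvec := norm_residueVector_apply_le hω hK hf hfN
  have : 0 ≤ K := (norm_nonneg _).trans (hK _ hx).1
  rw [h.fundamentalSolution_eq z _ hx.1]
  refine (norm_add_le _ _).trans ?_
  rw [norm_smul, norm_smul]
  calc _ ≤ (2 * K + 1) * (2 * K * N) * K + (2 * K + 1) * (2 * K * N) * K := by
        gcongr
        exacts [(norm_nonneg _).trans (hvec 0), hvec 0, (hK x hx).1,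
          (norm_nonneg _).trans (hvec 1), hvec 1, (hK x hx).2]
    _ = _ := by ring

lemma norm_sub_fundamentalSolution_le
    (hK : ∀ x ∈ Icc 0 Real.pi, ‖phi p q z x‖ ≤ K ∧ ‖psi p q z x‖ ≤ K)
    (hf : IntervalIntegrable f volume 0 Real.pi) (hfN : ∫ x in (0 : ℝ)..Real.pi, ‖f x‖ ≤ N)
    (hu : IsSolution p q (Icc 0 Real.pi) z f u) {x : ℝ} (hx : x ∈ Icc 0 Real.pi) :
    ‖u x - fundamentalSolution p q z (u 0 - sourceVector p q z f) x‖ ≤ 8 * K ^ 2 * N := by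
  have hK₀ : 0 ≤ K := (norm_nonneg _).trans (hK _ hx).1
  have hφ : ∀ y ∈ Icc 0 Real.pi, ‖∫ s in (0 : ℝ)..y, dot (f s) (phi p q z s)‖ ≤ 2 * K * N :=
    fun y hy => (norm_integral_dot_le hf (fun x hx => (hK x hx).1) hy).trans (by gcongr)
  have hψ : ∀ y ∈ Icc 0 Real.pi, ‖∫ s in (0 : ℝ)..y, dot (f s) (psi p q z s)‖ ≤ 2 * K * N :=
    fun y hy => (norm_integral_dot_le hf (fun x hx => (hK x hx).2) hy).trans (by gcongr)
  have hπ : Real.pi ∈ Icc 0 Real.pi := right_mem_Icc.2 Real.pi_pos.le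
  have hdiff : u x - fundamentalSolution p q z (u 0 - sourceVector p q z f) x =
      (pairing f (psi p q z) - ∫ s in (0 : ℝ)..x, dot (f s) (psi p q z s)) • phi p q z x +
      ((∫ s in (0 : ℝ)..x, dot (f s) (phi p q z s)) - pairing f (phi p q z)) • psi p q z x := by
    rw [h.eq_smul_phi_add_smul_psi hu hx, h.fundamentalSolution_eq z _ hx.1, PiLp.sub_apply,
      PiLp.sub_apply]
    simp only [sourceVector, PiLp.toLp_apply, cons_val_zero, cons_val_one, cons_val_fin_one]
    module
  rw [hdiff]
  refine (norm_add_le _ _).trans ?_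
  rw [norm_smul, norm_smul]
  calc _ ≤ (2 * K * N + 2 * K * N) * K + (2 * K * N + 2 * K * N) * K := by
        gcongr
        · exact (norm_nonneg _).trans ((norm_sub_le _ _).trans (add_le_add (hψ _ hπ) (hψ x hx)))
        · exact (norm_sub_le _ _).trans (add_le_add (hψ _ hπ) (hψ x hx))
        · exact (hK x hx).1
        · exact (norm_nonneg _).trans ((norm_sub_le _ _).trans (add_le_add (hφ x hx) (hφ _ hπ)))
        · exact (norm_sub_le _ _).trans (add_le_add (hφ x hx) (hφ _ hπ))
        · exact (hK x hx).2
    _ = _ := by ring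

lemma norm_discriminant_smul_add_residue_le (hω : ω ≠ 0)
    (hK : ∀ x ∈ Icc 0 Real.pi, ‖phi p q z x‖ ≤ K ∧ ‖psi p q z x‖ ≤ K)
    (hf : IntervalIntegrable f volume 0 Real.pi) (hfN : ∫ x in (0 : ℝ)..Real.pi, ‖f x‖ ≤ N)
    (hu : IsSolution p q (Icc 0 Real.pi) z f u) (hb : u Real.pi = ω • u 0)
    {x : ℝ} (hx : x ∈ Icc 0 Real.pi) :
    ‖(discriminant p q z - (ω + ω⁻¹)) • u x +
        fundamentalSolution p q z (residueVector p q z ω f) x‖ ≤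
      ‖discriminant p q z - (ω + ω⁻¹)‖ * (8 * K ^ 2 * N) := by
  have hres : residueVector p q z ω f =
      (-(discriminant p q z - (ω + ω⁻¹))) • (u 0 - sourceVector p q z f) := by
    rw [neg_smul, h.discriminant_smul_eq_neg_residueVector hω hu hb, neg_neg]
  rw [hres, h.fundamentalSolution_smul z _ _ hx.1, neg_smul, ← sub_eq_add_neg, ← smul_sub,
    norm_smul]
  gcongr
  exact h.norm_sub_fundamentalSolution_le hK hf hfN hu hx

lemma norm_le_of_isSolution_boundary (hω : ‖ω‖ = 1) (hD : discriminant p q z ≠ ω + ω⁻¹)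
    (hK : ∀ x ∈ Icc 0 Real.pi, ‖phi p q z x‖ ≤ K ∧ ‖psi p q z x‖ ≤ K)
    (hf : IntervalIntegrable f volume 0 Real.pi) (hfN : ∫ x in (0 : ℝ)..Real.pi, ‖f x‖ ≤ N)
    (hu : IsSolution p q (Icc 0 Real.pi) z f u) (hb : u Real.pi = ω • u 0)
    {x : ℝ} (hx : x ∈ Icc 0 Real.pi) : ‖u x‖ ≤
      (8 * K ^ 2 + ‖discriminant p q z - (ω + ω⁻¹)‖⁻¹ * (4 * K ^ 2 * (2 * K + 1))) * N := by
  have hω₀ : ω ≠ 0 := norm_ne_zero_iff.1 (hω ▸ one_ne_zero)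
  have hsum := h.norm_discriminant_smul_add_residue_le hω₀ hK hf hfN hu hb hx
  have hres := h.norm_fundamentalSolution_residueVector_le hω hK hf hfN hx
  have hD' : 0 < ‖discriminant p q z - (ω + ω⁻¹)‖ := norm_pos_iff.2 (sub_ne_zero.2 hD)
  set D := discriminant p q z - (ω + ω⁻¹)
  have hDu : ‖D‖ * ‖u x‖ ≤ ‖D‖ * (8 * K ^ 2 * N) + 4 * K ^ 2 * (2 * K + 1) * N := by
    rw [← norm_smul, ← add_sub_cancel_right (D • u x)]
    exact (norm_sub_le _ _).trans (add_le_add hsum hres)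
  refine le_of_mul_le_mul_left (hDu.trans_eq ?_) hD'
  field_simp

end BddPotential

end BoundaryProblem

section Resolvent

variable {E : Type*} [NormedAddCommGroup E] [NormedSpace ℂ E] {T : E →ₗ.[ℂ] E} {z w : ℂ}

lemma isResolventAt_resolvent (hz : z ∈ resolventSet T) : IsResolventAt T z (resolvent T z) := by
  have hex : ∃ R : E →L[ℂ] E, IsResolventAt T z R := hz
  rw [resolvent, dif_pos hex]
  exact hex.choose_spec

lemma mem_resolventSet_of_norm_le (hsurj : ∀ f : E, ∃ y : T.domain, T y - z • (y : E) = f) {C : ℝ}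
    (hC : ∀ y : T.domain, ‖(y : E)‖ ≤ C * ‖T y - z • (y : E)‖) : z ∈ resolventSet T := by
  let A : T.domain →ₗ[ℂ] E := T.toFun - z • T.domain.subtype
  have hker : LinearMap.ker A = ⊥ := LinearMap.ker_eq_bot'.2 fun y hy => Subtype.ext <| by
    have hy' : T y - z • (y : E) = 0 := hy
    rw [ZeroMemClass.coe_zero, ← norm_le_zero_iff]
    simpa only [hy', norm_zero, mul_zero] using hC y
  let e := LinearEquiv.ofBijective A ⟨LinearMap.ker_eq_bot.1 hker, hsurj⟩
  refine ⟨(T.domain.subtype ∘ₗ e.symm.toLinearMap).mkContinuous C fun f => ?_,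
    fun f => ⟨(e.symm f).2, e.apply_symm_apply f⟩,
    fun y => congrArg Subtype.val (e.symm_apply_apply y)⟩
  exact (hC (e.symm f)).trans_eq (congrArg (C * ‖·‖) (e.apply_symm_apply f))

lemma resolvent_mul_one_sub (hz : z ∈ resolventSet T) (hw : w ∈ resolventSet T) :
    resolvent T z * (1 - (z - w) • resolvent T w) = resolvent T w := by
  ext f
  obtain ⟨hdom, heq⟩ := (isResolventAt_resolvent hw).1 f
  have hleft := (isResolventAt_resolvent hz).2 ⟨_, hdom⟩
  have hshift : T ⟨resolvent T w f, hdom⟩ - z • resolvent T w f =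
      f - (z - w) • resolvent T w f := by
    rw [sub_eq_iff_eq_add.1 heq, sub_smul]
    abel
  simp only [hshift] at hleft
  exact hleft

lemma differentiableAt_resolvent [CompleteSpace E] {U : Set ℂ} (hU : IsOpen U)
    (hUT : U ⊆ resolventSet T) (hw : w ∈ U) : DifferentiableAt ℂ (resolvent T) w := by
  let G : ℂ → E →L[ℂ] E := fun z => 1 - (z - w) • resolvent T w
  have hG : Differentiable ℂ G := by fun_prop
  have hGw : IsUnit (G w) := by
    simp only [G, sub_self, zero_smul, sub_zero, isUnit_one]
  have hunit : ∀ᶠ z in 𝓝 w, IsUnit (G z) :=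
    hG.continuous.continuousAt.eventually ((Units.isOpen (R := E →L[ℂ] E)).mem_nhds hGw)
  have hdiff : DifferentiableAt ℂ (fun z => resolvent T w * Ring.inverse (G z)) w :=
    (differentiableAt_const _).mul ((differentiableAt_inverse hGw).comp w (hG w))
  refine hdiff.congr_of_eventuallyEq ?_
  filter_upwards [hunit, hU.mem_nhds hw] with z hz hzU
  rw [← resolvent_mul_one_sub (hUT hzU) (hUT hw), mul_assoc, Ring.mul_inverse_cancel _ hz, mul_one]

lemma mem_kerPow_succ_iff {k : ℕ} {y : E} : y ∈ kerPow T z (k + 1) ↔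
    ∃ w, (y, w) ∈ T.graph ∧ w - z • y ∈ kerPow T z k :=
  ⟨fun ⟨⟨_, w⟩, ⟨hgraph, hker⟩, hfst⟩ => hfst ▸ ⟨w, hgraph, hker⟩,
    fun ⟨w, hgraph, hker⟩ => ⟨(y, w), ⟨hgraph, hker⟩, rfl⟩⟩

lemma kerPow_le_span_singleton {Y : E} (heig : ∀ y, (y, z • y) ∈ T.graph → y ∈ ℂ ∙ Y)
    (hroot : ∀ (y w : E) (κ : ℂ), (y, w) ∈ T.graph → w - z • y = κ • Y → κ = 0) (k : ℕ) :
    kerPow T z k ≤ ℂ ∙ Y := by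
  induction k with
  | zero => exact bot_le
  | succ k ih =>
    intro y hy
    obtain ⟨w, hgraph, hker⟩ := mem_kerPow_succ_iff.1 hy
    obtain ⟨κ, hκ⟩ := Submodule.mem_span_singleton.1 (ih hker)
    rw [hroot y w κ hgraph hκ.symm, zero_smul, eq_comm, sub_eq_zero] at hκ
    exact heig y (hκ ▸ hgraph)

lemma algMultiplicity_le_one_of_span_singleton {Y : E}
    (heig : ∀ y, (y, z • y) ∈ T.graph → y ∈ ℂ ∙ Y)
    (hroot : ∀ (y w : E) (κ : ℂ), (y, w) ∈ T.graph → w - z • y = κ • Y → κ = 0) :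
    algMultiplicity T z ≤ 1 := by
  rw [algMultiplicity, Cardinal.toENat_le_one]
  refine (Submodule.rank_mono (iSup_le (kerPow_le_span_singleton heig hroot))).trans
    ((rank_span_le _).trans ?_)
  rw [Cardinal.mk_singleton]

lemma algMultiplicity_eq_zero (hz : ¬ IsEigenvalue T z) : algMultiplicity T z = 0 := by
  have hbot : ∀ k, kerPow T z k = ⊥ := fun k => by
    induction k with
    | zero => rfl
    | succ k ih =>
      refine (Submodule.eq_bot_iff _).2 fun y hy => ?_
      obtain ⟨w, hgraph, hker⟩ := mem_kerPow_succ_iff.1 hy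
      rw [ih, Submodule.mem_bot, sub_eq_zero] at hker
      obtain ⟨y, rfl, hTy⟩ := (LinearPMap.mem_graph_iff _).1 hgraph
      exact by_contra fun hy₀ => hz ⟨y, hy₀, y.2, hTy.trans hker⟩
  rw [algMultiplicity, iSup_congr hbot, iSup_bot, rank_bot, map_zero]

end Resolvent

section Multiplier

/-- The Floquet multiplier `e^{iπt}`. -/
noncomputable def multiplier (t : ℂ) : ℂ := Complex.exp (Complex.I * Real.pi * t)

lemma norm_multiplier (t : ℝ) : ‖multiplier t‖ = 1 := by
  have harg : Complex.I * Real.pi * t = ((Real.pi * t : ℝ) : ℂ) * Complex.I := by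
    push_cast
    ring
  rw [multiplier, harg, Complex.norm_exp_ofReal_mul_I]

lemma multiplier_ne_zero (t : ℂ) : multiplier t ≠ 0 := Complex.exp_ne_zero _

lemma multiplier_add_inv (t : ℝ) :
    multiplier t + (multiplier t)⁻¹ = ((2 * Real.cos (Real.pi * t) : ℝ) : ℂ) := by
  rw [multiplier, ← Complex.exp_neg]
  push_cast
  rw [Complex.two_cos]
  congr 2 <;> ring

lemma add_inv_sq_eq_four_iff {K : Type*} [Field K] {ω : K} (hω : ω ≠ 0) :
    (ω + ω⁻¹) ^ 2 = 4 ↔ ω ^ 2 = 1 := by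
  have hfactor : ω ^ 2 * ((ω + ω⁻¹) ^ 2 - 4) = (ω ^ 2 - 1) ^ 2 := by
    field_simp
    ring
  rw [← sub_eq_zero, ← mul_right_inj' (pow_ne_zero 2 hω), mul_zero, hfactor, sq_eq_zero_iff,
    sub_eq_zero]

lemma multiplier_sq_eq_one_iff {t : ℝ} : multiplier t ^ 2 = 1 ↔ Real.sin (Real.pi * t) = 0 := by
  rw [← add_inv_sq_eq_four_iff (multiplier_ne_zero t), multiplier_add_inv, ← sq_eq_zero_iff,
    Real.sin_sq]
  norm_cast
  constructor <;> intro hcos <;> linarith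

end Multiplier

section SquareIntegrable

variable {a b : ℝ}

lemma intervalIntegrable_coeFn_L2 (hab : a ≤ b) (f : L2 (Icc a b)) :
    IntervalIntegrable f volume a b := by
  rw [intervalIntegrable_iff_integrableOn_Icc_of_le hab]
  exact (Lp.memLp f).integrable one_le_two

lemma exists_integral_norm_le_L2 (hab : a ≤ b) : ∃ C, 0 ≤ C ∧ ∀ f : L2 (Icc a b),
    ∫ x in a..b, ‖f x‖ ≤ C * ‖f‖ := by
  set μ := (volume : Measure ℝ).restrict (Icc a b)
  set A := μ univ ^ (1 / (1 : ENNReal).toReal - 1 / (2 : ENNReal).toReal)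
  have hA : A ≠ ⊤ := ENNReal.rpow_ne_top_of_nonneg (by norm_num) (measure_ne_top μ _)
  refine ⟨A.toReal, ENNReal.toReal_nonneg, fun f => ?_⟩
  have hf := Lp.memLp f
  rw [intervalIntegral.integral_of_le hab, ← integral_Icc_eq_integral_Ioc,
    integral_norm_eq_lintegral_enorm hf.aestronglyMeasurable, ← eLpNorm_one_eq_lintegral_enorm,
    mul_comm, Lp.norm_def, ← ENNReal.toReal_mul]
  exact ENNReal.toReal_mono (ENNReal.mul_ne_top hf.eLpNorm_ne_top hA)
    (eLpNorm_le_eLpNorm_mul_rpow_measure_univ one_le_two hf.aestronglyMeasurable)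

lemma exists_norm_L2_le (a b : ℝ) : ∃ C, 0 ≤ C ∧ ∀ (f : L2 (Icc a b)) (u : ℝ → C2) (K : ℝ),
    0 ≤ K → f =ᵐ[volume.restrict (Icc a b)] u → (∀ x ∈ Icc a b, ‖u x‖ ≤ K) → ‖f‖ ≤ C * K := by
  refine ⟨(measureUnivNNReal (volume.restrict (Icc a b)) : ℝ) ^ (2 : ENNReal).toReal⁻¹,
    by positivity, fun f u K hK hf hu => Lp.norm_le_of_ae_bound hK ?_⟩
  filter_upwards [hf, ae_restrict_mem measurableSet_Icc] with x hx hxI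
  exact hx ▸ hu x hxI

lemma memLp_of_continuousOn_Icc {u : ℝ → C2} (hu : ContinuousOn u (Icc a b)) :
    MemLp u 2 (volume.restrict (Icc a b)) := by
  obtain ⟨K, hK⟩ := isCompact_Icc.exists_bound_of_continuousOn hu
  exact .of_bound (hu.aestronglyMeasurable measurableSet_Icc) K
    ((ae_restrict_mem measurableSet_Icc).mono hK)

lemma exists_L2_ae_eq {u : ℝ → C2} (hu : ContinuousOn u (Icc a b)) :
    ∃ y : L2 (Icc a b), y =ᵐ[volume.restrict (Icc a b)] u :=
  ⟨(memLp_of_continuousOn_Icc hu).toLp u, MemLp.coeFn_toLp _⟩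

end SquareIntegrable

section QuasiPeriodicOperator

variable {p q : ℝ → ℂ} {t z : ℂ} {y w : L2 (Icc 0 Real.pi)} {f u : ℝ → C2}

lemma exists_isSolution_of_mem_graph_op (hyw : (y, w) ∈ (op p q t).graph) (z : ℂ) :
    ∃ u, IsSolution p q (Icc 0 Real.pi) z (w - z • y : L2 (Icc 0 Real.pi)) u ∧
      u Real.pi = multiplier t • u 0 ∧ y =ᵐ[volume.restrict (Icc 0 Real.pi)] u := by
  rw [op_graph] at hyw
  obtain ⟨u, g, hu, hb, hy, hw⟩ := hyw
  refine ⟨u, ⟨g, hu, ?_⟩, hb, hy⟩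
  filter_upwards [hy, hw, Lp.coeFn_sub w (z • y), Lp.coeFn_smul z y] with x hyx hwx hsub hsmul
  rw [hsub, Pi.sub_apply, hsmul, Pi.smul_apply, hyx, hwx, add_sub_cancel]

lemma exists_isSolution_zero_of_mem_graph_op (hy : (y, z • y) ∈ (op p q t).graph) :
    ∃ u, IsSolution p q (Icc 0 Real.pi) z 0 u ∧ u Real.pi = multiplier t • u 0 ∧
      y =ᵐ[volume.restrict (Icc 0 Real.pi)] u := by
  obtain ⟨u, hu, hb, hyu⟩ := exists_isSolution_of_mem_graph_op hy z
  rw [sub_self] at hu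
  exact ⟨u, hu.congr (Lp.coeFn_zero _ _ _), hb, hyu⟩

lemma IsSolution.mem_graph_op (hu : IsSolution p q (Icc 0 Real.pi) z f u)
    (hb : u Real.pi = multiplier t • u 0) (hy : y =ᵐ[volume.restrict (Icc 0 Real.pi)] u)
    (hw : w =ᵐ[volume.restrict (Icc 0 Real.pi)] f) : (y, w + z • y) ∈ (op p q t).graph := by
  obtain ⟨g, hg, heq⟩ := hu
  rw [op_graph]
  refine ⟨u, g, hg, hb, hy, ?_⟩
  filter_upwards [hy, hw, heq, Lp.coeFn_add w (z • y), Lp.coeFn_smul z y] with x hyx hwx hx hadd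
    hsmul
  rw [hadd, Pi.add_apply, hsmul, Pi.smul_apply, hyx, hwx, hx, add_comm]

end QuasiPeriodicOperator

namespace BddPotential

open Matrix

variable {p q : ℝ → ℂ} {B : ℝ} (h : BddPotential p q B) {t : ℝ} {z κ : ℂ}
  {y w Y : L2 (Icc 0 Real.pi)} {v : C2}

include h

lemma exists_op_sub_smul_eq (hD : discriminant p q z ≠ multiplier t + (multiplier t)⁻¹)
    (f : L2 (Icc 0 Real.pi)) : ∃ y : (op p q t).domain, op p q t y - z • (y : L2 _) = f := by
  obtain ⟨u, hu, hb⟩ := h.exists_isSolution_boundary_of_discriminant_ne (multiplier_ne_zero t) hD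
    (intervalIntegrable_coeFn_L2 Real.pi_pos.le f)
  obtain ⟨y, hy⟩ := exists_L2_ae_eq (hu.continuousOn subset_rfl)
  obtain ⟨y, rfl, hTy⟩ := (LinearPMap.mem_graph_iff _).1
    (hu.mem_graph_op hb hy (EventuallyEq.refl _ f))
  exact ⟨y, by rw [hTy, add_sub_cancel_right]⟩

lemma mem_resolventSet_op (hD : discriminant p q z ≠ multiplier t + (multiplier t)⁻¹) :
    z ∈ resolventSet (op p q t) := by
  obtain ⟨K, hK₀, hK⟩ := h.exists_norm_phi_psi_le ‖z‖ Real.pi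
  obtain ⟨C₁, hC₁, hint⟩ := exists_integral_norm_le_L2 Real.pi_pos.le
  obtain ⟨C₂, -, hnorm⟩ := exists_norm_L2_le 0 Real.pi
  refine mem_resolventSet_of_norm_le (h.exists_op_sub_smul_eq hD) (C := C₂ * ((8 * K ^ 2 +
    ‖discriminant p q z - (multiplier t + (multiplier t)⁻¹)‖⁻¹ * (4 * K ^ 2 * (2 * K + 1))) *
      C₁)) fun y => ?_
  obtain ⟨u, hu, hb, hy⟩ := exists_isSolution_of_mem_graph_op ((op p q t).mem_graph y) z
  have hbound := fun x hx => h.norm_le_of_isSolution_boundary (x := x) (norm_multiplier t) hD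
    (hK z le_rfl) (intervalIntegrable_coeFn_L2 Real.pi_pos.le _) (hint _) hu hb hx
  refine (hnorm _ u _ (by positivity) hy hbound).trans_eq ?_
  ring

lemma discriminant_eq_of_isEigenvalue (hz : IsEigenvalue (op p q t) z) :
    discriminant p q z = multiplier t + (multiplier t)⁻¹ := by
  obtain ⟨y, hy₀, hdom, hTy⟩ := hz
  by_contra hD
  have hleft := (isResolventAt_resolvent (h.mem_resolventSet_op hD)).2 ⟨y, hdom⟩
  rw [hTy, sub_self, map_zero] at hleft
  exact hy₀ hleft.symm

lemma exists_L2_ae_eq_fundamentalSolution (z : ℂ) (v : C2) : ∃ Y : L2 (Icc 0 Real.pi),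
    Y =ᵐ[volume.restrict (Icc 0 Real.pi)] fundamentalSolution p q z v :=
  exists_L2_ae_eq (h.continuous_fundamentalSolution z v).continuousOn

lemma smul_ae_eq_fundamentalSolution
    (hY : Y =ᵐ[volume.restrict (Icc 0 Real.pi)] fundamentalSolution p q z v) (κ : ℂ) :
    (κ • Y : L2 (Icc 0 Real.pi)) =ᵐ[volume.restrict (Icc 0 Real.pi)]
      fundamentalSolution p q z (κ • v) := by
  filter_upwards [hY, Lp.coeFn_smul κ Y, ae_restrict_mem measurableSet_Icc] with x hYx hsmul hx
  rw [hsmul, Pi.smul_apply, hYx, h.fundamentalSolution_smul z κ v hx.1]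

lemma mem_span_of_mem_graph_op (hω : multiplier t ^ 2 ≠ 1) (hv : v ≠ 0)
    (hNv : boundaryMatrix p q z (multiplier t) *ᵥ v.ofLp = 0)
    (hY : Y =ᵐ[volume.restrict (Icc 0 Real.pi)] fundamentalSolution p q z v)
    (hy : (y, z • y) ∈ (op p q t).graph) : y ∈ ℂ ∙ Y := by
  obtain ⟨u, hu, hb, hyu⟩ := exists_isSolution_zero_of_mem_graph_op hy
  rw [h.eq_fundamentalSolution hu (right_mem_Icc.2 Real.pi_pos.le),
    h.fundamentalSolution_pi_eq_iff] at hb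
  obtain ⟨κ, hκ⟩ := h.exists_eq_smul_of_boundaryMatrix_mulVec hω hv hNv hb
  refine Submodule.mem_span_singleton.2 ⟨κ, Lp.ext ?_⟩
  filter_upwards [hyu, h.smul_ae_eq_fundamentalSolution hY κ, ae_restrict_mem measurableSet_Icc]
    with x hyx hYx hx
  rw [hyx, hYx, h.eq_fundamentalSolution hu hx, hκ]

lemma eq_zero_of_sub_smul_eq_smul (hF : discriminantDeriv p q z ≠ 0)
    (hD : discriminant p q z = multiplier t + (multiplier t)⁻¹) (hv : v ≠ 0)
    (hNv : boundaryMatrix p q z (multiplier t) *ᵥ v.ofLp = 0)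
    (hY : Y =ᵐ[volume.restrict (Icc 0 Real.pi)] fundamentalSolution p q z v)
    (hgraph : (y, w) ∈ (op p q t).graph) (hw : w - z • y = κ • Y) : κ = 0 := by
  obtain ⟨u, hu, hb, -⟩ := exists_isSolution_of_mem_graph_op hgraph z
  rw [hw] at hu
  have hres := h.residueVector_eq_zero (multiplier_ne_zero t) hD
    (hu.congr (h.smul_ae_eq_fundamentalSolution hY κ)) hb
  rw [h.residueVector_fundamentalSolution (by rw [WithLp.ofLp_smul, mulVec_smul, hNv, smul_zero])]
    at hres
  simpa only [smul_eq_zero, hF, hv, or_false, false_or] using hres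

lemma algMultiplicity_le_one
    (hω : discriminant p q z = multiplier t + (multiplier t)⁻¹ → multiplier t ^ 2 ≠ 1)
    (hF : discriminantDeriv p q z ≠ 0) : algMultiplicity (op p q t) z ≤ 1 := by
  by_cases hD : discriminant p q z = multiplier t + (multiplier t)⁻¹
  · obtain ⟨v, hv, hNv⟩ := h.exists_boundaryMatrix_mulVec_eq_zero (multiplier_ne_zero t) hD
    obtain ⟨Y, hY⟩ := h.exists_L2_ae_eq_fundamentalSolution z v
    exact algMultiplicity_le_one_of_span_singleton
      (fun y => h.mem_span_of_mem_graph_op (hω hD) hv hNv hY)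
      fun y w κ => h.eq_zero_of_sub_smul_eq_smul hF hD hv hNv hY
  · rw [algMultiplicity_eq_zero (mt h.discriminant_eq_of_isEigenvalue hD)]
    exact zero_le_one

end BddPotential

section Circles

variable {E : Type*} [NormedAddCommGroup E] [NormedSpace ℂ E] {c z : ℂ} {r : ℝ}

/-- The circle with centre `c` and radius `r`, parametrized by `[0, 1]` as contours are. -/
noncomputable def circleLoop (c : ℂ) (r : ℝ) (s : ℝ) : ℂ := circleMap c r (2 * Real.pi * s)

lemma hasDerivAt_circleLoop (c : ℂ) (r s : ℝ) : HasDerivAt (circleLoop c r)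
    ((2 * Real.pi : ℝ) • deriv (circleMap c r) (2 * Real.pi * s)) s :=
  (differentiable_circleMap c r (2 * Real.pi * s)).hasDerivAt.scomp s
    (hasDerivAt_const_mul (2 * Real.pi))

lemma contDiff_circleLoop (c : ℂ) (r : ℝ) : ContDiff ℝ 1 (circleLoop c r) :=
  (contDiff_circleMap c r).comp (contDiff_const.mul contDiff_id)

lemma integral_circleLoop (c : ℂ) (r : ℝ) (f : ℂ → E) :
    ∫ s in (0 : ℝ)..1, deriv (circleLoop c r) s • f (circleLoop c r s) = ∮ z in C(c, r), f z := by
  have hsubst := intervalIntegral.smul_integral_comp_mul_left (a := 0) (b := 1)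
    (fun θ => deriv (circleMap c r) θ • f (circleMap c r θ)) (2 * Real.pi)
  rw [mul_zero, mul_one] at hsubst
  simp_rw [fun s => (hasDerivAt_circleLoop c r s).deriv, smul_assoc]
  rw [intervalIntegral.integral_smul, circleIntegral]
  exact hsubst

lemma circleLoop_mem_sphere (hr : 0 ≤ r) (s : ℝ) : circleLoop c r s ∈ Metric.sphere c r :=
  circleMap_mem_sphere c hr _

lemma image_circleLoop_subset_sphere (hr : 0 ≤ r) :
    circleLoop c r '' Icc 0 1 ⊆ Metric.sphere c r := by
  rintro _ ⟨s, -, rfl⟩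
  exact circleLoop_mem_sphere hr s

lemma sphere_subset_image_circleLoop (hr : 0 ≤ r) :
    Metric.sphere c r ⊆ circleLoop c r '' Icc 0 1 := by
  rw [← abs_of_nonneg hr, ← image_circleMap_Ioc c r, abs_of_nonneg hr]
  rintro _ ⟨θ, hθ, rfl⟩
  have hπ := Real.two_pi_pos
  refine ⟨θ / (2 * Real.pi), ⟨div_nonneg hθ.1.le hπ.le, (div_le_one hπ).2 hθ.2⟩, ?_⟩
  rw [circleLoop, mul_div_cancel₀ _ hπ.ne']

lemma injOn_circleLoop (hr : r ≠ 0) : InjOn (circleLoop c r) (Ico 0 1) := by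
  have hπ := Real.two_pi_pos
  have hmaps : ∀ s ∈ Ico (0 : ℝ) 1, 2 * Real.pi * s ∈ Ico 0 (2 * Real.pi) := fun s hs =>
    ⟨mul_nonneg hπ.le hs.1, mul_lt_of_lt_one_right hπ hs.2⟩
  exact fun s hs s' hs' heq => mul_left_cancel₀ hπ.ne'
    (injOn_circleMap_of_abs_sub_le' hr (by simp) (hmaps s hs) (hmaps s' hs') heq)

lemma isContour_circleLoop (hr : r ≠ 0) : IsContour (circleLoop c r) where
  continuousOn := (contDiff_circleLoop c r).continuous.continuousOn
  closed := by simp [circleLoop, circleMap]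
  simple := injOn_circleLoop hr
  piecewise := ⟨∅, fun _ _ _ _ _ _ => (contDiff_circleLoop c r).contDiffOn⟩

lemma mem_ball_of_encloses (hr : 0 ≤ r) (h : Encloses (circleLoop c r) z) :
    z ∈ Metric.ball c r := by
  by_contra hz
  have hz' : z ∉ Metric.closedBall c r := by
    rw [← Metric.ball_union_sphere]
    exact fun H => h.1 (sphere_subset_image_circleLoop hr (H.resolve_left hz))
  have hne : ∀ w ∈ Metric.closedBall c r, w - z ≠ 0 := fun w hw =>
    sub_ne_zero.2 (ne_of_mem_of_not_mem hw hz')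
  have hint : ∮ w in C(c, r), (w - z)⁻¹ = 0 := by
    refine Complex.circleIntegral_eq_zero_of_differentiable_on_off_countable hr countable_empty
      (ContinuousOn.inv₀ (by fun_prop) hne) fun w hw => ?_
    exact DifferentiableAt.inv (by fun_prop) (hne w (Metric.ball_subset_closedBall hw.1))
  refine h.2 ?_
  simpa only [smul_eq_mul, ← div_eq_mul_inv, hint] using
    integral_circleLoop c r (fun w => (w - z)⁻¹)

lemma circleIntegral_eq_of_tendsto_sub_smul [CompleteSpace E] {f : ℂ → E} {L : E} (hr : 0 < r)
    (hf : ∀ ζ ∈ Metric.closedBall z r, ζ ≠ z → DifferentiableAt ℂ f ζ)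
    (hL : Tendsto (fun ζ => (ζ - z) • f ζ) (𝓝[≠] z) (𝓝 L)) :
    ∮ ζ in C(z, r), f ζ = (2 * Real.pi * Complex.I : ℂ) • L := by
  have hdiff : ∀ ζ ∈ Metric.closedBall z r, ζ ≠ z →
      DifferentiableAt ℂ (fun ζ => (ζ - z) • f ζ) ζ := fun ζ hζ hne =>
    DifferentiableAt.smul (by fun_prop) (hf ζ hζ hne)
  rw [← Complex.circleIntegral_sub_center_inv_smul_of_differentiable_on_off_countable_of_tendsto
    hr countable_empty
    (fun ζ hζ => (hdiff ζ hζ.1 hζ.2).continuousAt.continuousWithinAt)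
    (fun ζ hζ => hdiff ζ (Metric.ball_subset_closedBall hζ.1.1) hζ.1.2) hL]
  refine circleIntegral.integral_congr hr.le fun ζ hζ => ?_
  exact (inv_smul_smul₀ (sub_ne_zero.2 (Metric.ne_of_mem_sphere hζ hr.ne')) _).symm

end Circles

section Residue

/-- The matrix coefficient `⟨g, R f⟩` of the residue `R` of the resolvent of `L_t(Q)` at a simple
eigenvalue `z`, multiplied by `-F'(z)`; here `ω = e^{iπt}`. -/
noncomputable def residueForm (p q : ℝ → ℂ) (z ω : ℂ) (g f : L2 (Icc 0 Real.pi)) : ℂ :=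
  pairing (fun x => conjC2 (g x)) (fundamentalSolution p q z (residueVector p q z ω f))

variable {p q : ℝ → ℂ} {z : ℂ}

open Matrix

lemma inner_L2_eq_pairing {g y : L2 (Icc 0 Real.pi)} {u : ℝ → C2}
    (hy : y =ᵐ[volume.restrict (Icc 0 Real.pi)] u) :
    inner ℂ g y = pairing (fun x => conjC2 (g x)) u := by
  rw [L2.inner_def, pairing, intervalIntegral.integral_of_le Real.pi_pos.le,
    ← integral_Icc_eq_integral_Ioc]
  refine integral_congr_ae ?_
  filter_upwards [hy] with x hx
  rw [hx, inner_eq_dot, dot_comm]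

lemma intervalIntegrable_conjC2_L2 (g : L2 (Icc 0 Real.pi)) :
    IntervalIntegrable (fun x => conjC2 (g x)) volume 0 Real.pi :=
  intervalIntegrable_conjC2 (intervalIntegrable_coeFn_L2 Real.pi_pos.le g)

namespace BddPotential

variable {B : ℝ} (h : BddPotential p q B) {t : ℝ} {ω : ℂ}

include h

lemma residueVector_apply {f : ℝ → C2} (hf : IntervalIntegrable f volume 0 Real.pi) (z ω : ℂ)
    (i : Fin 2) : residueVector p q z ω f i =
      pairing f (fundamentalSolution p q z
        !₂[-(boundaryMatrix p q z ω).adjugate i 1, (boundaryMatrix p q z ω).adjugate i 0]) := by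
  rw [h.pairing_fundamentalSolution hf]
  simp only [residueVector, sourceVector, mulVec, dotProduct, Fin.sum_univ_two, cons_val_zero,
    cons_val_one]
  ring

lemma residueForm_eq (z ω : ℂ) (g f : L2 (Icc 0 Real.pi)) : residueForm p q z ω g f =
    residueVector p q z ω f 0 * pairing (fun x => conjC2 (g x)) (phi p q z) +
      residueVector p q z ω f 1 * pairing (fun x => conjC2 (g x)) (psi p q z) :=
  h.pairing_fundamentalSolution (intervalIntegrable_conjC2_L2 g) z _

lemma continuous_phi_psi_pi_apply (i : Fin 2) : Continuous (fun z => phi p q z Real.pi i) ∧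
    Continuous fun z => psi p q z Real.pi i :=
  ⟨(EuclideanSpace.proj (𝕜 := ℂ) i).continuous.comp
    (h.continuous_fundamentalSolution_left _ Real.pi_pos.le),
    (EuclideanSpace.proj (𝕜 := ℂ) i).continuous.comp
    (h.continuous_fundamentalSolution_left _ Real.pi_pos.le)⟩

lemma continuous_pairing_phi {f : ℝ → C2} (hf : IntervalIntegrable f volume 0 Real.pi) :
    Continuous fun z => pairing f (phi p q z) :=
  h.continuous_pairing_fundamentalSolution hf _

lemma continuous_pairing_psi {f : ℝ → C2} (hf : IntervalIntegrable f volume 0 Real.pi) :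
    Continuous fun z => pairing f (psi p q z) :=
  h.continuous_pairing_fundamentalSolution hf _

lemma continuous_residueForm (g f : L2 (Icc 0 Real.pi)) :
    Continuous fun x : ℂ × ℂ => residueForm p q x.1 x.2 g f := by
  have hg := intervalIntegrable_conjC2_L2 g
  have hf := intervalIntegrable_coeFn_L2 Real.pi_pos.le f
  have hφ := fun i => (h.continuous_phi_psi_pi_apply i).1.comp (continuous_fst (Y := ℂ))
  have hψ := fun i => (h.continuous_phi_psi_pi_apply i).2.comp (continuous_fst (Y := ℂ))
  have hgφ := (h.continuous_pairing_phi hg).comp (continuous_fst (Y := ℂ))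
  have hgψ := (h.continuous_pairing_psi hg).comp (continuous_fst (Y := ℂ))
  have hfφ := (h.continuous_pairing_phi hf).comp (continuous_fst (Y := ℂ))
  have hfψ := (h.continuous_pairing_psi hf).comp (continuous_fst (Y := ℂ))
  simp only [h.residueForm_eq, residueVector_zero_eq, residueVector_one_eq]
  exact (((((hψ 1).sub continuous_snd).mul hfψ).add ((hψ 0).mul hfφ)).mul hgφ).add
    ((((hφ 1).neg.mul hfψ).sub (((hφ 0).sub continuous_snd).mul hfφ)).mul hgψ)

lemma pairing_conjC2_fundamentalSolution_ne_zero (z : ℂ) {c : C2} (hc : c ≠ 0) :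
    pairing (fun x => conjC2 (fundamentalSolution p q z c x)) (fundamentalSolution p q z c) ≠
      0 := by
  rw [pairing_conjC2_self]
  exact_mod_cast (integral_norm_sq_pos Real.pi_pos
    (h.continuous_fundamentalSolution z c).continuousOn
    (by rwa [h.fundamentalSolution_zero])).ne'

lemma exists_residueVector_ne_zero (z : ℂ) (hω : ω ^ 2 ≠ 1) :
    ∃ f : L2 (Icc 0 Real.pi), residueVector p q z ω f ≠ 0 := by
  have hadj : (boundaryMatrix p q z ω).adjugate ≠ 0 := fun H => h.boundaryMatrix_ne_zero z hω (by
    simpa [H] using (adjugate_adjugate (boundaryMatrix p q z ω) (by simp)).symm)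
  obtain ⟨i, j, hij⟩ : ∃ i j, (boundaryMatrix p q z ω).adjugate i j ≠ 0 := by
    by_contra! H
    exact hadj (Matrix.ext H)
  set c : C2 :=
    !₂[-(boundaryMatrix p q z ω).adjugate i 1, (boundaryMatrix p q z ω).adjugate i 0] with hc
  have hc₀ : c ≠ 0 := fun H => by
    have hzero := congrArg (fun v : C2 => v 0) H
    have hone := congrArg (fun v : C2 => v 1) H
    simp only [hc, PiLp.toLp_apply, cons_val_zero, cons_val_one, PiLp.zero_apply,
      neg_eq_zero] at hzero hone
    match j with
    | 0 => exact hij hone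
    | 1 => exact hij hzero
  obtain ⟨f, hf⟩ := exists_L2_ae_eq
    (conjC2.continuous.comp (h.continuous_fundamentalSolution z c)).continuousOn
  refine ⟨f, fun H => h.pairing_conjC2_fundamentalSolution_ne_zero z hc₀ ?_⟩
  refine (pairing_congr _ hf).symm.trans ?_
  rw [hc, ← h.residueVector_apply (intervalIntegrable_coeFn_L2 Real.pi_pos.le f), H,
    PiLp.zero_apply]

lemma exists_residueForm_ne_zero (z : ℂ) (hω : ω ^ 2 ≠ 1) :
    ∃ g f : L2 (Icc 0 Real.pi), residueForm p q z ω g f ≠ 0 := by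
  obtain ⟨f, hf⟩ := h.exists_residueVector_ne_zero z hω
  obtain ⟨g, hg⟩ := h.exists_L2_ae_eq_fundamentalSolution z (residueVector p q z ω f)
  refine ⟨g, f, ?_⟩
  have hconj : (fun x => conjC2 (g x)) =ᵐ[volume.restrict (Icc 0 Real.pi)]
      fun x => conjC2 (fundamentalSolution p q z (residueVector p q z ω f) x) :=
    hg.fun_comp conjC2
  rw [residueForm, pairing_congr _ hconj]
  exact h.pairing_conjC2_fundamentalSolution_ne_zero z hf

lemma exists_isSolution_resolvent (hD : discriminant p q z ≠ multiplier t + (multiplier t)⁻¹)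
    (f : L2 (Icc 0 Real.pi)) :
    ∃ u, IsSolution p q (Icc 0 Real.pi) z f u ∧ u Real.pi = multiplier t • u 0 ∧
      resolvent (op p q t) z f =ᵐ[volume.restrict (Icc 0 Real.pi)] u := by
  obtain ⟨hdom, hres⟩ := (isResolventAt_resolvent (h.mem_resolventSet_op hD)).1 f
  obtain ⟨u, hu, hb, hy⟩ := exists_isSolution_of_mem_graph_op ((op p q t).mem_graph ⟨_, hdom⟩) z
  rw [hres] at hu
  exact ⟨u, hu, hb, hy⟩

lemma norm_discriminant_mul_inner_resolvent_add_le
    (hD : discriminant p q z ≠ multiplier t + (multiplier t)⁻¹) {K : ℝ}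
    (hK : ∀ x ∈ Icc 0 Real.pi, ‖phi p q z x‖ ≤ K ∧ ‖psi p q z x‖ ≤ K)
    (g f : L2 (Icc 0 Real.pi)) :
    ‖(discriminant p q z - (multiplier t + (multiplier t)⁻¹)) *
        inner ℂ g (resolvent (op p q t) z f) + residueForm p q z (multiplier t) g f‖ ≤
      2 * (‖discriminant p q z - (multiplier t + (multiplier t)⁻¹)‖ *
        (8 * K ^ 2 * ∫ x in (0 : ℝ)..Real.pi, ‖f x‖)) *
        ∫ x in (0 : ℝ)..Real.pi, ‖conjC2 (g x)‖ := by
  obtain ⟨u, hu, hb, hy⟩ := h.exists_isSolution_resolvent hD f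
  have hg := intervalIntegrable_conjC2_L2 g
  rw [inner_L2_eq_pairing hy, residueForm, ← one_mul (pairing _ (fundamentalSolution _ _ _ _)),
    ← pairing_add_smul hg (hu.continuousOn subset_rfl)
      (h.continuous_fundamentalSolution z _).continuousOn]
  refine norm_integral_dot_le hg (fun x hx => ?_) (right_mem_Icc.2 Real.pi_pos.le)
  rw [one_smul]
  exact h.norm_discriminant_smul_add_residue_le (multiplier_ne_zero t) hK
    (intervalIntegrable_coeFn_L2 Real.pi_pos.le f) le_rfl hu hb hx

lemma tendsto_discriminant_mul_inner_resolvent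
    (hD : discriminant p q z = multiplier t + (multiplier t)⁻¹)
    (hne : ∀ᶠ ζ in 𝓝[≠] z, discriminant p q ζ ≠ multiplier t + (multiplier t)⁻¹)
    (g f : L2 (Icc 0 Real.pi)) :
    Tendsto (fun ζ => (discriminant p q ζ - (multiplier t + (multiplier t)⁻¹)) *
        inner ℂ g (resolvent (op p q t) ζ f)) (𝓝[≠] z)
      (𝓝 (-residueForm p q z (multiplier t) g f)) := by
  obtain ⟨K, -, hK⟩ := h.exists_norm_phi_psi_le (‖z‖ + 1) Real.pi
  have hD₀ : Tendsto (fun ζ => ‖discriminant p q ζ - (multiplier t + (multiplier t)⁻¹)‖)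
      (𝓝[≠] z) (𝓝 0) := by
    rw [← tendsto_iff_norm_sub_tendsto_zero, ← hD]
    exact h.differentiable_discriminant.continuous.continuousAt.mono_left nhdsWithin_le_nhds
  have hform : Tendsto (fun ζ => residueForm p q ζ (multiplier t) g f) (𝓝[≠] z)
      (𝓝 (residueForm p q z (multiplier t) g f)) :=
    ((h.continuous_residueForm g f).comp (Continuous.prodMk_left _)).continuousAt.mono_left
      nhdsWithin_le_nhds
  have herr := squeeze_zero_norm' (f := fun ζ =>
      (discriminant p q ζ - (multiplier t + (multiplier t)⁻¹)) *
        inner ℂ g (resolvent (op p q t) ζ f) + residueForm p q ζ (multiplier t) g f)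
    (a := fun ζ => 2 * (‖discriminant p q ζ - (multiplier t + (multiplier t)⁻¹)‖ *
      (8 * K ^ 2 * ∫ x in (0 : ℝ)..Real.pi, ‖f x‖)) * ∫ x in (0 : ℝ)..Real.pi, ‖conjC2 (g x)‖)
    (by
      filter_upwards [hne, mem_nhdsWithin_of_mem_nhds (Metric.ball_mem_nhds z one_pos)] with ζ hζ
        hζz
      rw [mem_ball_iff_norm] at hζz
      have hζ₁ : ‖ζ‖ ≤ ‖z‖ + 1 := by linarith [norm_le_norm_add_norm_sub' ζ z]
      exact h.norm_discriminant_mul_inner_resolvent_add_le hζ (hK ζ hζ₁) g f)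
    (by simpa only [zero_mul, mul_zero] using ((hD₀.mul_const _).const_mul 2).mul_const _)
  simpa only [add_sub_cancel_right, zero_sub] using herr.sub hform

lemma tendsto_sub_mul_inner_resolvent
    (hD : discriminant p q z = multiplier t + (multiplier t)⁻¹) (hF : discriminantDeriv p q z ≠ 0)
    (hne : ∀ᶠ ζ in 𝓝[≠] z, discriminant p q ζ ≠ multiplier t + (multiplier t)⁻¹)
    (g f : L2 (Icc 0 Real.pi)) :
    Tendsto (fun ζ => (ζ - z) * inner ℂ g (resolvent (op p q t) ζ f)) (𝓝[≠] z)
      (𝓝 (-residueForm p q z (multiplier t) g f / discriminantDeriv p q z)) := by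
  have hslope := (hasDerivAt_iff_tendsto_slope.1 (h.hasDerivAt_discriminant z)).inv₀ hF
  rw [div_eq_inv_mul]
  refine (hslope.mul (h.tendsto_discriminant_mul_inner_resolvent hD hne g f)).congr' ?_
  filter_upwards [hne] with ζ hζ
  rw [slope_def_field, inv_div, ← hD, ← mul_assoc, div_mul_cancel₀ _ (sub_ne_zero.2 (hD ▸ hζ))]

lemma differentiableAt_resolvent_op
    (hz : discriminant p q z ≠ multiplier t + (multiplier t)⁻¹) :
    DifferentiableAt ℂ (resolvent (op p q t)) z :=
  differentiableAt_resolvent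
    (isOpen_ne_fun h.differentiable_discriminant.continuous continuous_const)
    (fun _ hζ => h.mem_resolventSet_op hζ) hz

lemma inner_contourProj_circleLoop {r : ℝ} (hr : 0 < r)
    (hD : discriminant p q z = multiplier t + (multiplier t)⁻¹) (hF : discriminantDeriv p q z ≠ 0)
    (hne : ∀ ζ ∈ Metric.closedBall z r, ζ ≠ z →
      discriminant p q ζ ≠ multiplier t + (multiplier t)⁻¹) (g f : L2 (Icc 0 Real.pi)) :
    inner ℂ g (contourProj p q t (circleLoop z r) f) = (2 * Real.pi * Complex.I) *
      (-residueForm p q z (multiplier t) g f / discriminantDeriv p q z) := by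
  let Λ : (L2 (Icc 0 Real.pi) →L[ℂ] L2 (Icc 0 Real.pi)) →L[ℂ] ℂ :=
    (innerSL ℂ g).comp (ContinuousLinearMap.apply ℂ (L2 (Icc 0 Real.pi)) f)
  have hdiff : ∀ ζ ∈ Metric.closedBall z r, ζ ≠ z →
      DifferentiableAt ℂ (resolvent (op p q t)) ζ := fun ζ hζ hζz =>
    h.differentiableAt_resolvent_op (hne ζ hζ hζz)
  have hint : CircleIntegrable (resolvent (op p q t)) z r :=
    ContinuousOn.circleIntegrable hr.le fun ζ hζ =>
      (hdiff ζ (Metric.sphere_subset_closedBall hζ)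
        (Metric.ne_of_mem_sphere hζ hr.ne')).continuousAt.continuousWithinAt
  have hpole : ∀ᶠ ζ in 𝓝[≠] z, discriminant p q ζ ≠ multiplier t + (multiplier t)⁻¹ := by
    filter_upwards [self_mem_nhdsWithin,
      mem_nhdsWithin_of_mem_nhds (Metric.closedBall_mem_nhds z hr)] with ζ hζz hζ using hne ζ hζ hζz
  calc Λ (contourProj p q t (circleLoop z r))
      = ∮ ζ in C(z, r), inner ℂ g (resolvent (op p q t) ζ f) := by
        have hproj : contourProj p q t (circleLoop z r) = ∮ ζ in C(z, r), resolvent (op p q t) ζ :=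
          integral_circleLoop z r _
        refine (congrArg Λ hproj).trans
          ((Λ.intervalIntegral_comp_comm hint.out).symm.trans ?_)
        exact intervalIntegral.integral_congr fun θ _ => map_smul Λ _ _
    _ = _ := circleIntegral_eq_of_tendsto_sub_smul hr
        (fun ζ hζ hζz => Λ.differentiableAt.comp ζ (hdiff ζ hζ hζz))
        (h.tendsto_sub_mul_inner_resolvent hD hF hpole g f)

lemma norm_residueForm_le {r : ℝ} (hr : 0 < r)
    (hD : discriminant p q z = multiplier t + (multiplier t)⁻¹) (hF : discriminantDeriv p q z ≠ 0)
    (hne : ∀ ζ ∈ Metric.closedBall z r, ζ ≠ z →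
      discriminant p q ζ ≠ multiplier t + (multiplier t)⁻¹) (g f : L2 (Icc 0 Real.pi)) :
    2 * Real.pi * ‖residueForm p q z (multiplier t) g f‖ ≤
      ‖discriminantDeriv p q z‖ * (‖g‖ * (‖contourProj p q t (circleLoop z r)‖ * ‖f‖)) := by
  have hF' : 0 < ‖discriminantDeriv p q z‖ := norm_pos_iff.2 hF
  have hle : ‖inner ℂ g (contourProj p q t (circleLoop z r) f)‖ ≤
      ‖g‖ * (‖contourProj p q t (circleLoop z r)‖ * ‖f‖) :=
    (norm_inner_le_norm _ _).trans (by gcongr; exact ContinuousLinearMap.le_opNorm _ _)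
  have h2πi : ‖(2 * Real.pi * Complex.I : ℂ)‖ = 2 * Real.pi := by
    rw [norm_mul, Complex.norm_I, mul_one]
    exact_mod_cast Complex.norm_of_nonneg Real.two_pi_pos.le
  rw [h.inner_contourProj_circleLoop hr hD hF hne, norm_mul, norm_div, norm_neg, h2πi,
    ← mul_div_assoc, div_le_iff₀' hF'] at hle
  exact hle

end BddPotential

end Residue

section MultipleEigenvalue

lemma exists_mem_nhds_injOn_of_hasStrictDerivAt {𝕜 : Type*} [NontriviallyNormedField 𝕜]
    [CompleteSpace 𝕜] {F : 𝕜 → 𝕜} {F' w : 𝕜} (hF : HasStrictDerivAt F F' w) (hF' : F' ≠ 0) :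
    ∃ s ∈ 𝓝 w, InjOn F s := by
  have hs := hF.hasStrictFDerivAt_equiv hF'
  exact ⟨(hs.toOpenPartialHomeomorph F).source,
    (hs.toOpenPartialHomeomorph F).open_source.mem_nhds hs.mem_toOpenPartialHomeomorph_source,
    (hs.toOpenPartialHomeomorph F).injOn⟩

lemma continuous_multiplier : Continuous multiplier :=
  Complex.continuous_exp.comp (continuous_const.mul continuous_id)

lemma continuous_multiplier_ofReal : Continuous fun s : ℝ => multiplier s :=
  continuous_multiplier.comp Complex.continuous_ofReal

lemma hasDerivAt_cos_pi_mul (t : ℝ) :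
    HasDerivAt (fun s => Real.cos (Real.pi * s)) (-Real.sin (Real.pi * t) * Real.pi) t :=
  (Real.hasDerivAt_cos _).comp t (hasDerivAt_const_mul Real.pi)

lemma eventually_multiplier_add_inv_ne {t : ℝ} (ht : Real.sin (Real.pi * t) ≠ 0) :
    ∀ᶠ s : ℝ in 𝓝[≠] t,
      multiplier s + (multiplier s)⁻¹ ≠ multiplier t + (multiplier t)⁻¹ := by
  filter_upwards [(hasDerivAt_cos_pi_mul t).eventually_ne (c := Real.cos (Real.pi * t))
    (mul_ne_zero (neg_ne_zero.2 ht) Real.pi_ne_zero)] with s hs hst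
  rw [multiplier_add_inv, multiplier_add_inv, Complex.ofReal_inj] at hst
  exact hs (mul_left_cancel₀ two_ne_zero hst)

namespace BddPotential

variable {p q : ℝ → ℂ} {B : ℝ} (h : BddPotential p q B) {t : ℝ} {z : ℂ}

include h

lemma deriv_discriminant : deriv (discriminant p q) = discriminantDeriv p q :=
  funext fun z => (h.hasDerivAt_discriminant z).deriv

lemma analyticOnNhd_discriminant : AnalyticOnNhd ℂ (discriminant p q) univ :=
  h.differentiable_discriminant.differentiableOn.analyticOnNhd isOpen_univ

lemma analyticOnNhd_discriminantDeriv : AnalyticOnNhd ℂ (discriminantDeriv p q) univ := by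
  rw [← h.deriv_discriminant]
  exact h.analyticOnNhd_discriminant.deriv

lemma continuous_discriminantDeriv : Continuous (discriminantDeriv p q) :=
  continuousOn_univ.1 h.analyticOnNhd_discriminantDeriv.continuousOn

-- Eigenvalues of `L_t(Q)` lie in a horizontal strip, so `F` omits the value `2 cos πt` outside it.
lemma exists_discriminant_ne (t : ℝ) :
    ∃ z, discriminant p q z ≠ multiplier t + (multiplier t)⁻¹ := by
  refine ⟨(2 * B + 1 : ℝ) * Complex.I, fun hD => ?_⟩
  obtain ⟨v, hv, hNv⟩ := h.exists_boundaryMatrix_mulVec_eq_zero (multiplier_ne_zero t) hD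
  have him := h.abs_im_le_of_boundary (norm_multiplier t) Real.pi_pos
    (h.isSolution_fundamentalSolution _ v (Icc 0 Real.pi))
    (by rw [h.fundamentalSolution_zero]; exact (h.fundamentalSolution_pi_eq_iff _ v).2 hNv)
    (by rwa [h.fundamentalSolution_zero])
  rw [Complex.im_ofReal_mul, Complex.I_im, mul_one] at him
  linarith [le_abs_self (2 * B + 1)]

lemma not_eventually_discriminant_eq (hD : discriminant p q z = multiplier t + (multiplier t)⁻¹) :
    ¬ ∀ᶠ ζ in 𝓝 z, discriminant p q ζ = discriminant p q z := fun H => by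
  obtain ⟨w, hw⟩ := h.exists_discriminant_ne t
  exact hw ((congrFun (h.analyticOnNhd_discriminant.eq_of_eventuallyEq
    (fun _ _ => analyticAt_const) H) w).trans hD)

lemma nhds_le_map_discriminant (hD : discriminant p q z = multiplier t + (multiplier t)⁻¹) :
    𝓝 (discriminant p q z) ≤ map (discriminant p q) (𝓝 z) :=
  (h.analyticOnNhd_discriminant z trivial).eventually_constant_or_nhds_le_map_nhds.resolve_left
    (h.not_eventually_discriminant_eq hD)

lemma eventually_discriminantDeriv_ne_zero
    (hD : discriminant p q z = multiplier t + (multiplier t)⁻¹) :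
    ∀ᶠ ζ in 𝓝[≠] z, discriminantDeriv p q ζ ≠ 0 := by
  refine (h.analyticOnNhd_discriminantDeriv z
    trivial).eventually_eq_zero_or_eventually_ne_zero.resolve_left fun H => ?_
  have hzero := h.analyticOnNhd_discriminantDeriv.eq_of_eventuallyEq (g := fun _ => 0)
    (fun _ _ => analyticAt_const) H
  refine h.not_eventually_discriminant_eq hD (Eventually.of_forall fun ζ => ?_)
  exact is_const_of_deriv_eq_zero h.differentiable_discriminant
    (fun x => by rw [h.deriv_discriminant]; exact congrFun hzero x) ζ z

lemma exists_discriminant_eq_ne (ht : Real.sin (Real.pi * t) ≠ 0)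
    (hD : discriminant p q z = multiplier t + (multiplier t)⁻¹) {S : ℂ × ℝ → Prop}
    (hS : ∀ᶠ x in 𝓝 (z, t), S x) :
    ∃ w, ∃ s : ℝ, S (w, s) ∧ discriminant p q w = multiplier s + (multiplier s)⁻¹ ∧ w ≠ z := by
  rw [nhds_prod_eq] at hS
  obtain ⟨P, hP, P', hP', hPP'⟩ := eventually_prod_iff.1 hS
  have hcont : Continuous fun s : ℝ => multiplier s + (multiplier s)⁻¹ :=
    continuous_multiplier_ofReal.add
      (continuous_multiplier_ofReal.inv₀ fun s => multiplier_ne_zero s)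
  have himage : ∀ᶠ s : ℝ in 𝓝 t,
      multiplier s + (multiplier s)⁻¹ ∈ discriminant p q '' {w | P w} := by
    have := h.nhds_le_map_discriminant hD (image_mem_map hP)
    rw [hD] at this
    exact hcont.continuousAt.eventually this
  obtain ⟨s, ⟨hs, w, hw, hDw⟩, hne⟩ := ((eventually_nhdsWithin_of_eventually_nhds
    (hP'.and himage)).and (eventually_multiplier_add_inv_ne ht)).exists
  refine ⟨w, s, hPP' hw hs, hDw, ?_⟩
  rintro rfl
  exact hne (hDw.symm.trans hD)

lemma enclosesAtMostOne_circleLoop {w : ℂ} {r : ℝ} (hr : 0 ≤ r)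
    (hinj : InjOn (discriminant p q) (Metric.closedBall w r))
    (hF : ∀ ζ ∈ Metric.closedBall w r, discriminantDeriv p q ζ ≠ 0)
    (hne : ∀ ζ ∈ Metric.closedBall w r, discriminant p q ζ ^ 2 ≠ 4) (s : ℝ) :
    EnclosesAtMostOne p q s (circleLoop w r) := by
  have hmem {a : ℂ} (ha : Encloses (circleLoop w r) a) : a ∈ Metric.closedBall w r :=
    Metric.ball_subset_closedBall (mem_ball_of_encloses hr ha)
  constructor
  · rintro a ⟨ha, ha'⟩ b ⟨hb, hb'⟩
    exact hinj (hmem ha') (hmem hb')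
      ((h.discriminant_eq_of_isEigenvalue ha).trans (h.discriminant_eq_of_isEigenvalue hb).symm)
  · intro a ha
    refine h.algMultiplicity_le_one (fun hD => ?_) (hF a (hmem ha))
    rw [Ne, ← add_inv_sq_eq_four_iff (multiplier_ne_zero s), ← hD]
    exact hne a (hmem ha)

lemma exists_circle_norm_residueForm_le {w : ℂ} {s : ℝ}
    (hD : discriminant p q w = multiplier s + (multiplier s)⁻¹)
    (hF : discriminantDeriv p q w ≠ 0) {V : Set ℂ} (hV : V ∈ 𝓝 w)
    (hVF : ∀ ζ ∈ V, discriminantDeriv p q ζ ≠ 0) (hVne : ∀ ζ ∈ V, discriminant p q ζ ^ 2 ≠ 4) :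
    ∃ r, 0 < r ∧ Metric.closedBall w r ⊆ V ∧
      (∀ s : ℝ, EnclosesAtMostOne p q s (circleLoop w r)) ∧
      Metric.sphere w r ⊆ resolventSet (op p q s) ∧ ∀ g f,
        2 * Real.pi * ‖residueForm p q w (multiplier s) g f‖ ≤
          ‖discriminantDeriv p q w‖ * (‖g‖ * (‖contourProj p q s (circleLoop w r)‖ * ‖f‖)) := by
  obtain ⟨N, hN, hinj⟩ := exists_mem_nhds_injOn_of_hasStrictDerivAt
    (h.analyticOnNhd_discriminant w trivial).hasStrictDerivAt
    (by rwa [h.deriv_discriminant])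
  obtain ⟨r, hr, hball⟩ := Metric.nhds_basis_closedBall.mem_iff.1 (inter_mem hN hV)
  have hinjr := hinj.mono (hball.trans inter_subset_left)
  have hballV := hball.trans inter_subset_right
  have hne : ∀ ζ ∈ Metric.closedBall w r, ζ ≠ w →
      discriminant p q ζ ≠ multiplier s + (multiplier s)⁻¹ := fun ζ hζ hζw hζD =>
    hζw (hinjr hζ (Metric.mem_closedBall_self hr.le) (hζD.trans hD.symm))
  exact ⟨r, hr, hballV,
    h.enclosesAtMostOne_circleLoop hr.le hinjr (fun ζ hζ => hVF ζ (hballV hζ))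
      (fun ζ hζ => hVne ζ (hballV hζ)),
    fun ζ hζ => h.mem_resolventSet_op (hne ζ (Metric.sphere_subset_closedBall hζ)
      (Metric.ne_of_mem_sphere hζ hr.ne')),
    h.norm_residueForm_le hr hD hF hne⟩

lemma eventually_norm_discriminantDeriv_mul_lt (hF : discriminantDeriv p q z = 0)
    {g f : L2 (Icc 0 Real.pi)} (hgf : residueForm p q z (multiplier t) g f ≠ 0) (C : ℝ) :
    ∀ᶠ x : ℂ × ℝ in 𝓝 (z, t), ‖discriminantDeriv p q x.1‖ * C <
      2 * Real.pi * ‖residueForm p q x.1 (multiplier x.2) g f‖ := by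
  have hleft : Continuous fun x : ℂ × ℝ => ‖discriminantDeriv p q x.1‖ * C :=
    ((h.continuous_discriminantDeriv.comp continuous_fst).norm).mul_const C
  have hright : Continuous fun x : ℂ × ℝ =>
      2 * Real.pi * ‖residueForm p q x.1 (multiplier x.2) g f‖ :=
    ((h.continuous_residueForm g f).comp (continuous_fst.prodMk
      (continuous_multiplier_ofReal.comp continuous_snd))).norm.const_mul _
  refine hleft.continuousAt.eventually_lt hright.continuousAt ?_
  rw [hF, norm_zero, zero_mul]
  exact mul_pos Real.two_pi_pos (norm_pos_iff.2 hgf)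

lemma eventually_nhdsNE_discriminant (ht : Real.sin (Real.pi * t) ≠ 0)
    (hD : discriminant p q z = multiplier t + (multiplier t)⁻¹) :
    ∀ᶠ ζ in 𝓝[≠] z, discriminantDeriv p q ζ ≠ 0 ∧ discriminant p q ζ ^ 2 ≠ 4 := by
  refine (h.eventually_discriminantDeriv_ne_zero hD).and
    (eventually_nhdsWithin_of_eventually_nhds ?_)
  refine (h.differentiable_discriminant.continuous.pow 2).continuousAt.eventually_ne ?_
  rw [Pi.pow_apply, hD, Ne, add_inv_sq_eq_four_iff (multiplier_ne_zero t),
    multiplier_sq_eq_one_iff]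
  exact ht

lemma exists_contour (ht : t ∈ Ioo (-1 : ℝ) 1) (hs : Real.sin (Real.pi * t) ≠ 0)
    (hD : discriminant p q z = multiplier t + (multiplier t)⁻¹)
    (hF : discriminantDeriv p q z = 0) {ε : ℝ} (hε : 0 < ε) (C : ℝ) :
    ∃ γ : ℝ → ℂ, (IsContour γ ∧ γ '' Icc 0 1 ⊆ Metric.ball z ε ∧
      ∀ s ∈ Ioc (-1 : ℝ) 1, EnclosesAtMostOne p q s γ) ∧
      ∃ s : ℝ, (s ∈ Ioc (-1 : ℝ) 1 ∧ γ '' Icc 0 1 ⊆ resolventSet (op p q s)) ∧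
        C < ‖contourProj p q s γ‖ := by
  obtain ⟨g, f, hgf⟩ := h.exists_residueForm_ne_zero z (mt multiplier_sq_eq_one_iff.1 hs)
  have hnear : ∀ᶠ ζ in 𝓝 z, ∀ᶠ ξ in 𝓝 ζ, ζ ≠ z →
      ξ ∈ Metric.ball z ε ∧ discriminantDeriv p q ξ ≠ 0 ∧ discriminant p q ξ ^ 2 ≠ 4 := by
    filter_upwards [eventually_eventually_nhds.2 (Metric.ball_mem_nhds z hε),
      eventually_eventually_nhds.2 (eventually_nhdsWithin_iff.1
        (h.eventually_nhdsNE_discriminant hs hD))] with ζ hball hζ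
    by_cases hζz : ζ = z
    · exact Eventually.of_forall fun _ hne => absurd hζz hne
    · filter_upwards [hball, hζ, isOpen_ne.mem_nhds hζz] with ξ h1 h2 h3 _ using ⟨h1, h2 h3⟩
  obtain ⟨w, s, ⟨⟨hw, hsI⟩, hlt⟩, hDw, hwz⟩ := h.exists_discriminant_eq_ne hs hD
    ((hnear.prod_nhds (Ioo_mem_nhds ht.1 ht.2)).and
      (h.eventually_norm_discriminantDeriv_mul_lt hF hgf (‖g‖ * (C * ‖f‖))))
  have hV := hw.mono fun ξ hξ => hξ hwz
  obtain ⟨r, hr, hrV, hone, hres, hle⟩ := h.exists_circle_norm_residueForm_le hDw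
    hV.self_of_nhds.2.1 hV (fun ζ hζ => hζ.2.1) (fun ζ hζ => hζ.2.2)
  have hsphere := image_circleLoop_subset_sphere (c := w) hr.le
  refine ⟨circleLoop w r, ⟨isContour_circleLoop hr.ne', fun ζ hζ =>
      (hrV (Metric.sphere_subset_closedBall (hsphere hζ))).1, fun s' _ => hone s'⟩,
    s, ⟨Ioo_subset_Ioc_self hsI, hsphere.trans hres⟩, ?_⟩
  by_contra! hC
  refine (hlt.trans_le (hle g f)).not_ge ?_
  gcongr

lemma exists_contours (ht : t ∈ Ioo (-1 : ℝ) 1) (hs : Real.sin (Real.pi * t) ≠ 0)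
    (hD : discriminant p q z = multiplier t + (multiplier t)⁻¹)
    (hF : discriminantDeriv p q z = 0) {ε : ℝ} (hε : 0 < ε) :
    ∃ γ : ℕ → ℝ → ℂ, (∀ n, IsContour (γ n) ∧ γ n '' Icc 0 1 ⊆ Metric.ball z ε ∧
      ∀ t ∈ Ioc (-1 : ℝ) 1, EnclosesAtMostOne p q t (γ n)) ∧
    Tendsto (fun n => ⨆ t ∈ {t : ℝ | t ∈ Ioc (-1 : ℝ) 1 ∧
        γ n '' Icc 0 1 ⊆ resolventSet (op p q t)}, ‖contourProj p q t (γ n)‖ₑ)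
      atTop (𝓝 ⊤) := by
  choose γ hγ s hs' hC using fun n : ℕ => h.exists_contour ht hs hD hF hε n
  refine ⟨γ, hγ, tendsto_nhds_top_mono ENNReal.tendsto_nat_nhds_top
    (Eventually.of_forall fun n => ?_)⟩
  calc (n : ENNReal) = ENNReal.ofReal n := (ENNReal.ofReal_natCast n).symm
    _ ≤ ENNReal.ofReal ‖contourProj p q (s n) (γ n)‖ := ENNReal.ofReal_le_ofReal (hC n).le
    _ = ‖contourProj p q (s n) (γ n)‖ₑ := ofReal_norm _
    _ ≤ _ := le_iSup₂ (f := fun t _ => ‖contourProj p q t (γ n)‖ₑ) (s n) (hs' n)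

end BddPotential

end MultipleEigenvalue

section AdjointEigenvectors

open Matrix

lemma inner_eq_zero_of_isEigenvector_adjoint {H : Type*} [NormedAddCommGroup H]
    [InnerProductSpace ℂ H] [CompleteSpace H] {T : H →ₗ.[ℂ] H} (hT : Dense (T.domain : Set H))
    {z : ℂ} {Ψ y w : H} (hΨ : IsEigenvector T.adjoint (star z) Ψ)
    (hw : (y, w + z • y) ∈ T.graph) : inner ℂ Ψ w = 0 := by
  obtain ⟨-, hdom, hTΨ⟩ := hΨ
  obtain ⟨y, rfl, hTy⟩ := (LinearPMap.mem_graph_iff _).1 hw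
  have hadj := LinearPMap.adjoint_isFormalAdjoint hT ⟨Ψ, hdom⟩ y
  rw [hTΨ, hTy, inner_smul_left, inner_add_right, inner_smul_right, starRingEnd_apply,
    star_star] at hadj
  exact right_eq_add.1 hadj

lemma negJ_negJ (u : C2) : negJ (negJ u) = -u := by
  rw [C2.ext_iff]
  simp only [negJ_apply_zero, negJ_apply_one, PiLp.neg_apply, and_self]

lemma isPrimitive_smul_const {χ : ℝ → ℝ} (hχ : ContDiff ℝ 1 χ) (e : C2) (s : Set ℝ) :
    IsPrimitive s (fun x => χ x • e) (fun x => deriv χ x • e) := by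
  have hderiv : Continuous (deriv χ) := hχ.continuous_deriv le_rfl
  refine fun a _ b _ => ⟨(hderiv.smul continuous_const).intervalIntegrable _ _, ?_⟩
  rw [intervalIntegral.integral_smul_const, intervalIntegral.integral_deriv_eq_sub
    (fun x _ => hχ.differentiable one_ne_zero x) (hderiv.intervalIntegrable _ _), sub_smul]

lemma eq_zero_of_integral_contDiff_smul_eq_zero {a b : ℝ} {g : L2 (Icc a b)}
    (hg : ∀ χ : ℝ → ℝ, ContDiff ℝ 1 χ → (∀ x ∉ Ioo a b, χ x = 0) →
      ∫ x in Icc a b, χ x • g x = 0) : g = 0 := by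
  have hint : IntegrableOn g (Icc a b) := (Lp.memLp g).integrable one_le_two
  have hzero : ∀ᵐ x, x ∈ Ioo a b → g x = 0 := by
    refine isOpen_Ioo.ae_eq_zero_of_integral_contDiff_smul_eq_zero
      (hint.mono_set Ioo_subset_Icc_self).locallyIntegrableOn fun χ hχ _ hsupp => ?_
    have hχ₀ : ∀ x ∉ Ioo a b, χ x = 0 := fun x hx =>
      image_eq_zero_of_notMem_tsupport fun hx' => hx (hsupp hx')
    rw [← hg χ (hχ.of_le (by simp)) hχ₀]
    refine (setIntegral_eq_integral_of_forall_compl_eq_zero fun x hx => ?_).symm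
    rw [hχ₀ x fun hx' => hx (Ioo_subset_Icc_self hx'), zero_smul]
  have hae : g =ᵐ[volume.restrict (Icc a b)] 0 :=
    (ae_restrict_congr_set Ioo_ae_eq_Icc).1 ((ae_restrict_iff' measurableSet_Ioo).2 hzero)
  exact Lp.ext (hae.trans (Lp.coeFn_zero _ _ _).symm)

lemma pairing_sub_left {f k u : ℝ → C2} (hf : IntervalIntegrable f volume 0 Real.pi)
    (hk : IntervalIntegrable k volume 0 Real.pi) (hu : ContinuousOn u (Icc 0 Real.pi)) :
    pairing (f - k) u = pairing f u - pairing k u := by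
  rw [← uIcc_of_le Real.pi_pos.le] at hu
  simp only [pairing]
  rw [← intervalIntegral.integral_sub (intervalIntegrable_dot hf hu) (intervalIntegrable_dot hk hu)]
  refine intervalIntegral.integral_congr fun x _ => ?_
  simp only [dot, Pi.sub_apply, PiLp.sub_apply]
  ring

lemma residueVector_smul (p q : ℝ → ℂ) (z ω c : ℂ) (f : ℝ → C2) :
    residueVector p q z ω (c • f) = c • residueVector p q z ω f := by
  rw [C2.ext_iff, PiLp.smul_apply, PiLp.smul_apply]
  simp only [residueVector_zero_eq, residueVector_one_eq, pairing_smul_left, smul_eq_mul]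
  constructor <;> ring

namespace BddPotential

variable {p q : ℝ → ℂ} {B : ℝ} (h : BddPotential p q B) {t : ℝ} {z : ℂ}

include h

lemma memLp_diracExpr {u g : ℝ → C2} {a b : ℝ} (hu : ContinuousOn u (Icc a b))
    (hg : ContinuousOn g (Icc a b)) :
    MemLp (diracExpr p q u g) 2 (volume.restrict (Icc a b)) := by
  obtain ⟨C, hC⟩ := h.exists_norm_coefficient_le 0
  obtain ⟨K, hK⟩ := isCompact_Icc.exists_bound_of_continuousOn hu
  have hcoeff : MemLp (fun x => coefficient p q 0 x (u x)) 2 (volume.restrict (Icc a b)) := by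
    refine .of_bound (aestronglyMeasurable_clm_apply
      (h.aestronglyMeasurable_coefficient 0).restrict
      (hu.aestronglyMeasurable measurableSet_Icc)) (C * K) ?_
    filter_upwards [ae_restrict_mem measurableSet_Icc] with x hx
    exact (coefficient p q 0 x).le_of_opNorm_le_of_le (hC 0 norm_zero.le x) (hK x hx)
  have heq : diracExpr p q u g = fun x => -negJ (g x - coefficient p q 0 x (u x)) := by
    funext x
    rw [(diracExpr_eq_iff (z := 0)).1 (by rw [zero_smul, zero_add] : diracExpr p q u g x = _),
      add_sub_cancel_right, negJ_negJ, neg_neg]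
  rw [heq]
  exact (negJ.comp_memLp' ((memLp_of_continuousOn_Icc hg).sub hcoeff)).neg

lemma exists_mem_domain_op {t : ℂ} {u g : ℝ → C2} (hu : IsPrimitive (Icc 0 Real.pi) u g)
    (hg : ContinuousOn g (Icc 0 Real.pi)) (hb : u Real.pi = multiplier t • u 0) :
    ∃ y ∈ (op p q t).domain, y =ᵐ[volume.restrict (Icc 0 Real.pi)] u := by
  have hsol : IsSolution p q (Icc 0 Real.pi) 0 (diracExpr p q u g) u :=
    ⟨g, hu, .of_forall fun x => by rw [zero_smul, zero_add]⟩
  have hcont : ContinuousOn u (Icc 0 Real.pi) := hsol.continuousOn subset_rfl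
  obtain ⟨y, hy⟩ := exists_L2_ae_eq hcont
  exact ⟨y, LinearPMap.mem_domain_of_mem_graph
    (hsol.mem_graph_op hb hy (MemLp.coeFn_toLp (h.memLp_diracExpr hcont hg))), hy⟩

lemma dense_domain_op (t : ℂ) : Dense ((op p q t).domain : Set (L2 (Icc 0 Real.pi))) := by
  rw [Submodule.dense_iff_topologicalClosure_eq_top, Submodule.topologicalClosure_eq_top_iff,
    Submodule.eq_bot_iff]
  refine fun g hg => eq_zero_of_integral_contDiff_smul_eq_zero fun χ hχ hχ₀ => ?_
  have hint : IntegrableOn (fun x => χ x • g x) (Icc 0 Real.pi) :=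
    IntegrableOn.continuousOn_smul ((Lp.memLp g).integrable one_le_two)
      hχ.continuous.continuousOn isCompact_Icc
  refine ext_inner_left ℂ fun e => ?_
  obtain ⟨y, hydom, hy⟩ := h.exists_mem_domain_op (t := t)
    (isPrimitive_smul_const hχ e _)
    ((hχ.continuous_deriv le_rfl).smul continuous_const).continuousOn
    (by simp only [hχ₀ 0 (by simp), hχ₀ Real.pi (by simp), zero_smul, smul_zero])
  rw [← integral_inner hint, inner_zero_right, ← (Submodule.mem_orthogonal _ _).1 hg y hydom,
    L2.inner_def]
  refine integral_congr_ae ?_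
  filter_upwards [hy] with x hx
  rw [hx, inner_smul_left_eq_smul, inner_smul_right_eq_smul]

lemma residueVector_sub {ω : ℂ} {f k : ℝ → C2} (hf : IntervalIntegrable f volume 0 Real.pi)
    (hk : IntervalIntegrable k volume 0 Real.pi) :
    residueVector p q z ω (f - k) = residueVector p q z ω f - residueVector p q z ω k := by
  have hphi := (h.continuous_phi z).continuousOn (s := Icc 0 Real.pi)
  have hpsi := (h.continuous_psi z).continuousOn (s := Icc 0 Real.pi)
  rw [C2.ext_iff, PiLp.sub_apply, PiLp.sub_apply]
  simp only [residueVector_zero_eq, residueVector_one_eq, pairing_sub_left hf hk hphi,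
    pairing_sub_left hf hk hpsi]
  constructor <;> ring

lemma inner_eq_zero_of_residueVector_eq_zero (hω : multiplier t ^ 2 ≠ 1)
    (hD : discriminant p q z = multiplier t + (multiplier t)⁻¹) {Ψs w : L2 (Icc 0 Real.pi)}
    (hΨs : IsEigenvector (op p q t).adjoint (star z) Ψs)
    (hw : residueVector p q z (multiplier t) w = 0) : inner ℂ Ψs w = 0 := by
  obtain ⟨u, hu, hb⟩ := h.exists_isSolution_boundary_of_residueVector_eq_zero
    (multiplier_ne_zero t) hω hD (intervalIntegrable_coeFn_L2 Real.pi_pos.le w) hw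
  obtain ⟨y, hy⟩ := exists_L2_ae_eq (hu.continuousOn subset_rfl)
  exact inner_eq_zero_of_isEigenvector_adjoint (h.dense_domain_op t) hΨs
    (hu.mem_graph_op hb hy (EventuallyEq.refl _ w))

lemma residueVector_smul_sub_eq_zero
    (hD : discriminant p q z = multiplier t + (multiplier t)⁻¹) {g Y : L2 (Icc 0 Real.pi)}
    (hY : Y =ᵐ[volume.restrict (Icc 0 Real.pi)]
      fundamentalSolution p q z (residueVector p q z (multiplier t) g)) :
    residueVector p q z (multiplier t) (discriminantDeriv p q z • g - Y : L2 (Icc 0 Real.pi)) =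
      0 := by
  have hint := intervalIntegrable_coeFn_L2 Real.pi_pos.le g
  have hae := (Lp.coeFn_sub (discriminantDeriv p q z • g) Y).trans
    ((Lp.coeFn_smul (discriminantDeriv p q z) g).sub hY)
  rw [residueVector_congr _ hae, h.residueVector_sub (hint.smul _)
    ((h.continuous_fundamentalSolution z _).intervalIntegrable _ _), residueVector_smul,
    h.residueVector_fundamentalSolution
      (h.boundaryMatrix_mulVec_residueVector (multiplier_ne_zero t) hD g), sub_self]

lemma inner_eq_discriminantDeriv (hω : multiplier t ^ 2 ≠ 1)
    (hD : discriminant p q z = multiplier t + (multiplier t)⁻¹) {Ψs Y : L2 (Icc 0 Real.pi)}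
    (hΨs : IsEigenvector (op p q t).adjoint (star z) Ψs) (hnorm : ‖Ψs‖ = 1)
    (hY : Y =ᵐ[volume.restrict (Icc 0 Real.pi)]
      fundamentalSolution p q z (residueVector p q z (multiplier t) Ψs)) :
    inner ℂ Ψs Y = discriminantDeriv p q z := by
  have hperp := h.inner_eq_zero_of_residueVector_eq_zero hω hD hΨs
    (h.residueVector_smul_sub_eq_zero hD hY)
  rw [inner_sub_right, inner_smul_right, inner_self_eq_norm_sq_to_K, hnorm, sub_eq_zero] at hperp
  simpa using hperp.symm

lemma exists_ae_eq_fundamentalSolution {Ψ : L2 (Icc 0 Real.pi)}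
    (hΨ : IsEigenvector (op p q t) z Ψ) : ∃ v : C2, v ≠ 0 ∧
      boundaryMatrix p q z (multiplier t) *ᵥ v.ofLp = 0 ∧
      Ψ =ᵐ[volume.restrict (Icc 0 Real.pi)] fundamentalSolution p q z v := by
  obtain ⟨hΨ₀, hdom, hTΨ⟩ := hΨ
  obtain ⟨u, hu, hb, hΨu⟩ := exists_isSolution_zero_of_mem_graph_op
    (hTΨ ▸ (op p q t).mem_graph ⟨Ψ, hdom⟩)
  have hfund : ∀ x ∈ Icc 0 Real.pi, u x = fundamentalSolution p q z (u 0) x :=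
    fun x hx => h.eq_fundamentalSolution hu hx
  have hΨfund : Ψ =ᵐ[volume.restrict (Icc 0 Real.pi)] fundamentalSolution p q z (u 0) := by
    filter_upwards [hΨu, ae_restrict_mem measurableSet_Icc] with x hx hxI
    rw [hx, hfund x hxI]
  rw [hfund _ (right_mem_Icc.2 Real.pi_pos.le), h.fundamentalSolution_pi_eq_iff] at hb
  refine ⟨u 0, fun hu₀ => hΨ₀ ?_, hb, hΨfund⟩
  have hzero := h.smul_ae_eq_fundamentalSolution hΨfund 0
  rw [hu₀, smul_zero] at hzero
  rw [hu₀] at hΨfund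
  exact Lp.ext (hΨfund.trans (hzero.symm.trans (by rw [zero_smul])))

lemma norm_discriminantDeriv_le (R : ℝ) : ∃ C, ∀ (t : ℝ) (z : ℂ), ‖z‖ ≤ R →
    multiplier t ^ 2 ≠ 1 → ∀ Ψ Ψs : L2 (Icc 0 Real.pi), IsEigenvector (op p q t) z Ψ → ‖Ψ‖ = 1 →
      IsEigenvector (op p q t).adjoint (star z) Ψs → ‖Ψs‖ = 1 →
      ‖discriminantDeriv p q z‖ ≤ C * ‖(inner ℂ Ψs Ψ : ℂ)‖ := by
  obtain ⟨K, hK₀, hK⟩ := h.exists_norm_phi_psi_le R Real.pi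
  obtain ⟨C₁, hC₁, hint⟩ := exists_integral_norm_le_L2 Real.pi_pos.le
  obtain ⟨C₂, -, hnorm⟩ := exists_norm_L2_le 0 Real.pi
  refine ⟨C₂ * (4 * K ^ 2 * (2 * K + 1) * (C₁ * 1)), fun t z hz hω Ψ Ψs hΨ hΨn hΨs hΨsn => ?_⟩
  have hD := h.discriminant_eq_of_isEigenvalue ⟨Ψ, hΨ⟩
  obtain ⟨v, hv, hNv, hΨv⟩ := h.exists_ae_eq_fundamentalSolution hΨ
  obtain ⟨κ, hκ⟩ := h.exists_eq_smul_of_boundaryMatrix_mulVec hω hv hNv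
    (h.boundaryMatrix_mulVec_residueVector (multiplier_ne_zero t) hD Ψs)
  have hκΨ := h.smul_ae_eq_fundamentalSolution hΨv κ
  rw [← hκ] at hκΨ
  have hκnorm : ‖κ‖ ≤ C₂ * (4 * K ^ 2 * (2 * K + 1) * (C₁ * 1)) := by
    rw [show ‖κ‖ = ‖κ • Ψ‖ by rw [norm_smul, hΨn, mul_one]]
    exact hnorm _ _ _ (by positivity) hκΨ fun x hx =>
      h.norm_fundamentalSolution_residueVector_le (norm_multiplier t) (hK z hz)
        (intervalIntegrable_coeFn_L2 Real.pi_pos.le Ψs) (hΨsn ▸ hint Ψs) hx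
  rw [← h.inner_eq_discriminantDeriv hω hD hΨs hΨsn hκΨ, inner_smul_right, norm_mul]
  gcongr

end BddPotential

end AdjointEigenvectors

section GradientInequality

open Asymptotics

section AnalyticOrder

variable {𝕜 E : Type*} [NontriviallyNormedField 𝕜] [NormedAddCommGroup E] [NormedSpace 𝕜 E]
  {f : 𝕜 → E} {z₀ : 𝕜}

lemma isTheta_pow_of_analyticOrderAt_eq (hf : AnalyticAt 𝕜 f z₀) {n : ℕ}
    (hn : analyticOrderAt f z₀ = n) : f =Θ[𝓝 z₀] fun z => (z - z₀) ^ n := by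
  obtain ⟨g, hg, hg₀, hfg⟩ := hf.analyticOrderAt_eq_natCast.1 hn
  have hgθ : g =Θ[𝓝 z₀] fun _ => (1 : 𝕜) :=
    ((isEquivalent_const_iff_tendsto hg₀).2 hg.continuousAt).isTheta.trans
      (isTheta_const_const hg₀ one_ne_zero)
  refine EventuallyEq.trans_isTheta hfg
    (((isTheta_refl (fun z => (z - z₀) ^ n) (𝓝 z₀)).smul hgθ).trans_eventuallyEq ?_)
  exact Eventually.of_forall fun z => mul_one _

-- If `f - f z₀` vanishes to order `k + 1`, then `deriv f` vanishes to order `k`: `σ = k / (k + 1)`.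
lemma exists_rpow_isBigO_deriv [CharZero 𝕜] [CompleteSpace E] (hf : AnalyticAt 𝕜 f z₀)
    (hc : ¬∀ᶠ z in 𝓝 z₀, f z = f z₀) :
    ∃ σ : ℝ, 0 ≤ σ ∧ σ < 1 ∧ (fun z => ‖f z - f z₀‖ ^ σ) =O[𝓝 z₀] deriv f := by
  have hderiv := hf.analyticOrderAt_deriv_add_one
  have hsub : analyticOrderAt (f · - f z₀) z₀ ≠ ⊤ := by
    simpa only [ne_eq, analyticOrderAt_eq_top, sub_eq_zero] using hc
  obtain ⟨k, hk⟩ : ∃ k : ℕ, analyticOrderAt (deriv f) z₀ = k :=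
    ENat.ne_top_iff_exists.1 (fun htop => hsub (by rw [← hderiv, htop, top_add])) |>.imp
      fun _ => Eq.symm
  have hincr : (f · - f z₀) =O[𝓝 z₀] fun z => ‖z - z₀‖ ^ (k + 1) := by
    simp_rw [← norm_pow]
    refine (isTheta_pow_of_analyticOrderAt_eq (hf.fun_sub analyticAt_const) ?_).isBigO.norm_right
    rw [← hderiv, hk, Nat.cast_succ]
  have hpow : ∀ z, (‖z - z₀‖ ^ (k + 1)) ^ ((k : ℝ) / (k + 1)) = ‖(z - z₀) ^ k‖ := fun z => by
    rw [← Real.rpow_natCast, ← Real.rpow_mul (norm_nonneg _), Nat.cast_succ,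
      mul_div_cancel₀ _ k.cast_add_one_ne_zero, Real.rpow_natCast, norm_pow]
  refine ⟨k / (k + 1), by positivity, (div_lt_one (by positivity)).2 (lt_add_one _), ?_⟩
  refine (hincr.norm_left.rpow (by positivity) (Eventually.of_forall fun _ => by positivity)).trans
    ?_
  simp_rw [hpow]
  exact (isTheta_pow_of_analyticOrderAt_eq hf.deriv hk).symm.isBigO.norm_left

end AnalyticOrder

lemma sub_isBigO_multiplier_add_inv_sub {t : ℝ} (ht : Real.sin (Real.pi * t) ≠ 0) :
    (fun s => s - t) =O[𝓝 t] fun s : ℝ =>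
      multiplier s + (multiplier s)⁻¹ - (multiplier t + (multiplier t)⁻¹) := by
  have hcos : (fun s => s - t) =O[𝓝 t]
      fun s => Real.cos (Real.pi * s) - Real.cos (Real.pi * t) := by
    simpa [prod_pure, Function.comp_def] using ((hasDerivAt_cos_pi_mul t).isTheta_sub
      (mul_ne_zero (neg_ne_zero.2 ht) Real.pi_ne_zero)).isBigO_symm
  refine hcos.trans (IsBigO.of_bound 1 (Eventually.of_forall fun s => ?_))
  rw [multiplier_add_inv, multiplier_add_inv, ← Complex.ofReal_sub, Complex.norm_real, ← mul_sub,
    norm_mul, Real.norm_two, one_mul]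
  exact le_mul_of_one_le_left (norm_nonneg _) one_le_two

lemma integrableOn_abs_sub_rpow {r : ℝ} (hr : -1 < r) (t : ℝ) {ε : ℝ} (hε : 0 < ε) :
    IntegrableOn (fun s => |s - t| ^ r) (Ioo (t - ε) (t + ε)) := by
  have hright : IntervalIntegrable (fun x : ℝ => |x| ^ r) volume 0 ε :=
    (intervalIntegral.intervalIntegrable_rpow' hr).congr fun x hx => by
      rw [uIoc_of_le hε.le] at hx
      simp only [abs_of_pos hx.1]
  have hleft : IntervalIntegrable (fun x : ℝ => |x| ^ r) volume (-ε) 0 := by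
    simpa [div_neg] using (hright.comp_mul_left (c := -1)).symm
  have hint := (hleft.trans hright).comp_sub_right t
  rw [show -ε + t = t - ε by ring, show ε + t = t + ε by ring] at hint
  exact (intervalIntegrable_iff_integrableOn_Ioo_of_le (by linarith)).1 hint

lemma exists_lintegral_enorm_inv_lt_top {E : Type*} [NormedAddCommGroup E] {t σ : ℝ} (hσ : σ < 1)
    {α : ℝ → E} (hα : (fun s => |s - t| ^ σ) =O[𝓝 t] α) :
    ∃ ε > 0, ∫⁻ s in Ioo (t - ε) (t + ε), ‖α s‖ₑ⁻¹ < ⊤ := by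
  obtain ⟨C, hC, hα⟩ := hα.exists_pos
  obtain ⟨ε, hε, hball⟩ := Metric.eventually_nhds_iff_ball.1 hα.bound
  rw [Real.ball_eq_Ioo] at hball
  refine ⟨ε, hε, lt_of_le_of_lt (lintegral_mono_ae ?_)
    ((integrableOn_abs_sub_rpow (r := -σ) (by linarith) t hε).const_mul C).lintegral_lt_top⟩
  filter_upwards [ae_restrict_mem measurableSet_Ioo,
    ae_restrict_of_ae (Measure.ae_ne volume t)] with s hs hst
  have hpow : 0 < |s - t| ^ σ := Real.rpow_pos_of_pos (abs_pos.2 (sub_ne_zero.2 hst)) σ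
  have hbound := hball s hs
  rw [Real.norm_of_nonneg hpow.le] at hbound
  have hpos : 0 < ‖α s‖ := pos_of_mul_pos_right (hpow.trans_le hbound) hC.le
  rw [← ofReal_norm, ← ENNReal.ofReal_inv_of_pos hpos]
  refine ENNReal.ofReal_le_ofReal ?_
  rw [Real.rpow_neg (abs_nonneg _), ← div_eq_mul_inv, le_div_iff₀ hpow, inv_mul_le_iff₀ hpos,
    mul_comm]
  exact hbound

namespace BddPotential

variable {p q : ℝ → ℂ} {B : ℝ} (h : BddPotential p q B)
include h

lemma exists_abs_sub_rpow_isBigO_inner {t δ : ℝ} (hδ : 0 < δ)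
    (ht : Real.sin (Real.pi * t) ≠ 0) {lam : ℝ → ℂ} {Ψ Ψs : ℝ → L2 (Icc 0 Real.pi)}
    (hbr : IsBlochBranch p q (Ioo (t - δ) (t + δ)) lam Ψ Ψs) :
    ∃ σ : ℝ, σ < 1 ∧ (fun s => |s - t| ^ σ) =O[𝓝 t] fun s => (inner ℂ (Ψs s) (Ψ s) : ℂ) := by
  have hI : Ioo (t - δ) (t + δ) ∈ 𝓝 t := Ioo_mem_nhds (by linarith) (by linarith)
  have hD : ∀ s ∈ Ioo (t - δ) (t + δ),
      discriminant p q (lam s) = multiplier s + (multiplier s)⁻¹ := fun s hs =>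
    h.discriminant_eq_of_isEigenvalue ⟨Ψ s, hbr.eigen s hs⟩
  have hDt := hD t (mem_of_mem_nhds hI)
  have hlam : Tendsto lam (𝓝 t) (𝓝 (lam t)) := hbr.continuousOn.continuousAt hI
  obtain ⟨σ, hσ₀, hσ₁, hgrad⟩ := exists_rpow_isBigO_deriv
    (h.analyticOnNhd_discriminant (lam t) trivial) (h.not_eventually_discriminant_eq hDt)
  obtain ⟨C, hC⟩ := h.norm_discriminantDeriv_le (‖lam t‖ + 1)
  have hincr : (fun s => |s - t| ^ σ) =O[𝓝 t]
      fun s => ‖discriminant p q (lam s) - discriminant p q (lam t)‖ ^ σ := by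
    refine ((sub_isBigO_multiplier_add_inv_sub ht).norm_norm.rpow hσ₀
      (Eventually.of_forall fun _ => norm_nonneg _)).congr' (.of_forall fun _ => rfl) ?_
    filter_upwards [hI] with s hs
    rw [hD s hs, hDt]
  have hinner : (fun s => discriminantDeriv p q (lam s)) =O[𝓝 t]
      fun s => (inner ℂ (Ψs s) (Ψ s) : ℂ) := by
    refine IsBigO.of_bound C ?_
    filter_upwards [hI, hlam.norm.eventually_lt_const (lt_add_one _),
      (continuous_multiplier_ofReal.pow 2).continuousAt.eventually_ne
        (mt multiplier_sq_eq_one_iff.1 ht)] with s hs hnorm hω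
    exact hC s (lam s) hnorm.le hω _ _ (hbr.eigen s hs) (hbr.norm_eigen s hs)
      (hbr.eigen_adjoint s hs) (hbr.norm_eigen_adjoint s hs)
  rw [h.deriv_discriminant] at hgrad
  exact ⟨σ, hσ₁, (hincr.trans (hgrad.comp_tendsto hlam)).trans hinner⟩

lemma not_isESS {z₀ : ℂ} (hz₀ : discriminant p q z₀ ^ 2 ≠ 4) : ¬IsESS p q z₀ := by
  rintro ⟨t, -, δ, hδ, lam, Ψ, Ψs, hbr, rfl, htop⟩
  have hIt : t ∈ Ioo (t - δ) (t + δ) := ⟨by linarith, by linarith⟩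
  rw [h.discriminant_eq_of_isEigenvalue ⟨Ψ t, hbr.eigen t hIt⟩, ne_eq,
    add_inv_sq_eq_four_iff (multiplier_ne_zero t), multiplier_sq_eq_one_iff] at hz₀
  obtain ⟨σ, hσ, hα⟩ := h.exists_abs_sub_rpow_isBigO_inner hδ hz₀ hbr
  obtain ⟨ε, hε, hint⟩ := exists_lintegral_enorm_inv_lt_top hσ hα
  exact hint.ne (htop ε hε)

end BddPotential

end GradientInequality

section UnboundedOperator

variable {E : Type*} [NormedAddCommGroup E] [NormedSpace ℂ E]

lemma mem_spectrum_of_forall_exists_mem_graph {T : E →ₗ.[ℂ] E} {z : ℂ}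
    (h : ∀ C : ℝ, ∃ y w : E, (y, w + z • y) ∈ T.graph ∧ C * ‖w‖ < ‖y‖) : z ∈ spectrum T := by
  rintro ⟨R, -, hR⟩
  obtain ⟨y, w, hyw, hlt⟩ := h ‖R‖
  obtain ⟨y', rfl, hTy⟩ := (LinearPMap.mem_graph_iff _).1 hyw
  have hRw : R w = y' := by simpa only [hTy, add_sub_cancel_right] using hR y'
  exact hlt.not_ge (hRw ▸ R.le_opNorm w)

end UnboundedOperator

section Cutoff

lemma exists_cutoff : ∃ D : ℝ, ∀ L : ℝ, 0 < L → ∃ X : ℝ → ℂ, ContDiff ℝ 1 X ∧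
    tsupport X ⊆ Icc (-(2 * L)) (2 * L) ∧ (∀ x ∈ Icc 0 L, X x = 1) ∧
      ∀ x, ‖deriv X x‖ ≤ D / L := by
  let f : ContDiffBump (0 : ℝ) := ⟨1, 2, one_pos, one_lt_two⟩
  have hf : ContDiff ℝ 1 fun x => (f x : ℂ) := Complex.ofRealCLM.contDiff.comp f.contDiff
  have hfs : HasCompactSupport fun x => (f x : ℂ) :=
    f.hasCompactSupport.comp_left Complex.ofReal_zero
  obtain ⟨D, hD⟩ := hfs.deriv.exists_bound_of_continuous (hf.continuous_deriv le_rfl)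
  refine ⟨D, fun L hL => ⟨fun x => f (L⁻¹ * x), hf.comp (contDiff_const.mul contDiff_id),
    closure_minimal (fun x hx => ?_) isClosed_Icc, fun x hx => ?_, fun x => ?_⟩⟩
  · have hfx : f (L⁻¹ * x) ≠ 0 := fun h0 => hx (by simp only [h0, Complex.ofReal_zero])
    have hlt : |L⁻¹ * x| < 2 := by
      simpa [f, Real.dist_eq] using lt_of_not_ge (mt f.zero_of_le_dist hfx)
    rw [abs_mul, abs_of_pos (inv_pos.2 hL), inv_mul_lt_iff₀ hL] at hlt
    rw [mem_Icc, ← abs_le]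
    linarith
  · have hle : |L⁻¹ * x| ≤ 1 := by
      rw [abs_of_nonneg (mul_nonneg (inv_nonneg.2 hL.le) hx.1), inv_mul_le_iff₀ hL, mul_one]
      exact hx.2
    simp [f.one_of_mem_closedBall (x := L⁻¹ * x) (by simpa [f, Real.dist_eq] using hle)]
  · rw [deriv_comp_mul_left L⁻¹ fun x => (f x : ℂ), norm_smul, norm_inv,
      Real.norm_of_nonneg hL.le, div_eq_inv_mul]
    gcongr
    exact hD _

variable {X : ℝ → ℂ} {u g : ℝ → C2}

lemma IsPrimitive.fun_smul (hX : ContDiff ℝ 1 X) (hu : IsPrimitive univ u g) :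
    IsPrimitive univ (fun x => X x • u x) (fun x => deriv X x • u x + X x • g x) := by
  intro a _ b _
  have hX' : IntervalIntegrable (deriv X) volume a b :=
    (hX.continuous_deriv le_rfl).intervalIntegrable a b
  have hXp (x : ℝ) : X x = X a + ∫ y in a..x, deriv X y := by
    rw [intervalIntegral.integral_deriv_of_contDiffOn_uIcc hX.contDiffOn]
    ring
  have hgi := (hu a (mem_univ a) b (mem_univ b)).1
  have hI : IntervalIntegrable (fun x => deriv X x • u x + X x • g x) volume a b :=
    ((hX.continuous_deriv le_rfl).continuousOn.smul
      (hu.continuousOn (subset_univ _))).intervalIntegrable.add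
      (hgi.continuousOn_smul hX.continuous.continuousOn)
  have hcoord (i : Fin 2) :
      (X b • u b - X a • u a) i = (∫ x in a..b, (deriv X x • u x + X x • g x)) i :=
    (mul_sub_mul_eq_integral_of_eq_primitive hX' (intervalIntegrable_apply hgi i)
      (fun x _ => hXp x) fun x _ => hu.apply_eq_add_integral (mem_univ a) (mem_univ x) i).2.trans
      ((EuclideanSpace.proj (𝕜 := ℂ) i).intervalIntegral_comp_comm hI)
  exact ⟨hI, C2.ext_iff.2 ⟨hcoord 0, hcoord 1⟩⟩

lemma diracExpr_fun_smul (p q : ℝ → ℂ) (X X' : ℝ → ℂ) (u g : ℝ → C2) (x : ℝ) :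
    diracExpr p q (fun x => X x • u x) (fun x => X' x • u x + X x • g x) x =
      X x • diracExpr p q u g x - X' x • negJ (u x) := by
  refine C2.ext_iff.2 ⟨?_, ?_⟩ <;>
    simp only [diracExpr_apply_zero, diracExpr_apply_one, PiLp.add_apply, PiLp.sub_apply,
      PiLp.smul_apply, smul_eq_mul, negJ_apply_zero, negJ_apply_one] <;>
    ring

lemma norm_sq_eq_integral {y : L2 univ} {v : ℝ → C2} (hy : y =ᵐ[volume.restrict univ] v) :
    ‖y‖ ^ 2 = ∫ x, ‖v x‖ ^ 2 := by
  have hC : ((‖y‖ ^ 2 : ℝ) : ℂ) = ((∫ x, ‖v x‖ ^ 2 : ℝ) : ℂ) := by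
    have hinner := L2.inner_def (𝕜 := ℂ) y y
    rw [inner_self_eq_norm_sq_to_K] at hinner
    rw [← integral_complex_ofReal]
    push_cast
    refine hinner.trans ((integral_congr_ae ?_).trans setIntegral_univ)
    filter_upwards [hy] with x hx
    rw [hx, inner_self_eq_norm_sq_to_K]
    rfl
  exact_mod_cast hC

lemma exists_mem_graph_opLine_of_cutoff {p q : ℝ → ℂ} {z : ℂ} (hX : ContDiff ℝ 1 X)
    (hXs : HasCompactSupport X) (hu : IsSolution p q univ z 0 u) :
    ∃ y w : L2 univ, (y, w + z • y) ∈ (opLine p q).graph ∧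
      y =ᵐ[volume.restrict univ] (fun x => X x • u x) ∧
      w =ᵐ[volume.restrict univ] fun x => -(deriv X x • negJ (u x)) := by
  have huc : Continuous u := hu.continuous
  have hX'c : Continuous (deriv X) := hX.continuous_deriv le_rfl
  obtain ⟨g, hg, hd⟩ := hu
  have hy : MemLp (fun x => X x • u x) 2 (volume.restrict univ) :=
    (hX.continuous.smul huc).memLp_of_hasCompactSupport hXs.smul_right
  have hw : MemLp (fun x => -(deriv X x • negJ (u x))) 2 (volume.restrict univ) :=
    (hX'c.smul (negJ.continuous.comp huc)).neg.memLp_of_hasCompactSupport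
      hXs.deriv.smul_right.neg
  refine ⟨hy.toLp, hw.toLp, ?_, hy.coeFn_toLp, hw.coeFn_toLp⟩
  rw [opLine_graph]
  refine ⟨_, _, hg.fun_smul hX, trivial, hy.coeFn_toLp, ?_⟩
  filter_upwards [hd, Lp.coeFn_add hw.toLp (z • hy.toLp), Lp.coeFn_smul z hy.toLp, hy.coeFn_toLp,
    hw.coeFn_toLp] with x hx hadd hsmul hyx hwx
  rw [hadd, Pi.add_apply, hsmul, Pi.smul_apply, hyx, hwx, diracExpr_fun_smul, hx, Pi.zero_apply,
    add_zero, smul_comm z, neg_add_eq_sub]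

lemma integral_norm_sq_le_of_eq_zero_off_Icc {v : ℝ → C2} {a b M : ℝ} (hab : a ≤ b)
    (hv : ∀ x ∉ Icc a b, v x = 0) (hM : ∀ x, ‖v x‖ ≤ M) :
    ∫ x, ‖v x‖ ^ 2 ≤ M ^ 2 * (b - a) := by
  rw [← setIntegral_eq_integral_of_forall_compl_eq_zero (s := Icc a b)
    fun x hx => by rw [hv x hx, norm_zero, zero_pow two_ne_zero]]
  have hbound := norm_setIntegral_le_of_norm_le_const (μ := volume) (s := Icc a b)
    (f := fun x => ‖v x‖ ^ 2) (C := M ^ 2) measure_Icc_lt_top fun x _ => by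
      rw [norm_pow, norm_norm]
      gcongr
      exact hM x
  rw [Real.volume_real_Icc_of_le hab] at hbound
  exact (le_abs_self _).trans hbound

lemma integral_norm_sq_le_integral_norm_sq_smul {L : ℝ} (hX : Continuous X)
    (hXc : HasCompactSupport X) (hu : Continuous u) (hL : 0 ≤ L) (hX1 : ∀ x ∈ Icc 0 L, X x = 1) :
    ∫ x in (0 : ℝ)..L, ‖u x‖ ^ 2 ≤ ∫ x, ‖X x • u x‖ ^ 2 := by
  have hint : Integrable fun x => ‖X x • u x‖ ^ 2 :=
    ((hX.smul hu).norm.pow 2).integrable_of_hasCompactSupport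
      (hXc.mono fun x hx hx0 => hx (by simp [hx0]))
  have hcongr : ∫ x in Ioc 0 L, ‖u x‖ ^ 2 = ∫ x in Ioc 0 L, ‖X x • u x‖ ^ 2 :=
    setIntegral_congr_fun measurableSet_Ioc fun x hx => by
      rw [hX1 x (Ioc_subset_Icc_self hx), one_smul]
  rw [intervalIntegral.integral_of_le hL, hcongr]
  exact setIntegral_le_integral hint (Eventually.of_forall fun x => by positivity)

lemma mem_spectrum_opLine_of_bounded {p q : ℝ → ℂ} {z : ℂ} {M : ℝ}
    (hu : IsSolution p q univ z 0 u) (hM : ∀ x, ‖u x‖ ≤ M)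
    (hinf : Tendsto (fun L => ∫ x in (0 : ℝ)..L, ‖u x‖ ^ 2) atTop atTop) :
    z ∈ spectrum (opLine p q) := by
  have huc : Continuous u := hu.continuous
  obtain ⟨D, hD⟩ := exists_cutoff
  refine mem_spectrum_of_forall_exists_mem_graph fun C => ?_
  obtain ⟨L, hL, hL1⟩ := ((hinf.eventually_gt_atTop (C ^ 2 * (4 * (D * (‖negJ‖ * M)) ^ 2))).and
    (eventually_ge_atTop 1)).exists
  have hL0 : 0 < L := one_pos.trans_le hL1
  obtain ⟨X, hX, hXs, hX1, hX'⟩ := hD L hL0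
  have hXc : HasCompactSupport X := isCompact_Icc.of_isClosed_subset isClosed_closure hXs
  obtain ⟨y, w, hyw, hy, hw⟩ := exists_mem_graph_opLine_of_cutoff hX hXc hu
  refine ⟨y, w, hyw, lt_of_pow_lt_pow_left₀ 2 (norm_nonneg y) ?_⟩
  have hlower : ∫ x in (0 : ℝ)..L, ‖u x‖ ^ 2 ≤ ‖y‖ ^ 2 :=
    (integral_norm_sq_le_integral_norm_sq_smul hX.continuous hXc huc hL0.le hX1).trans_eq
      (norm_sq_eq_integral hy).symm
  have hupper : ‖w‖ ^ 2 ≤ 4 * (D * (‖negJ‖ * M)) ^ 2 := by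
    have hbound (x : ℝ) : ‖-(deriv X x • negJ (u x))‖ ≤ D / L * (‖negJ‖ * M) := by
      rw [norm_neg, norm_smul]
      exact mul_le_mul (hX' x) ((negJ.le_opNorm _).trans (by gcongr; exact hM x)) (norm_nonneg _)
        ((norm_nonneg _).trans (hX' x))
    have hoff (x : ℝ) (hx : x ∉ Icc (-(2 * L)) (2 * L)) : -(deriv X x • negJ (u x)) = 0 := by
      rw [Function.notMem_support.1 fun h => hx (hXs (support_deriv_subset h)), zero_smul, neg_zero]
    calc ‖w‖ ^ 2 ≤ (D / L * (‖negJ‖ * M)) ^ 2 * (2 * L - -(2 * L)) :=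
          norm_sq_eq_integral hw ▸
            integral_norm_sq_le_of_eq_zero_off_Icc (by linarith) hoff hbound
      _ = 4 * (D * (‖negJ‖ * M)) ^ 2 / L := by field_simp; ring
      _ ≤ 4 * (D * (‖negJ‖ * M)) ^ 2 := div_le_self (by positivity) hL1
  calc (C * ‖w‖) ^ 2 = C ^ 2 * ‖w‖ ^ 2 := mul_pow C ‖w‖ 2
    _ ≤ C ^ 2 * (4 * (D * (‖negJ‖ * M)) ^ 2) := by gcongr
    _ < ∫ x in (0 : ℝ)..L, ‖u x‖ ^ 2 := hL
    _ ≤ ‖y‖ ^ 2 := hlower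

end Cutoff

section Floquet

variable {p q : ℝ → ℂ} {T : ℝ} {z : ℂ} {u : ℝ → C2}

lemma IsSolution.comp_add_period (hp : Function.Periodic p T) (hq : Function.Periodic q T)
    (hu : IsSolution p q univ z 0 u) : IsSolution p q univ z 0 (fun x => u (x + T)) := by
  obtain ⟨g, hg, hd⟩ := hu
  refine ⟨fun x => g (x + T), fun a _ b _ => ?_, ?_⟩
  · obtain ⟨hgi, hint⟩ := hg (a + T) (mem_univ _) (b + T) (mem_univ _)
    exact ⟨by simpa only [add_sub_cancel_right] using hgi.comp_add_right T, by
      rw [intervalIntegral.integral_comp_add_right (fun x => g x), ← hint]⟩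
  · rw [Measure.restrict_univ] at hd ⊢
    filter_upwards [(measurePreserving_add_right volume T).quasiMeasurePreserving.ae hd] with x hx
    simpa only [diracExpr, hp x, hq x, Pi.zero_apply] using hx

variable {B : ℝ} (h : BddPotential p q B)
include h

lemma BddPotential.eq_zero_of_apply_zero_eq_zero (hu : IsSolution p q univ z 0 u)
    (h0 : u 0 = 0) (x : ℝ) : u x = 0 := by
  have hwr {v : ℝ → C2} (hv : IsSolution p q univ z 0 v) : wronskian (u x) (v x) = 0 := by
    simpa [h0, wronskian, dot_zero, zero_dot] using
      hu.wronskian_sub_wronskian hv (subset_univ (uIcc 0 x))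
  have hexp := wronskian_smul_eq (u x) (phi p q z x) (psi p q z x)
  rwa [h.wronskian_phi_psi, hwr (h.isSolution_phi z univ), hwr (h.isSolution_psi z univ), one_smul,
    zero_smul, zero_smul, sub_zero] at hexp

lemma BddPotential.apply_add_period (hp : Function.Periodic p T) (hq : Function.Periodic q T)
    {ω : ℂ} (hu : IsSolution p q univ z 0 u) (hb : u T = ω • u 0) (x : ℝ) :
    u (x + T) = ω • u x := by
  have hdiff : IsSolution p q univ z 0 ((fun x => u (x + T)) + -ω • u) := by
    simpa only [smul_zero, add_zero] using (hu.comp_add_period hp hq).add (hu.smul (-ω))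
  have hzero := h.eq_zero_of_apply_zero_eq_zero hdiff (by simp [hb]) x
  rwa [Pi.add_apply, Pi.smul_apply, neg_smul, add_neg_eq_zero] at hzero

lemma BddPotential.mem_spectrum_opLine (hp : Function.Periodic p T) (hq : Function.Periodic q T)
    (hT : 0 < T) {ω : ℂ} (hω : ‖ω‖ = 1) (hu : IsSolution p q univ z 0 u) (hb : u T = ω • u 0)
    (h0 : u 0 ≠ 0) : z ∈ spectrum (opLine p q) := by
  have huc : Continuous u := hu.continuous
  have hper : Function.Periodic (fun x => ‖u x‖) T := fun x => by
    simp only [h.apply_add_period hp hq hu hb, norm_smul, hω, one_mul]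
  obtain ⟨M, hM⟩ := (hper.isBounded_of_continuous hT.ne' huc.norm).exists_norm_le
  refine mem_spectrum_opLine_of_bounded hu (M := M) (fun x => ?_) ?_
  · simpa only [norm_norm] using hM _ (mem_range_self x)
  · exact (hper.comp (· ^ 2)).tendsto_atTop_intervalIntegral_of_pos
      (integral_norm_sq_pos hT huc.continuousOn h0) hT

end Floquet

lemma sin_pi_mul_ne_zero {t : ℝ} (ht : t ∈ Ioo (-1 : ℝ) 1) (h0 : t ≠ 0) :
    Real.sin (Real.pi * t) ≠ 0 := by
  have hlt : |Real.pi * t| < Real.pi := by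
    rw [abs_mul, abs_of_pos Real.pi_pos]
    exact mul_lt_of_lt_one_right Real.pi_pos (abs_lt.2 ht)
  exact mt (Real.sin_eq_zero_iff_of_lt_of_lt (abs_lt.1 hlt).1 (abs_lt.1 hlt).2).1
    (mul_ne_zero Real.pi_ne_zero h0)

theorem theorem3_general {p q : ℝ → ℂ} {B : ℝ} (hp : Function.Periodic p Real.pi)
    (hq : Function.Periodic q Real.pi) (h : BddPotential p q B) {t₀ : ℝ}
    (ht₀ : t₀ ∈ Ioc (-1 : ℝ) 1) (h0 : t₀ ≠ 0) (h1 : t₀ ≠ 1) {lam₀ : ℂ}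
    (hlam₀ : IsEigenvalue (op p q t₀) lam₀) (hmult : 2 ≤ algMultiplicity (op p q t₀) lam₀) :
    IsSpectralSingularity p q lam₀ ∧ ¬IsESS p q lam₀ := by
  have ht : t₀ ∈ Ioo (-1 : ℝ) 1 := ⟨ht₀.1, ht₀.2.lt_of_ne h1⟩
  have hsin : Real.sin (Real.pi * t₀) ≠ 0 := sin_pi_mul_ne_zero ht h0
  have hω : multiplier t₀ ^ 2 ≠ 1 := mt multiplier_sq_eq_one_iff.1 hsin
  have hD : discriminant p q lam₀ = multiplier t₀ + (multiplier t₀)⁻¹ :=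
    h.discriminant_eq_of_isEigenvalue hlam₀
  have hF : discriminantDeriv p q lam₀ = 0 := by
    by_contra hF
    exact absurd (hmult.trans (h.algMultiplicity_le_one (fun _ => hω) hF)) (by norm_num)
  refine ⟨⟨?_, fun ε hε => h.exists_contours ht hsin hD hF hε⟩, h.not_isESS ?_⟩
  · obtain ⟨v, hv, hNv⟩ := h.exists_boundaryMatrix_mulVec_eq_zero (multiplier_ne_zero t₀) hD
    have hv₀ : fundamentalSolution p q lam₀ v 0 = v := h.fundamentalSolution_zero lam₀ v
    refine h.mem_spectrum_opLine hp hq Real.pi_pos (norm_multiplier t₀)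
      (h.isSolution_fundamentalSolution lam₀ v univ) ?_ (hv₀.symm ▸ hv)
    rw [hv₀, h.fundamentalSolution_pi_eq_iff lam₀ v]
    exact hNv
  · rwa [hD, Ne, add_inv_sq_eq_four_iff (multiplier_ne_zero t₀)]

end Dirac

theorem theorem3 (p q : ℝ → ℂ)
    (hp : Function.Periodic p Real.pi) (hq : Function.Periodic q Real.pi)
    (hpv : BoundedVariationOn p (Set.Icc 0 Real.pi))
    (hqv : BoundedVariationOn q (Set.Icc 0 Real.pi))
    (t₀ : ℝ) (ht₀ : t₀ ∈ Set.Ioc (-1 : ℝ) 1) (h0 : t₀ ≠ 0) (h1 : t₀ ≠ 1)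
    (lam₀ : ℂ) (hlam₀ : Dirac.IsEigenvalue (Dirac.op p q t₀) lam₀)
    (hmult : 2 ≤ Dirac.algMultiplicity (Dirac.op p q t₀) lam₀) :
    Dirac.IsSpectralSingularity p q lam₀ ∧ ¬ Dirac.IsESS p q lam₀ := by
  obtain ⟨_, h⟩ := Dirac.exists_bddPotential Real.pi_pos hp hq hpv hqv
  exact Dirac.theorem3_general hp hq h ht₀ h0 h1 hlam₀ hmult
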